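/- Let $d\in\{1,2\}$, $H,g,T>0$, $s\ge 0$, $k\in\mathbb N^*$ and $\nu\in\{2k,2k+1\}$, and let $\mathcal S=\mathbb R^d\times(-H,0)$ with points $(X,z)$; $\nabla$ and $\Delta$ act in $X$ only. For $m\in\mathbb N$ let $H^{s,m}$ be the space of functions on $\mathcal S$ with $\sum_{j=0}^m\|(1-\Delta)^{(s-j)/2}\partial_z^j u\|_{L^2(\mathcal S)}<\infty$. Let $\rho_{\rm eq}\in W^{\nu,\infty}(-H,0)$ (identified with its continuous representative on $[-H,0]$) be positive and such that $N^2=-\frac{\rho_{\rm eq}'}{\rho_{\rm eq}}g$ is a positive constant. Let $({\bf f}_n)_{n\ge1}$ be the orthonormal basis of $L^2((-H,0),\rho_{\rm eq}N^2dz)$ formed by the eigenfunctions of $$(\rho_{\rm eq}{\bf f}_n')'+\frac{\rho_{\rm eq}N^2}{c_n^2}{\bf f}_n=0,\qquad {\bf f}_n(-H)={\bf f}_n(0)=0,\qquad c_1>c_2>\dots>0,$$ and ${\bf g}_n=c_n{\bf f}_n'$ for $n\ge 1$. Let $V$ (with values in $\mathbb R^d$), $w$ and $\rho$ belong to $C([0,T];H^{s,\nu})$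 and solve, for some pressure $P$, in the sense of distributions, $$\partial_tV+\tfrac1{\rho_{\rm eq}}\nabla P=0,\quad \partial_tw+\tfrac1{\rho_{\rm eq}}\partial_zP+\tfrac{\rho}{\rho_{\rm eq}}g=0,\quad \partial_t\rho+\rho_{\rm eq}'w=0,\quad \nabla\cdot V+\partial_zw=0,$$ with $w=0$ at $z=-H$ and $z=0$. Denote by $V^0,w^0,\rho^0$ the values at $t=0$, and assume that $V^0$ has zero vertical vorticity, $\nabla^\perp\cdot V^0=0$ (a void condition if $d=1$). Let $$T_1=\partial_z\Big(\tfrac1{-\rho_{\rm eq}'}\partial_z(\rho_{\rm eq}\,\cdot)\Big),\qquad T_2=\partial_z\Big(\rho_{\rm eq}\partial_z\big(\tfrac1{-\rho_{\rm eq}'}\,\cdot\big)\Big),\qquad T_2^*=\tfrac1{-\rho_{\rm eq}'}\partial_z(\rho_{\rm eq}\partial_z\,\cdot),$$ $T_2^*$ being the adjoint of $T_2$ for the $L^2((-H,0),dz)$ scalar product. Assume that the following traces vanish at $z=-H$ and at $z=0$: $$\partial_zT_1^{l-1}V^0=0\ \ (1\le l\le k),\qquad (T_2^*)^lw^0=0\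 \ (0\le l\le k),\qquad T_2^l\rho^0=0\ \ (0\le l\le k,\ 2l<\nu).$$ (When $\nu=2k$, the trace of $(T_2^*)^kw^0$ is well defined because $\partial_z w^0=-\nabla\cdot V^0$; the trace of $T_2^k\rho^0$ is not defined in general and is not required.) Define the modal coefficients $w_n=\int_{-H}^0 w\,{\bf f}_n\,\rho_{\rm eq}N^2dz$, $V_n=\int_{-H}^0V\,{\bf g}_n\,\rho_{\rm eq}dz$ and $\rho_n=g\int_{-H}^0\rho\,{\bf f}_n\,dz$, that is, the coefficients of the expansions $w=\sum w_n{\bf f}_n$, $V=\sum V_n{\bf g}_n$, $\rho=\sum\frac1g\rho_n\rho_{\rm eq}N^2{\bf f}_n$. Then, for every $t\in[0,T]$, $$\sum_{n=1}^\infty\Big[\frac1{c_n^{2\nu}}|\rho_n(t)|_{H^{s-\nu}(\mathbb R^d)}^2+\frac1{c_n^{2\nu}}|V_n(t)|_{H^{s-\nu}(\mathbb R^d)}^2+\frac1{c_n^{2\nu}}|w_n(t)|_{H^{s-\nu}(\mathbb R^d)}^2\Big]<\infty .$$ -/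

import Mathlib

open MeasureTheory Set Filter Topology
open scoped ContDiff SchwartzMap ENNReal

noncomputable section

namespace StratifiedFluid

/-- The horizontal space `ℝ^d`. -/
abbrev Horiz (d : ℕ) : Type := EuclideanSpace ℝ (Fin d)

/-- The strip `ℝ^d × (-H, 0)`; its points are pairs `(X, z)`. -/
def strip (d : ℕ) (H : ℝ) : Set (Horiz d × ℝ) := univ ×ˢ Ioo (-H) 0

/-- Real test functions: smooth, with compact support contained in `Ω`. -/
def IsTestFunction {X : Type*} [NormedAddCommGroup X] [NormedSpace ℝ X]
    (Ω : Set X) (φ : X → ℝ) : Prop :=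
  ContDiff ℝ ∞ φ ∧ HasCompactSupport φ ∧ tsupport φ ⊆ Ω

/-! ### Function spaces -/

/-- The symbol `(1 + |2πξ|²)^{r/2}` of `Λ^r = (1 - Δ)^{r/2}`; the factor `2π` comes from the
normalisation `𝓕 χ (ξ) = ∫ exp (-2πi x·ξ) χ(x) dx` of the Fourier transform. -/
def lambdaSymbol (d : ℕ) (r : ℝ) (ξ : Horiz d) : ℝ :=
  (1 + ‖(2 * Real.pi) • ξ‖ ^ 2) ^ (r / 2)

theorem lambdaSymbol_hasTemperateGrowth (d : ℕ) (r : ℝ) :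
    (lambdaSymbol d r).HasTemperateGrowth := by
  have h : (fun x : Horiz d => (1 + ‖x‖ ^ 2) ^ (r / 2)).HasTemperateGrowth := by fun_prop
  have h2 : (fun x : Horiz d => (2 * Real.pi) • x).HasTemperateGrowth := by fun_prop
  exact h.comp h2

/-- The operator `Λ^r = (1 - Δ)^{r/2}` on Schwartz functions of the horizontal variable. -/
def lambdaPow (d : ℕ) (r : ℝ) : 𝓢(Horiz d, ℂ) →L[ℂ] 𝓢(Horiz d, ℂ) :=
  SchwartzMap.fourierMultiplierCLM ℂ (fun ξ : Horiz d => ((lambdaSymbol d r ξ : ℝ) : ℂ))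

/-- `Λ^r f = v` in the sense of tempered distributions on `ℝ^d`
(`Λ^r` is symmetric for the bilinear pairing `∫ f χ`). -/
def IsLambdaPow {d : ℕ} (r : ℝ) (f : Horiz d → ℝ) (v : Lp ℂ 2 (volume : Measure (Horiz d))) :
    Prop :=
  ∀ χ : 𝓢(Horiz d, ℂ), ∫ X, (f X : ℂ) * lambdaPow d r χ X = ∫ X, v X * χ X

/-- The square `|f|²_{H^r} = |Λ^r f|²_{L²}` of the `H^r(ℝ^d)` norm of a function `f ∈ L²(ℝ^d)`,
for any real `r`; it is `∞` if `Λ^r f` is not in `L²`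
(the element `v` is unique, so that the infimum is over at most one value).
Functions outside of `L²(ℝ^d)` are given the value `∞`. -/
def sobolevNormSq {d : ℕ} (r : ℝ) (f : Horiz d → ℝ) : ℝ≥0∞ :=
  ⨅ (_ : MemLp f 2 volume) (v : Lp ℂ 2 (volume : Measure (Horiz d))) (_ : IsLambdaPow r f v),
    ‖v‖ₑ ^ 2

/-- `Λ^r ∂_z^j u = v` in the sense of distributions on the strip (tempered in `X`):
the equality is tested against the products `χ(X) ψ(z)`, with `χ` in the Schwartz class and
`ψ` smooth and compactly supported in `(-H, 0)`. -/
def IsLambdaPowDz {d : ℕ} (H r : ℝ) (j : ℕ) (u : Horiz d × ℝ → ℝ)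
    (v : Lp ℂ 2 (volume.restrict (strip d H))) : Prop :=
  ∀ (χ : 𝓢(Horiz d, ℂ)) (ψ : ℝ → ℝ), IsTestFunction (Ioo (-H) 0) ψ →
    ∫ p in strip d H, (u p : ℂ) * lambdaPow d r χ p.1 * ((iteratedDeriv j ψ p.2 : ℝ) : ℂ) =
      (-1) ^ j * ∫ p in strip d H, v p * χ p.1 * (ψ p.2 : ℂ)

/-- `u ∈ C([0,T]; H^{s,m})`, where `H^{s,m}` has the norm `∑_{j ≤ m} ‖Λ^{s-j} ∂_z^j u‖_{L²}`.
This is for `s ≥ 0`, where the elements of `H^{s,m}` are `L²` functions on the strip. -/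
def IsContinuousIntoHsm {d : ℕ} (H T s : ℝ) (m : ℕ) (u : ℝ → Horiz d × ℝ → ℝ) : Prop :=
  (∀ t ∈ Icc 0 T, MemLp (u t) 2 (volume.restrict (strip d H))) ∧
  ∀ j ≤ m, ∃ v : ℝ → Lp ℂ 2 (volume.restrict (strip d H)),
    ContinuousOn v (Icc 0 T) ∧ ∀ t ∈ Icc 0 T, IsLambdaPowDz H (s - j) j (u t) (v t)

/-- `f ∈ W^{m,∞}(-H, 0)`: the weak derivatives `D 0 = f, D 1, …, D m` are essentially bounded. -/
def MemWInfty (H : ℝ) (m : ℕ) (f : ℝ → ℝ) : Prop :=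
  ∃ D : ℕ → ℝ → ℝ, D 0 = f ∧
    (∀ j ≤ m, MemLp (D j) ⊤ (volume.restrict (Ioo (-H) 0))) ∧
    ∀ j < m, ∀ ψ : ℝ → ℝ, IsTestFunction (Ioo (-H) 0) ψ →
      ∫ z in Ioo (-H) 0, D j z * deriv ψ z = - ∫ z in Ioo (-H) 0, D (j + 1) z * ψ z

/-- The trace of `A u` vanishes at `z = -H` and at `z = 0`, for a differential operator `A` in `z`
of order `m`. The trace is taken with values in the tempered distributions on `ℝ^d`: for every
Schwartz function `χ`, the function `z ↦ ∫ u(X, z) χ(X) dX` has a representative `F` of class `C^m`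
on `(-H, 0)`, and `A F` tends to `0` at both end points. -/
def HasZeroTrace {d : ℕ} (H : ℝ) (m : ℕ) (A : (ℝ → ℂ) → ℝ → ℂ) (u : Horiz d × ℝ → ℝ) : Prop :=
  ∀ χ : 𝓢(Horiz d, ℂ), ∃ F : ℝ → ℂ, ContDiffOn ℝ m F (Ioo (-H) 0) ∧
    (∀ᵐ z ∂(volume.restrict (Ioo (-H) 0)), F z = ∫ X, (u (X, z) : ℂ) * χ X) ∧
    Tendsto (A F) (𝓝[>] (-H)) (𝓝 0) ∧ Tendsto (A F) (𝓝[<] 0) (𝓝 0)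

/-! ### The operators `T₁`, `T₂`, `T₂*` -/

/-- `T₁ F = ∂_z ((-ρ_eq')⁻¹ ∂_z (ρ_eq F))`. -/
def opT₁ (ρeq : ℝ → ℝ) (F : ℝ → ℂ) : ℝ → ℂ :=
  deriv fun y => (1 / (-deriv ρeq y)) • deriv (fun x => ρeq x • F x) y

/-- `T₂ F = ∂_z (ρ_eq ∂_z ((-ρ_eq')⁻¹ F))`. -/
def opT₂ (ρeq : ℝ → ℝ) (F : ℝ → ℂ) : ℝ → ℂ :=
  deriv fun y => ρeq y • deriv (fun x => (1 / (-deriv ρeq x)) • F x) y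

/-- The adjoint of `T₂` for the `L²((-H,0), dz)` scalar product,
`T₂* F = (-ρ_eq')⁻¹ ∂_z (ρ_eq ∂_z F)`. -/
def opT₂Star (ρeq : ℝ → ℝ) (F : ℝ → ℂ) : ℝ → ℂ :=
  fun z => (1 / (-deriv ρeq z)) • deriv (fun y => ρeq y • deriv F y) z

/-! ### The linearised Euler equations -/

/-- The duality pairing `∫₀ᵀ ∫_strip a φ dX dz dt`. -/
def pairing {d : ℕ} (H T : ℝ) (a : ℝ → Horiz d × ℝ → ℝ) (φ : ℝ × (Horiz d × ℝ) → ℝ) : ℝ :=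
  ∫ t in Ioo 0 T, ∫ p in strip d H, a t p * φ (t, p)

/-- The unit vector of the `i`-th horizontal direction in `ℝ^d × ℝ`. -/
def eX {d : ℕ} (i : Fin d) : Horiz d × ℝ := (EuclideanSpace.single i 1, 0)

/-- The unit vector of the vertical direction in `ℝ^d × ℝ`. -/
def eZ {d : ℕ} : Horiz d × ℝ := (0, 1)

/-- `(V, w, ρ)`, with pressure `P`, solves on `(0, T) × strip`, in the sense of distributions,
`∂_t V + (1/ρ_eq) ∇P = 0`, `∂_t w + (1/ρ_eq) ∂_z P + (ρ/ρ_eq) g = 0`, `∂_t ρ + ρ_eq' w = 0`,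
`∇·V + ∂_z w = 0`, with the boundary condition `w = 0` at `z = -H` and `z = 0`.
The first two equations are multiplied by `ρ_eq`, which depends on `z` only. -/
structure IsLinearSolution {d : ℕ} (H g T : ℝ) (ρeq : ℝ → ℝ)
    (V : Fin d → ℝ → Horiz d × ℝ → ℝ) (w ρ P : ℝ → Horiz d × ℝ → ℝ) : Prop where
  pressure_locallyIntegrable :
    LocallyIntegrableOn (fun q : ℝ × (Horiz d × ℝ) => P q.1 q.2) (Ioo 0 T ×ˢ strip d H)
  horizontal_momentum : ∀ φ, IsTestFunction (Ioo 0 T ×ˢ strip d H) φ → ∀ i,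
    pairing H T (fun t p => ρeq p.2 * V i t p) (fun q => fderiv ℝ φ q (1, 0)) +
      pairing H T P (fun q => fderiv ℝ φ q (0, eX i)) = 0
  vertical_momentum : ∀ φ, IsTestFunction (Ioo 0 T ×ˢ strip d H) φ →
    pairing H T (fun t p => ρeq p.2 * w t p) (fun q => fderiv ℝ φ q (1, 0)) +
      pairing H T P (fun q => fderiv ℝ φ q (0, eZ)) -
      pairing H T (fun t p => g * ρ t p) φ = 0
  density : ∀ φ, IsTestFunction (Ioo 0 T ×ˢ strip d H) φ →
    pairing H T ρ (fun q => fderiv ℝ φ q (1, 0)) -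
      pairing H T (fun t p => deriv ρeq p.2 * w t p) φ = 0
  divergence_free : ∀ t ∈ Icc 0 T, ∀ φ, IsTestFunction (strip d H) φ →
    ∫ p in strip d H, ((∑ i, V i t p * fderiv ℝ φ p (eX i)) + w t p * fderiv ℝ φ p eZ) = 0
  boundary : ∀ t ∈ Icc 0 T, HasZeroTrace H 0 id (w t)

/-- The horizontal field `V` has no vertical vorticity: `∂_i V_j = ∂_j V_i` in the sense of
distributions on the strip (for `d = 2` this is `∇^⊥ · V = 0`, for `d = 1` it is void). -/
def HasZeroVerticalVorticity {d : ℕ} (H : ℝ) (V : Fin d → Horiz d × ℝ → ℝ) : Prop :=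
  ∀ i j, ∀ φ, IsTestFunction (strip d H) φ →
    ∫ p in strip d H, V j p * fderiv ℝ φ p (eX i) = ∫ p in strip d H, V i p * fderiv ℝ φ p (eX j)

/-! ### The Sturm–Liouville basis and the modal coefficients -/

/-- The square `N² = -(ρ_eq'/ρ_eq) g` of the Brunt–Väisälä frequency. -/
def Nsq (g : ℝ) (ρeq : ℝ → ℝ) (z : ℝ) : ℝ := -(deriv ρeq z / ρeq z) * g

/-- `(f n)_{n ≥ 1}` is an orthonormal basis of `L²((-H,0), ρ_eq N² dz)` of eigenfunctions of
`(ρ_eq f_n')' + (ρ_eq N² / c_n²) f_n = 0`, `f_n(-H) = f_n(0) = 0`, with `c_1 > c_2 > ⋯ > 0`. -/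
structure IsSturmLiouvilleBasis (H g : ℝ) (ρeq : ℝ → ℝ) (c : ℕ+ → ℝ) (f : ℕ+ → ℝ → ℝ) :
    Prop where
  speed_pos : ∀ n, 0 < c n
  speed_strictAnti : StrictAnti c
  continuousOn : ∀ n, ContinuousOn (f n) (Icc (-H) 0)
  differentiableOn : ∀ n, DifferentiableOn ℝ (f n) (Ioo (-H) 0)
  equation : ∀ n, ∀ z ∈ Ioo (-H) 0, HasDerivAt (fun y => ρeq y * deriv (f n) y)
    (-(ρeq z * Nsq g ρeq z / c n ^ 2 * f n z)) z
  bottom : ∀ n, f n (-H) = 0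
  top : ∀ n, f n 0 = 0
  orthonormal : ∀ m n, ∫ z in Ioo (-H) 0, f m z * f n z * (ρeq z * Nsq g ρeq z) =
    if m = n then 1 else 0
  complete : ∀ h : ℝ → ℝ, MemLp h 2 (volume.restrict (Ioo (-H) 0)) →
    (∀ n, ∫ z in Ioo (-H) 0, h z * f n z * (ρeq z * Nsq g ρeq z) = 0) →
    h =ᵐ[volume.restrict (Ioo (-H) 0)] 0

/-- The coefficient `w_n` of `w = ∑ w_n f_n`: the scalar product of `w` and `f_n` in
`L²(ρ_eq N² dz)`. -/
def modeW {d : ℕ} (H g : ℝ) (ρeq fn : ℝ → ℝ) (w : Horiz d × ℝ → ℝ) (X : Horiz d) : ℝ :=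
  ∫ z in Ioo (-H) 0, w (X, z) * fn z * (ρeq z * Nsq g ρeq z)

/-- The coefficient `V_n` of `V = ∑ V_n g_n`, where `g_n = c_n f_n'`: the scalar product of `V` and
`g_n` in `L²(ρ_eq dz)`. Here for one component of `V`. -/
def modeV {d : ℕ} (H : ℝ) (ρeq : ℝ → ℝ) (cn : ℝ) (fn : ℝ → ℝ) (V : Horiz d × ℝ → ℝ)
    (X : Horiz d) : ℝ :=
  ∫ z in Ioo (-H) 0, V (X, z) * (cn * deriv fn z) * ρeq z

/-- The coefficient `ρ_n` of `ρ = ∑ (1/g) ρ_n ρ_eq N² f_n`: the scalar product of `g ρ` and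
`ρ_eq N² f_n` in `L²((ρ_eq N²)⁻¹ dz)`. -/
def modeRho {d : ℕ} (H g : ℝ) (ρeq fn : ℝ → ℝ) (ρ : Horiz d × ℝ → ℝ) (X : Horiz d) : ℝ :=
  ∫ z in Ioo (-H) 0,
    (g * ρ (X, z)) * (ρeq z * Nsq g ρeq z * fn z) * (ρeq z * Nsq g ρeq z)⁻¹

end StratifiedFluid

end

open StratifiedFluid

noncomputable section

namespace StratifiedFluid

/-! ### Square-integrable functions on a product, and Bessel families of profiles -/

section ProductL2

variable {α β : Type*} [MeasurableSpace α] [MeasurableSpace β] {μ : Measure α} {ν : Measure β}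

/-! Constancy of `N²` forces `ρ_eq' = -b ρ_eq` with `b g = N²`. So `ρ_eq` is an exponential and the
trace operators have constant coefficients: `T₂* = b⁻¹ ∂(∂ - b)` and `T₂ = b⁻¹ ∂(∂ + b)`. The proof
then has two independent halves.

Propagation in time. The equations are paired with the modes, the pressure being removed by
cross-differentiation. After a horizontal Fourier transform, with `κ = |2πξ|²`, each mode satisfies
`ρ_n' = w_n` and `w_n' = -m ρ_n`, where `m = κ / (c_n⁻² + κ/N²)`. Incompressibility gives `∇·V_n = ∓
w_n / c_n` (the sign depends on the side of the pairing), and absence of vorticity makes `V_n`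
parallel to `ξ`. Hence `|V_n|² + |w_n|²/N² + |ρ_n|²` is conserved for almost every `ξ`
(`modal_energy_ae`, `exists_modal_hats`). Norms at time `t` are therefore bounded by those at time
`0`, with a constant independent of `n` and `ξ`.

Decay at time `0`. The coefficients are integrated by parts, passing alternately between the
profiles `ρ_eq N² f_n` and `c_n ρ_eq f_n'`. Each passage costs one vertical derivative and yields
one factor `c_n`. Leaving the first profile requires the data to vanish at the ends, leaving the
second does not, since `f_n` vanishes there. After `ν` passages a coefficient equals `c_n^ν` times
the coefficient, in a family satisfying a Bessel inequality, of a fixed combination of derivatives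
of order at most `ν` (`IsJet.integral_profW_reduce`). The weight `c_n^(-2ν)` cancels the powers of
`c_n`, and Bessel and Plancherel bound the sum (`tsum_weighted_lt_top`).

The end conditions for `w` are those on `(T₂*)^l w`. The density is brought to the same form by
multiplication by `e^{bz}`, which conjugates `T₂` into `T₂*` (`opL_expJet`). For the velocity, `ΔV =
-∇ ∂_z w`, so that the required end values are again those of `w` (`vanishesAtEnds_velocity`). The
horizontal Laplacian is put on the test function and divided out in Fourier variables, where its
symbol vanishes only at `ξ = 0`.

Everything is done weakly: the unknowns enter through brackets with `χ ⊗ h`, or through their slices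
`z ↦ ∫ u(X, z) χ(X) dX`, to which one-dimensional integration by parts applies. -/

theorem eLpNorm_two_sq (f : α → ℂ) (μ : Measure α) :
    eLpNorm f 2 μ ^ 2 = ∫⁻ x, ‖f x‖ₑ ^ 2 ∂μ := by
  rw [eLpNorm_eq_lintegral_rpow_enorm_toReal (by norm_num) (by norm_num)]
  rw [← ENNReal.rpow_natCast, ← ENNReal.rpow_mul]
  norm_num

theorem memLp_two_iff {f : α → ℂ} :
    MemLp f 2 μ ↔ AEStronglyMeasurable f μ ∧ ∫⁻ x, ‖f x‖ₑ ^ 2 ∂μ < ⊤ := by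
  rw [MemLp, ← eLpNorm_two_sq]
  simp [ENNReal.pow_lt_top_iff]

theorem enorm_integral_mul_sq_le {u h : β → ℂ} (hu : AEStronglyMeasurable u ν)
    (hh : AEStronglyMeasurable h ν) :
    ‖∫ y, u y * h y ∂ν‖ₑ ^ 2 ≤ (∫⁻ y, ‖u y‖ₑ ^ 2 ∂ν) * ∫⁻ y, ‖h y‖ₑ ^ 2 ∂ν := by
  have h1 : ‖∫ y, u y * h y ∂ν‖ₑ ≤ ∫⁻ y, ‖u y‖ₑ * ‖h y‖ₑ ∂ν := by
    refine (enorm_integral_le_lintegral_enorm _).trans (le_of_eq ?_)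
    simp [enorm_mul]
  have h2 := ENNReal.lintegral_mul_le_Lp_mul_Lq ν Real.HolderConjugate.two_two
    hu.enorm hh.enorm
  have h3 := h1.trans h2
  calc _ ≤ _ := pow_le_pow_left' h3 2
    _ = _ := by
      rw [mul_pow, ← ENNReal.rpow_natCast, ← ENNReal.rpow_natCast, ← ENNReal.rpow_mul,
        ← ENNReal.rpow_mul]
      norm_num

variable [SFinite ν]

/-- Cauchy–Schwarz in `y` for almost every `x`, then Tonelli. -/
theorem lintegral_integral_mul_le [SFinite μ] {u : α × β → ℂ} {h : β → ℂ}
    (hu : AEStronglyMeasurable u (μ.prod ν))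
    (hh : AEStronglyMeasurable h ν) :
    ∫⁻ x, ‖∫ y, u (x, y) * h y ∂ν‖ₑ ^ 2 ∂μ ≤
      (∫⁻ p, ‖u p‖ₑ ^ 2 ∂(μ.prod ν)) * ∫⁻ y, ‖h y‖ₑ ^ 2 ∂ν := by
  calc _ ≤ ∫⁻ x, (∫⁻ y, ‖u (x, y)‖ₑ ^ 2 ∂ν) * ∫⁻ y, ‖h y‖ₑ ^ 2 ∂ν ∂μ := by
        refine lintegral_mono_ae ?_
        filter_upwards [hu.prodMk_left] with x hx
        exact enorm_integral_mul_sq_le hx hh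
    _ = _ := by
        have hm := (hu.enorm.pow_const 2)
        rw [lintegral_mul_const'' _ hm.lintegral_prod_right', lintegral_prod _ hm]

theorem memLp_integral_mul_right [SFinite μ] {u : α × β → ℂ} {h : β → ℂ}
    (hu : MemLp u 2 (μ.prod ν)) (hh : MemLp h 2 ν) :
    MemLp (fun x => ∫ y, u (x, y) * h y ∂ν) 2 μ := by
  refine memLp_two_iff.2 ⟨?_, ?_⟩
  · exact AEStronglyMeasurable.integral_prod_right'
      (f := fun p : α × β => u p * h p.2) (hu.1.mul hh.1.comp_snd)
  · exact (lintegral_integral_mul_le hu.1 hh.1).trans_lt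
      (ENNReal.mul_lt_top (memLp_two_iff.1 hu).2 (memLp_two_iff.1 hh).2)

theorem memLp_integral_mul_left [SFinite μ] {u : α × β → ℂ} {h : α → ℂ}
    (hu : MemLp u 2 (μ.prod ν)) (hh : MemLp h 2 μ) :
    MemLp (fun y => ∫ x, u (x, y) * h x ∂μ) 2 ν :=
  memLp_integral_mul_right (u := u ∘ Prod.swap)
    (hu.comp_measurePreserving Measure.measurePreserving_swap) hh

theorem memLp_tensor [SFinite μ] {a : α → ℂ} {b : β → ℂ} (ha : MemLp a 2 μ) (hb : MemLp b 2 ν) :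
    MemLp (fun p : α × β => a p.1 * b p.2) 2 (μ.prod ν) := by
  refine memLp_two_iff.2 ⟨ha.1.comp_fst.mul hb.1.comp_snd, ?_⟩
  simp only [enorm_mul, mul_pow]
  rw [lintegral_prod_mul (f := fun x => ‖a x‖ₑ ^ 2) (g := fun x => ‖b x‖ₑ ^ 2)
    (ha.1.enorm.pow_const 2) (hb.1.enorm.pow_const 2)]
  exact ENNReal.mul_lt_top (memLp_two_iff.1 ha).2 (memLp_two_iff.1 hb).2

theorem integrable_mul_tensor [SFinite μ] {u : α × β → ℂ} {a : α → ℂ} {b : β → ℂ}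
    (hu : MemLp u 2 (μ.prod ν)) (ha : MemLp a 2 μ) (hb : MemLp b 2 ν) :
    Integrable (fun p : α × β => u p * a p.1 * b p.2) (μ.prod ν) := by
  have := hu.integrable_mul (memLp_tensor ha hb)
  refine this.congr (ae_of_all _ fun p => ?_)
  simp [mul_assoc]

theorem integral_mul_tensor_eq_left [SFinite μ] {u : α × β → ℂ} {a : α → ℂ} {b : β → ℂ}
    (hu : MemLp u 2 (μ.prod ν)) (ha : MemLp a 2 μ) (hb : MemLp b 2 ν) :
    ∫ p, u p * a p.1 * b p.2 ∂(μ.prod ν) = ∫ x, (∫ y, u (x, y) * b y ∂ν) * a x ∂μ := by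
  rw [integral_prod _ (integrable_mul_tensor hu ha hb)]
  refine integral_congr_ae (ae_of_all _ fun x => ?_)
  simp only
  rw [← integral_mul_const]
  exact integral_congr_ae (ae_of_all _ fun y => by simp only; ring)

theorem integral_mul_tensor_eq_right [SFinite μ] {u : α × β → ℂ} {a : α → ℂ} {b : β → ℂ}
    (hu : MemLp u 2 (μ.prod ν)) (ha : MemLp a 2 μ) (hb : MemLp b 2 ν) :
    ∫ p, u p * a p.1 * b p.2 ∂(μ.prod ν) = ∫ y, (∫ x, u (x, y) * a x ∂μ) * b y ∂ν := by
  rw [integral_prod_symm _ (integrable_mul_tensor hu ha hb)]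
  refine integral_congr_ae (ae_of_all _ fun x => ?_)
  simp only
  rw [← integral_mul_const]

/-- A family of profiles satisfying a Bessel inequality. -/
def IsBesselFamily {ι : Type*} (ν : Measure β) (h : ι → β → ℂ) : Prop :=
  (∀ n, MemLp (h n) 2 ν) ∧ ∃ C : ℝ≥0∞, C < ⊤ ∧ ∀ u : β → ℂ, MemLp u 2 ν →
    ∑' n, ‖∫ y, u y * h n y ∂ν‖ₑ ^ 2 ≤ C * ∫⁻ y, ‖u y‖ₑ ^ 2 ∂ν

/-- The profiles are real, so the bilinear pairing `∫ u e_n` is the Hermitian inner product with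
`e_n`, and Bessel's inequality in `L²` gives the constant `1`. -/
theorem isBesselFamily_of_orthonormal {ι : Type*} [DecidableEq ι] {e : ι → β → ℝ}
    (he : ∀ n, MemLp (fun y => (e n y : ℂ)) 2 ν)
    (ho : ∀ m n, ∫ y, e m y * e n y ∂ν = if m = n then 1 else 0) :
    IsBesselFamily ν (fun n y => (e n y : ℂ)) := by

  refine ⟨he, 1, ENNReal.one_lt_top, fun u hu => ?_⟩
  let E : ι → Lp ℂ 2 ν := fun n => (he n).toLp
  have hE : Orthonormal ℂ E := by
    rw [orthonormal_iff_ite]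
    intro m n
    rw [L2.inner_def]
    have : ∫ y, inner ℂ (E m y) (E n y) ∂ν = ∫ y, ((e m y * e n y : ℝ) : ℂ) ∂ν := by
      refine integral_congr_ae ?_
      filter_upwards [(he m).coeFn_toLp, (he n).coeFn_toLp] with y h1 h2
      simp only [E, h1, h2]
      simp [mul_comm]
    rw [this, integral_complex_ofReal, ho]
    split_ifs <;> simp
  have hin : ∀ n, inner ℂ (E n) hu.toLp = ∫ y, u y * (e n y : ℂ) ∂ν := by
    intro n
    rw [L2.inner_def]
    refine integral_congr_ae ?_
    filter_upwards [(he n).coeFn_toLp, hu.coeFn_toLp] with y h1 h2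
    simp only [E, h1, h2]
    simp [mul_comm]
  rw [one_mul, ENNReal.tsum_eq_iSup_sum]
  refine iSup_le fun s => ?_
  have hb := hE.sum_inner_products_le hu.toLp (s := s)
  have hn : ‖hu.toLp‖ₑ ^ 2 = ∫⁻ y, ‖u y‖ₑ ^ 2 ∂ν := by
    rw [← eLpNorm_two_sq, Lp.enorm_toLp]
  rw [← hn]
  calc ∑ n ∈ s, ‖∫ y, u y * (e n y : ℂ) ∂ν‖ₑ ^ 2
      = ENNReal.ofReal (∑ n ∈ s, ‖inner ℂ (E n) hu.toLp‖ ^ 2) := by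
        rw [ENNReal.ofReal_sum_of_nonneg (fun _ _ => by positivity)]
        refine Finset.sum_congr rfl fun n _ => ?_
        rw [hin, ENNReal.ofReal_pow (norm_nonneg _), ofReal_norm]
    _ ≤ ENNReal.ofReal (‖hu.toLp‖ ^ 2) := ENNReal.ofReal_le_ofReal hb
    _ = _ := by rw [ENNReal.ofReal_pow (norm_nonneg _), ofReal_norm]

/-- The factor `e` can be moved from the profiles onto `u`, where it costs at most `K²`. -/
theorem IsBesselFamily.mul_bounded {ι : Type*} {h : ι → β → ℂ} (hh : IsBesselFamily ν h)
    {e : β → ℂ} (he : AEStronglyMeasurable e ν) {K : ℝ} (hK : ∀ᵐ y ∂ν, ‖e y‖ ≤ K) :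
    IsBesselFamily ν (fun n y => e y * h n y) := by
  obtain ⟨h1, C, hC, h2⟩ := hh
  have hmul : ∀ u : β → ℂ, MemLp u 2 ν → MemLp (fun y => e y * u y) 2 ν := fun u hu =>
    MemLp.of_le_mul hu (he.mul hu.1) (c := K) (by
      filter_upwards [hK] with y hy
      rw [norm_mul]
      exact mul_le_mul_of_nonneg_right hy (norm_nonneg _))
  refine ⟨fun n => hmul _ (h1 n), C * ENNReal.ofReal K ^ 2,
    ENNReal.mul_lt_top hC (ENNReal.pow_lt_top ENNReal.ofReal_lt_top), fun u hu => ?_⟩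
  have := h2 _ (hmul u hu)
  calc _ = ∑' n, ‖∫ y, e y * u y * h n y ∂ν‖ₑ ^ 2 := by
        congr 1; ext n; congr 3; ext y; ring
    _ ≤ _ := this
    _ ≤ C * ∫⁻ y, ENNReal.ofReal K ^ 2 * ‖u y‖ₑ ^ 2 ∂ν := by
        gcongr 1
        refine lintegral_mono_ae ?_
        filter_upwards [hK] with y hy
        rw [enorm_mul, mul_pow]
        gcongr
        rw [← ofReal_norm]
        exact ENNReal.ofReal_le_ofReal hy
    _ = _ := by
        rw [lintegral_const_mul' _ _ (by simp)]
        ring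

theorem IsBesselFamily.congr_ae {ι : Type*} {h h' : ι → β → ℂ} (hh : IsBesselFamily ν h)
    (he : ∀ n, h' n =ᵐ[ν] h n) : IsBesselFamily ν h' := by
  obtain ⟨h1, C, hC, h2⟩ := hh
  refine ⟨fun n => (memLp_congr_ae (he n)).2 (h1 n), C, hC, fun u hu => ?_⟩
  refine le_trans (le_of_eq ?_) (h2 u hu)
  congr 1; ext n; congr 2
  refine integral_congr_ae ?_
  filter_upwards [he n] with y hy
  rw [hy]

/-- Sum and integral are exchanged by Tonelli, and the Bessel inequality is applied to almost every
slice `u (x, ·)`. This is where the sum over the modes converges. -/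
theorem IsBesselFamily.tsum_lintegral_lt_top {ι : Type*} [Countable ι] [SFinite μ] {h : ι → β → ℂ}
    (hh : IsBesselFamily ν h) {u : α × β → ℂ} (hu : MemLp u 2 (μ.prod ν)) :
    ∑' n, ∫⁻ x, ‖∫ y, u (x, y) * h n y ∂ν‖ₑ ^ 2 ∂μ < ⊤ := by
  obtain ⟨h1, C, hC, h2⟩ := hh
  rw [← lintegral_tsum (fun n => ((memLp_integral_mul_right hu (h1 n)).1.enorm.pow_const 2))]
  have hm := hu.1.enorm.pow_const 2
  have hfin := (memLp_two_iff.1 hu).2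
  rw [lintegral_prod _ hm] at hfin
  calc _ ≤ ∫⁻ x, C * ∫⁻ y, ‖u (x, y)‖ₑ ^ 2 ∂ν ∂μ := by
        refine lintegral_mono_ae ?_
        filter_upwards [hu.1.prodMk_left, ae_lt_top' hm.lintegral_prod_right' hfin.ne]
          with x hx hx2
        exact h2 _ (memLp_two_iff.2 ⟨hx, hx2⟩)
    _ = C * ∫⁻ x, ∫⁻ y, ‖u (x, y)‖ₑ ^ 2 ∂ν ∂μ :=
        lintegral_const_mul' _ _ hC.ne
    _ < ⊤ := ENNReal.mul_lt_top hC hfin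

end ProductL2

/-! ### Weak derivatives and integration by parts on an interval -/

section OneDim

/-- `q` is the weak derivative of `p` on `(a, b)`. -/
def IsWeakDeriv (a b : ℝ) (p q : ℝ → ℂ) : Prop :=
  ∀ ψ : ℝ → ℝ, IsTestFunction (Ioo a b) ψ →
    ∫ z in Ioo a b, p z * ((deriv ψ z : ℝ) : ℂ) = -∫ z in Ioo a b, q z * (ψ z : ℂ)

/-- The primitive of an integrable `q` is absolutely continuous and `f` is Lipschitz because `f1` is
bounded. The product rule thus holds almost everywhere and integrates. -/
theorem integral_primitive_mul_add_real {a b : ℝ} {q f f1 : ℝ → ℝ} (hab : a ≤ b)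
    (hq : IntervalIntegrable q volume a b) (hf : ∀ z ∈ Icc a b, HasDerivAt f (f1 z) z)
    (hf1 : ContinuousOn f1 (Icc a b)) :
    ∫ z in a..b, ((∫ t in a..z, q t) * f1 z + q z * f z) = (∫ t in a..b, q t) * f b := by
  have hG := hq.absolutelyContinuousOnInterval_intervalIntegral (c := a) (by simp)
  have hF : AbsolutelyContinuousOnInterval f a b := by
    obtain ⟨K, hK⟩ := isCompact_Icc.exists_bound_of_continuousOn hf1
    have : LipschitzOnWith (Real.toNNReal K) f (Icc a b) := by
      refine Convex.lipschitzOnWith_of_nnnorm_hasDerivWithin_le (convex_Icc a b)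
        (fun x hx => (hf x hx).hasDerivWithinAt) (fun x hx => ?_)
      rw [← NNReal.coe_le_coe]
      simpa using Or.inl (hK x hx)
    rw [← uIcc_of_le hab] at this
    exact this.absolutelyContinuousOnInterval
  have h := hG.integral_deriv_mul_eq_sub hF
  simp only [intervalIntegral.integral_same, zero_mul, sub_zero] at h
  rw [← h]
  refine intervalIntegral.integral_congr_ae ?_
  filter_upwards [hq.ae_hasDerivAt_integral] with z hz hzm
  have hz' : z ∈ uIcc a b := uIoc_subset_uIcc hzm
  rw [(hz hz' a (by simp)).deriv, (hf z (by rwa [uIcc_of_le hab] at hz')).deriv]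
  ring

theorem integral_primitive_mul_add {a b : ℝ} {q : ℝ → ℂ} {f f1 : ℝ → ℝ} (hab : a ≤ b)
    (hq : IntervalIntegrable q volume a b) (hf : ∀ z ∈ Icc a b, HasDerivAt f (f1 z) z)
    (hf1 : ContinuousOn f1 (Icc a b)) (C : ℂ) :
    ∫ z in a..b, ((C + ∫ t in a..z, q t) * (f1 z : ℂ) + q z * (f z : ℂ)) =
      (C + ∫ t in a..b, q t) * f b - C * f a := by
  have hfc : ContinuousOn f (Icc a b) := fun z hz => (hf z hz).continuousAt.continuousWithinAt
  have huI := uIcc_of_le hab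
  have hGc : ContinuousOn (fun z => ∫ t in a..z, q t) (uIcc a b) :=
    intervalIntegral.continuousOn_primitive_interval' hq (by simp)
  have hfC : ContinuousOn (fun z => (f z : ℂ)) (uIcc a b) := by
    rw [huI]; exact Complex.continuous_ofReal.comp_continuousOn hfc
  have hf1C : ContinuousOn (fun z => (f1 z : ℂ)) (uIcc a b) := by
    rw [huI]; exact Complex.continuous_ofReal.comp_continuousOn hf1
  have i1 : IntervalIntegrable (fun z => (∫ t in a..z, q t) * (f1 z : ℂ) + q z * (f z : ℂ))
      volume a b := (hGc.mul hf1C).intervalIntegrable.add (hq.mul_continuousOn hfC)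
  have i2 : IntervalIntegrable (fun z => C * (f1 z : ℂ)) volume a b :=
    (continuousOn_const.mul hf1C).intervalIntegrable
  have hftc : ∫ z in a..b, (f1 z : ℂ) = f b - f a := by
    rw [intervalIntegral.integral_ofReal, intervalIntegral.integral_eq_sub_of_hasDerivAt
      (f := f) (fun z hz => hf z (by rwa [huI] at hz))
      (by rw [← huI] at hf1; exact hf1.intervalIntegrable)]
    push_cast; rfl
  have hmain : ∫ z in a..b, ((∫ t in a..z, q t) * (f1 z : ℂ) + q z * (f z : ℂ)) =
      (∫ t in a..b, q t) * f b := by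
    have hqr : IntervalIntegrable (fun z => (q z).re) volume a b := ⟨hq.1.re, hq.2.re⟩
    have hqi : IntervalIntegrable (fun z => (q z).im) volume a b := ⟨hq.1.im, hq.2.im⟩
    have hr := integral_primitive_mul_add_real hab hqr hf hf1
    have hi := integral_primitive_mul_add_real hab hqi hf hf1
    have key : ∀ z ∈ uIcc a b, (∫ t in a..z, q t) =
        ((∫ t in a..z, (q t).re : ℝ) : ℂ) + ((∫ t in a..z, (q t).im : ℝ) : ℂ) * Complex.I := by
      intro z hz
      have hqz : IntervalIntegrable q volume a z :=
        hq.mono_set (uIcc_subset_uIcc (by simp) hz)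
      rw [← intervalIntegral.integral_ofReal, ← intervalIntegral.integral_ofReal,
        ← intervalIntegral.integral_mul_const, ← intervalIntegral.integral_add]
      · refine intervalIntegral.integral_congr fun t _ => ?_
        simp [Complex.re_add_im]
      · exact ⟨hqz.1.re.ofReal, hqz.2.re.ofReal⟩
      · exact IntervalIntegrable.mul_const ⟨hqz.1.im.ofReal, hqz.2.im.ofReal⟩ _
    have hGr : ContinuousOn (fun z => ∫ t in a..z, (q t).re) (uIcc a b) :=
      intervalIntegral.continuousOn_primitive_interval' hqr (by simp)
    have hGi : ContinuousOn (fun z => ∫ t in a..z, (q t).im) (uIcc a b) :=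
      intervalIntegral.continuousOn_primitive_interval' hqi (by simp)
    rw [← huI] at hf1 hfc
    have j1 : IntervalIntegrable (fun z => (∫ t in a..z, (q t).re) * f1 z + (q z).re * f z)
      volume a b := (hGr.mul hf1).intervalIntegrable.add (hqr.mul_continuousOn hfc)
    have j2 : IntervalIntegrable (fun z => (∫ t in a..z, (q t).im) * f1 z + (q z).im * f z)
      volume a b := (hGi.mul hf1).intervalIntegrable.add (hqi.mul_continuousOn hfc)
    rw [key b (by simp), add_mul, mul_right_comm, ← Complex.ofReal_mul, ← Complex.ofReal_mul,
      ← hr, ← hi, ← intervalIntegral.integral_ofReal, ← intervalIntegral.integral_ofReal,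
      ← intervalIntegral.integral_mul_const, ← intervalIntegral.integral_add]
    · refine intervalIntegral.integral_congr fun z hz => ?_
      rw [key z hz]
      push_cast
      conv_lhs => rw [← Complex.re_add_im (q z)]
      ring
    · exact ⟨j1.1.ofReal, j1.2.ofReal⟩
    · exact IntervalIntegrable.mul_const ⟨j2.1.ofReal, j2.2.ofReal⟩ _
  have : ∀ z, (C + ∫ t in a..z, q t) * (f1 z : ℂ) + q z * (f z : ℂ) =
      C * (f1 z : ℂ) + ((∫ t in a..z, q t) * (f1 z : ℂ) + q z * (f z : ℂ)) := fun z => by ring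
  simp_rw [this]
  rw [intervalIntegral.integral_add i2 i1, hmain, intervalIntegral.integral_const_mul, hftc]
  ring

/-- The margin between the support and the end points is kept explicit, so that
`IsTestFunction.of_Icc` applies to sums and primitives. -/
theorem IsTestFunction.exists_Icc {a b : ℝ} {ψ : ℝ → ℝ} (hab : a < b)
    (h : IsTestFunction (Ioo a b) ψ) :
    ∃ c d, a < c ∧ c < d ∧ d < b ∧ ∀ z, z ∉ Icc c d → ψ z = 0 := by
  obtain ⟨h1, h2, h3⟩ := h
  have hK : IsCompact (tsupport ψ) := h2
  rcases (tsupport ψ).eq_empty_or_nonempty with he | hne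
  · refine ⟨(2 * a + b) / 3, (a + 2 * b) / 3, by linarith, by linarith, by linarith,
      fun z _ => image_eq_zero_of_notMem_tsupport (by simp [he])⟩
  · obtain ⟨m, hm, hm'⟩ := hK.exists_isLeast hne
    obtain ⟨M, hM, hM'⟩ := hK.exists_isGreatest hne
    have ha := (h3 hm).1
    have hb := (h3 hM).2
    have hmM := hm' hM
    refine ⟨(a + m) / 2, (M + b) / 2, by linarith, by linarith, by linarith, fun z hz => ?_⟩
    refine image_eq_zero_of_notMem_tsupport fun hzt => hz ⟨?_, ?_⟩
    · linarith [hm' hzt]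
    · linarith [hM' hzt]

theorem IsTestFunction.of_Icc {a b c d : ℝ} {ψ : ℝ → ℝ} (hac : a < c) (hdb : d < b)
    (hψ : ContDiff ℝ ∞ ψ) (h : ∀ z, z ∉ Icc c d → ψ z = 0) : IsTestFunction (Ioo a b) ψ := by
  have hsub : tsupport ψ ⊆ Icc c d :=
    closure_minimal (fun z hz => by_contra fun hn => hz (h z hn)) isClosed_Icc
  exact ⟨hψ, HasCompactSupport.intro isCompact_Icc (fun z hz => h z hz),
    hsub.trans fun z hz => ⟨hac.trans_le hz.1, hz.2.trans_lt hdb⟩⟩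

theorem IsTestFunction.deriv {a b : ℝ} {ψ : ℝ → ℝ} (h : IsTestFunction (Ioo a b) ψ) :
    IsTestFunction (Ioo a b) (deriv ψ) := by
  refine ⟨(contDiff_infty_iff_deriv.1 h.1).2, h.2.1.deriv, ?_⟩
  exact (tsupport_deriv_subset).trans h.2.2

theorem IsTestFunction.memLp_ofReal {a b : ℝ} {ψ : ℝ → ℝ} (h : IsTestFunction (Ioo a b) ψ)
    (p : ℝ≥0∞) : MemLp (fun z => (ψ z : ℂ)) p (volume.restrict (Ioo a b)) := by
  have : Continuous (fun z => (ψ z : ℂ)) := Complex.continuous_ofReal.comp h.1.continuous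
  exact (this.memLp_of_hasCompactSupport (h.2.1.comp_left (g := fun x : ℝ => (x : ℂ)) rfl)).restrict _

/-- The primitive based to the left of the support vanishes on the left because `ψ` does, and on the
right because the total integral is zero. -/
theorem IsTestFunction.exists_primitive {a b : ℝ} {ψ : ℝ → ℝ} (hab : a < b)
    (h : IsTestFunction (Ioo a b) ψ) (h0 : ∫ z, ψ z = 0) :
    ∃ η, IsTestFunction (Ioo a b) η ∧ _root_.deriv η = ψ := by
  obtain ⟨c, d, hac, hcd, hdb, hz⟩ := h.exists_Icc hab
  have hd : ∀ z, HasDerivAt (fun z => ∫ t in c..z, ψ t) (ψ z) z := fun z =>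
    h.1.continuous.integral_hasStrictDerivAt c z |>.hasDerivAt
  refine ⟨fun z => ∫ t in c..z, ψ t, IsTestFunction.of_Icc hac hdb ?_ ?_,
    funext fun z => (hd z).deriv⟩
  · rw [contDiff_infty_iff_deriv]
    refine ⟨fun z => (hd z).differentiableAt, ?_⟩
    rw [show _root_.deriv (fun z => ∫ t in c..z, ψ t) = ψ from funext fun z => (hd z).deriv]
    exact h.1
  · intro z hzn
    by_cases hzc : z < c
    · rw [intervalIntegral.integral_symm, intervalIntegral.integral_of_le hzc.le, neg_eq_zero]
      refine setIntegral_eq_zero_of_forall_eq_zero fun t ht => ?_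
      by_cases htc : t = c
      -- The vanishing hypothesis excludes the point `c` itself; there `ψ` is zero as a limit from
      -- the left.
      · have hcl : Tendsto ψ (𝓝[<] c) (𝓝 (ψ c)) := h.1.continuous.continuousAt.mono_left inf_le_left
        have : Tendsto ψ (𝓝[<] c) (𝓝 0) := tendsto_const_nhds.congr' (by
          filter_upwards [self_mem_nhdsWithin] with y hy
          exact (hz y fun hy' => absurd hy'.1 (not_le.2 hy)).symm)
        rw [htc]; exact tendsto_nhds_unique hcl this
      · exact hz t fun ht' => htc (le_antisymm ht.2 ht'.1)
    · have hzd : d < z := by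
        by_contra hcon
        exact hzn ⟨not_lt.1 hzc, not_lt.1 hcon⟩
      rw [← h0]
      have hcz : c ≤ z := not_lt.1 hzc
      rw [intervalIntegral.integral_of_le hcz, ← integral_Icc_eq_integral_Ioc]
      refine setIntegral_eq_integral_of_forall_compl_eq_zero fun t ht => hz t fun ht' => ht
        ⟨ht'.1, ht'.2.trans hzd.le⟩

theorem exists_isTestFunction_integral_eq_one {a b : ℝ} (hab : a < b) :
    ∃ ψ, IsTestFunction (Ioo a b) ψ ∧ ∫ z, ψ z = 1 := by
  let f : ContDiffBump ((a + b) / 2) :=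
    { rIn := (b - a) / 8, rOut := (b - a) / 4, rIn_pos := by linarith, rIn_lt_rOut := by linarith }
  refine ⟨f.normed volume, ⟨f.contDiff_normed, f.hasCompactSupport_normed, ?_⟩,
    f.integral_normed⟩
  rw [f.tsupport_normed_eq]
  intro z hz
  rw [Metric.mem_closedBall, Real.dist_eq, abs_le] at hz
  have : f.rOut = (b - a) / 4 := rfl
  rw [this] at hz
  constructor <;> linarith [hz.1, hz.2]

theorem ae_eq_zero_of_forall_testFunction {a b : ℝ} {p : ℝ → ℂ}
    (hp : IntegrableOn p (Ioo a b))
    (h : ∀ ψ, IsTestFunction (Ioo a b) ψ → ∫ z in Ioo a b, p z * (ψ z : ℂ) = 0) :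
    p =ᵐ[volume.restrict (Ioo a b)] 0 := by
  have := isOpen_Ioo.ae_eq_zero_of_integral_contDiff_smul_eq_zero (μ := volume)
    hp.locallyIntegrableOn (fun g h1 h2 h3 => by
      have := h g ⟨h1, h2, h3⟩
      rw [← this, ← setIntegral_eq_integral_of_forall_compl_eq_zero (s := Ioo a b)]
      · refine setIntegral_congr_fun measurableSet_Ioo fun z _ => ?_
        simp [mul_comm]
      · intro z hz
        rw [image_eq_zero_of_notMem_tsupport (fun hh => hz (h3 hh)), zero_smul])
  rw [EventuallyEq, ae_restrict_iff' measurableSet_Ioo]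
  exact this

theorem IsTestFunction.integrable_mul {a b : ℝ} {ψ : ℝ → ℝ} (h : IsTestFunction (Ioo a b) ψ)
    {p : ℝ → ℂ} (hp : IntegrableOn p (Ioo a b)) :
    IntegrableOn (fun z => p z * (ψ z : ℂ)) (Ioo a b) := by
  have hc : Continuous (fun z => (ψ z : ℂ)) := Complex.continuous_ofReal.comp h.1.continuous
  obtain ⟨C, hC⟩ := (h.2.1.comp_left (g := fun x : ℝ => (x : ℂ)) rfl).exists_bound_of_continuous hc
  exact Integrable.mul_bdd (c := C) hp hc.aestronglyMeasurable (ae_of_all _ hC)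

/-- The lemma of du Bois-Reymond: subtracting from `φ` a multiple of a fixed `ψ0` of integral one
leaves the derivative of a test function, on which `p` vanishes. So `p` acts on `φ` as the constant
`∫ p ψ0`. -/
theorem exists_ae_eq_const_of_isWeakDeriv_zero {a b : ℝ} (hab : a < b) {p : ℝ → ℂ}
    (hp : IntegrableOn p (Ioo a b)) (h : IsWeakDeriv a b p 0) :
    ∃ C : ℂ, p =ᵐ[volume.restrict (Ioo a b)] fun _ => C := by
  obtain ⟨ψ0, hψ0, hψ1⟩ := exists_isTestFunction_integral_eq_one hab
  refine ⟨∫ z in Ioo a b, p z * (ψ0 z : ℂ), ?_⟩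
  set C := ∫ z in Ioo a b, p z * (ψ0 z : ℂ) with hC
  have hpC : IntegrableOn (fun z => p z - C) (Ioo a b) := hp.sub (integrableOn_const (by simp))
  have key := ae_eq_zero_of_forall_testFunction hpC (fun φ hφ => by
    have hint : Integrable φ := hφ.1.continuous.integrable_of_hasCompactSupport hφ.2.1
    have hint0 : Integrable ψ0 := hψ0.1.continuous.integrable_of_hasCompactSupport hψ0.2.1
    obtain ⟨c, d, hac, hcd, hdb, hz⟩ := hφ.exists_Icc hab
    obtain ⟨c', d', hac', hcd', hdb', hz'⟩ := hψ0.exists_Icc hab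
    have ht : IsTestFunction (Ioo a b) (fun z => φ z - (∫ t, φ t) * ψ0 z) := by
      refine IsTestFunction.of_Icc (c := min c c') (d := max d d') (lt_min hac hac')
        (max_lt hdb hdb') (hφ.1.sub (contDiff_const.mul hψ0.1)) (fun z hzn => ?_)
      rw [hz z fun hh => hzn ⟨(min_le_left _ _).trans hh.1, hh.2.trans (le_max_left _ _)⟩,
        hz' z fun hh => hzn ⟨(min_le_right _ _).trans hh.1, hh.2.trans (le_max_right _ _)⟩]
      simp
    obtain ⟨η, hη, hη'⟩ := ht.exists_primitive hab (by
      rw [integral_sub hint (hint0.const_mul _), integral_const_mul, hψ1]; ring)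
    have h1 := h η hη
    rw [hη'] at h1
    simp only [Pi.zero_apply, zero_mul, integral_zero, neg_zero] at h1
    have h2 : ∫ z in Ioo a b, (φ z : ℂ) = ((∫ t, φ t : ℝ) : ℂ) := by
      rw [← integral_complex_ofReal]
      refine setIntegral_eq_integral_of_forall_compl_eq_zero fun z hzn => ?_
      rw [image_eq_zero_of_notMem_tsupport fun hh => hzn (hφ.2.2 hh)]; simp
    have e1 : ∀ z, p z * ((φ z - (∫ t, φ t) * ψ0 z : ℝ) : ℂ) =
      p z * (φ z : ℂ) - ((∫ t, φ t : ℝ) : ℂ) * (p z * (ψ0 z : ℂ)) := fun z => by push_cast; ring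
    simp_rw [e1] at h1
    rw [integral_sub (hφ.integrable_mul hp) ((hψ0.integrable_mul hp).const_mul _),
      integral_const_mul, ← hC, sub_eq_zero] at h1
    simp_rw [sub_mul]
    rw [integral_sub (hφ.integrable_mul hp) ((hφ.memLp_ofReal 1).integrable le_rfl |>.const_mul _),
      integral_const_mul, h2, h1]
    ring)
  filter_upwards [key] with z hz
  exact sub_eq_zero.1 hz

theorem isWeakDeriv_primitive {a b : ℝ} (hab : a < b) {q : ℝ → ℂ}
    (hq : IntegrableOn q (Ioo a b)) : IsWeakDeriv a b (fun z => ∫ t in a..z, q t) q := by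
  intro ψ hψ
  have hqi : IntervalIntegrable q volume a b :=
    (intervalIntegrable_iff_integrableOn_Ioo_of_le hab.le).2 hq
  have hcd := contDiff_infty_iff_deriv.1 hψ.1
  have h := integral_primitive_mul_add hab.le hqi (f := ψ) (f1 := deriv ψ)
    (fun z _ => (hcd.1 z).hasDerivAt) hcd.2.continuous.continuousOn 0
  have hb : ψ b = 0 := image_eq_zero_of_notMem_tsupport fun hh => lt_irrefl _ (hψ.2.2 hh).2
  simp only [zero_add, hb, zero_mul, sub_zero, Complex.ofReal_zero, mul_zero] at h
  rw [intervalIntegral.integral_of_le hab.le, integral_Ioc_eq_integral_Ioo, integral_add] at h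
  · exact eq_neg_of_add_eq_zero_left h
  · refine hψ.deriv.integrable_mul (IntegrableOn.mono_set ?_ Ioo_subset_Icc_self)
    rw [← uIcc_of_le hab.le]
    exact (intervalIntegral.continuousOn_primitive_interval' hqi (by simp)).integrableOn_compact
      isCompact_uIcc
  · exact hψ.integrable_mul hq

theorem IsWeakDeriv.exists_ae_eq_primitive {a b : ℝ} (hab : a < b) {p q : ℝ → ℂ}
    (hp : IntegrableOn p (Ioo a b)) (hq : IntegrableOn q (Ioo a b)) (h : IsWeakDeriv a b p q) :
    ∃ C : ℂ, p =ᵐ[volume.restrict (Ioo a b)] fun z => C + ∫ t in a..z, q t := by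
  have hqi : IntervalIntegrable q volume a b :=
    (intervalIntegrable_iff_integrableOn_Ioo_of_le hab.le).2 hq
  have hGi : IntegrableOn (fun z => ∫ t in a..z, q t) (Ioo a b) := by
    refine IntegrableOn.mono_set ?_ Ioo_subset_Icc_self
    rw [← uIcc_of_le hab.le]
    exact (intervalIntegral.continuousOn_primitive_interval' hqi (by simp)).integrableOn_compact
      isCompact_uIcc
  obtain ⟨C, hC⟩ := exists_ae_eq_const_of_isWeakDeriv_zero hab (hp.sub hGi) (fun ψ hψ => by
    have h1 := h ψ hψ
    have h2 := isWeakDeriv_primitive hab hq ψ hψ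
    simp only [Pi.sub_apply, sub_mul, Pi.zero_apply, zero_mul, integral_zero, neg_zero]
    rw [integral_sub (hψ.deriv.integrable_mul hp) (hψ.deriv.integrable_mul hGi), h1, h2, sub_self])
  refine ⟨C, ?_⟩
  filter_upwards [hC] with z hz
  rw [← hz]; simp

/-- If `A` and `B` are continuous on `[a, b]` and `A' = B` weakly, then `A` is a primitive
of `B`. -/
theorem IsWeakDeriv.eq_add_integral {a b : ℝ} (hab : a < b) {A B : ℝ → ℂ}
    (hA : ContinuousOn A (Icc a b)) (hB : ContinuousOn B (Icc a b)) (h : IsWeakDeriv a b A B) :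
    ∀ t ∈ Icc a b, A t = A a + ∫ τ in a..t, B τ := by
  have hBi : IntegrableOn B (Ioo a b) :=
    (hB.integrableOn_compact isCompact_Icc).mono_set Ioo_subset_Icc_self
  obtain ⟨C, hC⟩ := h.exists_ae_eq_primitive hab
    ((hA.integrableOn_compact isCompact_Icc).mono_set Ioo_subset_Icc_self) hBi
  have hqi : IntervalIntegrable B volume a b :=
    (intervalIntegrable_iff_integrableOn_Ioo_of_le hab.le).2 hBi
  have hG : ContinuousOn (fun z => C + ∫ t in a..z, B t) (Icc a b) := by
    rw [← uIcc_of_le hab.le]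
    exact continuousOn_const.add (intervalIntegral.continuousOn_primitive_interval' hqi (by simp))
  have hIoo : EqOn A (fun z => C + ∫ t in a..z, B t) (Ioo a b) :=
    Measure.eqOn_open_of_ae_eq hC isOpen_Ioo (hA.mono Ioo_subset_Icc_self)
      (hG.mono Ioo_subset_Icc_self)
  have hIcc : EqOn A (fun z => C + ∫ t in a..z, B t) (Icc a b) :=
    hIoo.of_subset_closure hA hG Ioo_subset_Icc_self (by rw [closure_Ioo hab.ne])
  intro t ht
  rw [hIcc ht, hIcc (left_mem_Icc.2 hab.le)]
  simp

/-- `p` has a continuous representative on `(a, b)` that vanishes at both end points. -/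
def VanishesAtEnds (a b : ℝ) (p : ℝ → ℂ) : Prop :=
  ∃ U : ℝ → ℂ, ContinuousOn U (Ioo a b) ∧ p =ᵐ[volume.restrict (Ioo a b)] U ∧
    Tendsto U (𝓝[>] a) (𝓝 0) ∧ Tendsto U (𝓝[<] b) (𝓝 0)

theorem VanishesAtEnds.congr {a b : ℝ} {p p' : ℝ → ℂ} (h : VanishesAtEnds a b p)
    (hp : p' =ᵐ[volume.restrict (Ioo a b)] p) : VanishesAtEnds a b p' := by
  obtain ⟨U, h1, h2, h3⟩ := h
  exact ⟨U, h1, hp.trans h2, h3⟩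

/-- Integration by parts on `(a, b)` without boundary terms. -/
theorem IsWeakDeriv.integral_mul_add_eq_zero {a b : ℝ} (hab : a < b) {p q : ℝ → ℂ}
    (hp : IntegrableOn p (Ioo a b)) (hq : IntegrableOn q (Ioo a b)) (h : IsWeakDeriv a b p q)
    {f f1 : ℝ → ℝ} {K : ℝ} (hf : ∀ z ∈ Ioo a b, HasDerivAt f (f1 z) z)
    (hf1 : ContinuousOn f1 (Ioo a b)) (hfb : ∀ z ∈ Ioo a b, |f z| ≤ K)
    (hf1b : ∀ z ∈ Ioo a b, |f1 z| ≤ K)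
    (hends : VanishesAtEnds a b p ∨ (Tendsto f (𝓝[>] a) (𝓝 0) ∧ Tendsto f (𝓝[<] b) (𝓝 0))) :
    ∫ z in Ioo a b, (p z * (f1 z : ℂ) + q z * (f z : ℂ)) = 0 := by
  obtain ⟨C, hC⟩ := h.exists_ae_eq_primitive hab hp hq
  set G : ℝ → ℂ := fun z => C + ∫ t in a..z, q t with hGdef
  have hqi : IntervalIntegrable q volume a b :=
    (intervalIntegrable_iff_integrableOn_Ioo_of_le hab.le).2 hq
  have hG : ContinuousOn G (Icc a b) := by
    rw [← uIcc_of_le hab.le]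
    exact continuousOn_const.add (intervalIntegral.continuousOn_primitive_interval' hqi (by simp))
  have hfc : ContinuousOn f (Ioo a b) := fun z hz => (hf z hz).continuousAt.continuousWithinAt
  have hGa : Tendsto G (𝓝[>] a) (𝓝 (G a)) :=
    ((hG a (left_mem_Icc.2 hab.le)).mono_left
      ((nhdsWithin_Ioo_eq_nhdsGT hab).symm.le.trans (nhdsWithin_mono _ Ioo_subset_Icc_self)))
  have hGb : Tendsto G (𝓝[<] b) (𝓝 (G b)) :=
    ((hG b (right_mem_Icc.2 hab.le)).mono_left
      ((nhdsWithin_Ioo_eq_nhdsLT hab).symm.le.trans (nhdsWithin_mono _ Ioo_subset_Icc_self)))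
  have hba : IsBoundedUnder (· ≤ ·) (𝓝[>] a) (fun z => ‖(f z : ℂ)‖) :=
    isBoundedUnder_of_eventually_le (a := K) (by
      filter_upwards [Ioo_mem_nhdsGT hab] with z hz
      simpa using hfb z hz)
  have hbb : IsBoundedUnder (· ≤ ·) (𝓝[<] b) (fun z => ‖(f z : ℂ)‖) :=
    isBoundedUnder_of_eventually_le (a := K) (by
      filter_upwards [Ioo_mem_nhdsLT hab] with z hz
      simpa using hfb z hz)
  -- Under either alternative one factor tends to zero and the other stays bounded, so no boundary
  -- term survives.
  have hends' : Tendsto (fun z => G z * (f z : ℂ)) (𝓝[>] a) (𝓝 0) ∧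
      Tendsto (fun z => G z * (f z : ℂ)) (𝓝[<] b) (𝓝 0) := by
    rcases hends with ⟨U, hU, hpU, hUa, hUb⟩ | ⟨ha, hb⟩
    · have hGU : EqOn G U (Ioo a b) := Measure.eqOn_open_of_ae_eq (hC.symm.trans hpU) isOpen_Ioo
        (hG.mono Ioo_subset_Icc_self) hU
      constructor
      · refine (hUa.congr' ?_).zero_mul_isBoundedUnder_le hba
        filter_upwards [Ioo_mem_nhdsGT hab] with z hz using (hGU hz).symm
      · refine (hUb.congr' ?_).zero_mul_isBoundedUnder_le hbb
        filter_upwards [Ioo_mem_nhdsLT hab] with z hz using (hGU hz).symm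
    · have ha' : Tendsto (fun z => (f z : ℂ)) (𝓝[>] a) (𝓝 ((0 : ℝ) : ℂ)) :=
        (Complex.continuous_ofReal.tendsto 0).comp ha
      have hb' : Tendsto (fun z => (f z : ℂ)) (𝓝[<] b) (𝓝 ((0 : ℝ) : ℂ)) :=
        (Complex.continuous_ofReal.tendsto 0).comp hb
      exact ⟨by simpa using hGa.mul ha', by simpa using hGb.mul hb'⟩
  have hint : IntegrableOn (fun z => G z * (f1 z : ℂ) + q z * (f z : ℂ)) (Ioo a b) := by
    refine Integrable.add ?_ ?_
    · refine Integrable.mul_bdd (c := K)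
        ((hG.integrableOn_compact isCompact_Icc).mono_set Ioo_subset_Icc_self)
        ((Complex.continuous_ofReal.comp_continuousOn hf1).aestronglyMeasurable measurableSet_Ioo) ?_
      filter_upwards [ae_restrict_mem measurableSet_Ioo] with z hz
      simpa using hf1b z hz
    · refine Integrable.mul_bdd (c := K) hq
        ((Complex.continuous_ofReal.comp_continuousOn hfc).aestronglyMeasurable measurableSet_Ioo) ?_
      filter_upwards [ae_restrict_mem measurableSet_Ioo] with z hz
      simpa using hfb z hz
  have hinti : IntervalIntegrable (fun z => G z * (f1 z : ℂ) + q z * (f z : ℂ)) volume a b :=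
    (intervalIntegrable_iff_integrableOn_Ioo_of_le hab.le).2 hint
  have hcongr : ∫ z in Ioo a b, (p z * (f1 z : ℂ) + q z * (f z : ℂ)) =
      ∫ z in a..b, (G z * (f1 z : ℂ) + q z * (f z : ℂ)) := by
    rw [intervalIntegral.integral_of_le hab.le, integral_Ioc_eq_integral_Ioo]
    refine integral_congr_ae ?_
    filter_upwards [hC] with z hz
    rw [hz]
  rw [hcongr]
  -- Only on compact subintervals is `f` known to be `C¹`. The formula is proved there, and the two
  -- halves on either side of a midpoint are extended to the ends by continuity of the integral.
  have hsub : ∀ c d, a < c → c ≤ d → d < b →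
      ∫ z in c..d, (G z * (f1 z : ℂ) + q z * (f z : ℂ)) = G d * f d - G c * f c := by
    intro c d hac hcd hdb
    have hss : Icc c d ⊆ Ioo a b := fun z hz => ⟨hac.trans_le hz.1, hz.2.trans_lt hdb⟩
    have huu : uIcc c d ⊆ uIcc a b := by
      rw [uIcc_of_le hcd, uIcc_of_le hab.le]; exact hss.trans Ioo_subset_Icc_self
    have huc : uIcc a c ⊆ uIcc a b := by
      rw [uIcc_of_le hac.le, uIcc_of_le hab.le]; exact Icc_subset_Icc_right (hcd.trans hdb.le)
    have hGz : ∀ z ∈ uIcc c d, G z = G c + ∫ t in c..z, q t := by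
      intro z hz
      simp only [hGdef, add_assoc]
      rw [intervalIntegral.integral_add_adjacent_intervals (hqi.mono_set huc)
        ((hqi.mono_set huu).mono_set (uIcc_subset_uIcc (by simp) hz))]
    have := integral_primitive_mul_add hcd (hqi.mono_set huu) (fun z hz => hf z (hss hz))
      (hf1.mono hss) (G c)
    rw [← hGz d (by simp)] at this
    rw [← this]
    refine intervalIntegral.integral_congr fun z hz => ?_
    rw [hGz z hz]
  set m := (a + b) / 2
  have ham : a < m := by simp only [m]; linarith
  have hmb : m < b := by simp only [m]; linarith
  have hF : ContinuousOn (fun x => ∫ z in m..x, (G z * (f1 z : ℂ) + q z * (f z : ℂ))) (uIcc a b) :=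
    intervalIntegral.continuousOn_primitive_interval' hinti (by
      rw [uIcc_of_le hab.le]; exact ⟨ham.le, hmb.le⟩)
  rw [uIcc_of_le hab.le] at hF
  have h1 : Tendsto (fun x => ∫ z in m..x, (G z * (f1 z : ℂ) + q z * (f z : ℂ))) (𝓝[>] a)
      (𝓝 (∫ z in m..a, (G z * (f1 z : ℂ) + q z * (f z : ℂ)))) :=
    (hF a (left_mem_Icc.2 hab.le)).mono_left
      ((nhdsWithin_Ioo_eq_nhdsGT hab).symm.le.trans (nhdsWithin_mono _ Ioo_subset_Icc_self))
  have h2 : Tendsto (fun x => ∫ z in m..x, (G z * (f1 z : ℂ) + q z * (f z : ℂ))) (𝓝[<] b)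
      (𝓝 (∫ z in m..b, (G z * (f1 z : ℂ) + q z * (f z : ℂ)))) :=
    (hF b (right_mem_Icc.2 hab.le)).mono_left
      ((nhdsWithin_Ioo_eq_nhdsLT hab).symm.le.trans (nhdsWithin_mono _ Ioo_subset_Icc_self))
  have h1' : Tendsto (fun x => ∫ z in m..x, (G z * (f1 z : ℂ) + q z * (f z : ℂ))) (𝓝[>] a)
      (𝓝 (0 - G m * f m)) := by
    refine (hends'.1.sub_const _).congr' ?_
    filter_upwards [Ioo_mem_nhdsGT ham] with x hx
    rw [intervalIntegral.integral_symm, hsub x m hx.1 hx.2.le hmb]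
    ring
  have h2' : Tendsto (fun x => ∫ z in m..x, (G z * (f1 z : ℂ) + q z * (f z : ℂ))) (𝓝[<] b)
      (𝓝 (0 - G m * f m)) := by
    refine (hends'.2.sub_const _).congr' ?_
    filter_upwards [Ioo_mem_nhdsLT hmb] with x hx
    rw [hsub m x ham hx.1.le hx.2]
  have e1 := tendsto_nhds_unique h1 h1'
  have e2 := tendsto_nhds_unique h2 h2'
  have hmem : ∀ {x y}, x ∈ Icc a b → y ∈ Icc a b → uIcc x y ⊆ uIcc a b := fun hx hy => by
    rw [uIcc_of_le hab.le]; exact (convex_Icc a b).ordConnected.uIcc_subset hx hy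
  rw [← intervalIntegral.integral_add_adjacent_intervals
    (hinti.mono_set (hmem (left_mem_Icc.2 hab.le) ⟨ham.le, hmb.le⟩))
    (hinti.mono_set (hmem ⟨ham.le, hmb.le⟩ (right_mem_Icc.2 hab.le))), e2,
    intervalIntegral.integral_symm, e1]
  ring

end OneDim

/-! ### From compactly supported real test functions to Schwartz functions -/

section Cutoff

open scoped LineDeriv

variable {d : ℕ}

/-- The `i`-th unit vector of the horizontal space. -/
abbrev hdir (i : Fin d) : Horiz d := EuclideanSpace.single i 1

theorem complex_test_of_real_test {a : Horiz d → ℂ} {b : Fin d → Horiz d → ℂ}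
    (ha : MemLp a 2 volume) (hb : ∀ i, MemLp (b i) 2 volume)
    (h : ∀ χ : Horiz d → ℝ, ContDiff ℝ ∞ χ → HasCompactSupport χ →
      (∫ X, a X * (χ X : ℂ)) + ∑ i, ∫ X, b i X * ((fderiv ℝ χ X (hdir i) : ℝ) : ℂ) = 0)
    (g : Horiz d → ℂ) (hg : ContDiff ℝ ∞ g) (hgc : HasCompactSupport g) :
    (∫ X, a X * g X) + ∑ i, ∫ X, b i X * fderiv ℝ g X (hdir i) = 0 := by
  have hre : ContDiff ℝ ∞ (fun X => (g X).re) := Complex.reCLM.contDiff.comp hg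
  have him : ContDiff ℝ ∞ (fun X => (g X).im) := Complex.imCLM.contDiff.comp hg
  have hrec : HasCompactSupport (fun X => (g X).re) := hgc.comp_left (g := Complex.re) rfl
  have himc : HasCompactSupport (fun X => (g X).im) := hgc.comp_left (g := Complex.im) rfl
  have hdg : ∀ X, DifferentiableAt ℝ g X := fun X => (hg.differentiable (by simp)) X
  have fre : ∀ X v, fderiv ℝ (fun X => (g X).re) X v = (fderiv ℝ g X v).re := fun X v => by
    have := (Complex.reCLM.hasFDerivAt.comp X (hdg X).hasFDerivAt).fderiv
    change fderiv ℝ (fun X => (g X).re) X = _ at this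
    rw [this]; rfl
  have fim : ∀ X v, fderiv ℝ (fun X => (g X).im) X v = (fderiv ℝ g X v).im := fun X v => by
    have := (Complex.imCLM.hasFDerivAt.comp X (hdg X).hasFDerivAt).fderiv
    change fderiv ℝ (fun X => (g X).im) X = _ at this
    rw [this]; rfl
  have hr := h _ hre hrec
  have hi := h _ him himc
  simp only [fre, fim] at hr hi
  have mem : ∀ φ : Horiz d → ℝ, Continuous φ → HasCompactSupport φ →
      MemLp (fun X => (φ X : ℂ)) 2 volume := fun φ h1 h2 =>
    (Complex.continuous_ofReal.comp h1).memLp_of_hasCompactSupport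
      (h2.comp_left (g := fun x : ℝ => (x : ℂ)) rfl)
  have hfc : ∀ i, Continuous fun X => fderiv ℝ g X (hdir i) := fun i =>
    (hg.continuous_fderiv (by simp)).clm_apply continuous_const
  have hfcc : ∀ i, HasCompactSupport fun X => fderiv ℝ g X (hdir i) := fun i =>
    hgc.fderiv_apply (𝕜 := ℝ) (hdir i)
  have split : ∀ (u φ : Horiz d → ℂ), MemLp u 2 volume → Continuous φ → HasCompactSupport φ →
      ∫ X, u X * φ X = (∫ X, u X * ((φ X).re : ℂ)) + (∫ X, u X * ((φ X).im : ℂ)) * Complex.I := by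
    intro u φ hu h1 h2
    have m1 := mem (fun X => (φ X).re) (Complex.continuous_re.comp h1)
      (h2.comp_left (g := Complex.re) rfl)
    have m2 := mem (fun X => (φ X).im) (Complex.continuous_im.comp h1)
      (h2.comp_left (g := Complex.im) rfl)
    rw [← integral_mul_const, ← integral_add]
    · refine integral_congr_ae (ae_of_all _ fun X => ?_)
      simp only
      conv_lhs => rw [← Complex.re_add_im (φ X)]
      ring
    · exact hu.integrable_mul m1
    · exact (hu.integrable_mul m2).mul_const _
  rw [split a g ha hg.continuous hgc]
  simp_rw [fun i => split (b i) _ (hb i) (hfc i) (hfcc i)]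
  rw [Finset.sum_add_distrib, ← Finset.sum_mul]
  linear_combination hr + Complex.I * hi

/-- Cut-off functions that converge to `1`, with uniformly small derivatives. -/
theorem exists_cutoff_seq (d : ℕ) : ∃ (θ : ℕ → Horiz d → ℝ) (c : ℕ → ℝ) (M : ℝ),
    (∀ k, ContDiff ℝ ∞ (θ k)) ∧ (∀ k, HasCompactSupport (θ k)) ∧ (∀ k X, |θ k X| ≤ 1) ∧
    (∀ X, ∀ᶠ k in atTop, θ k X = 1) ∧ Tendsto c atTop (𝓝 0) ∧ (∀ k, c k ≤ 1) ∧ 0 ≤ M ∧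
    ∀ k X (i : Fin d), |fderiv ℝ (θ k) X (hdir i)| ≤ c k * M := by
  let f : ContDiffBump (0 : Horiz d) :=
    { rIn := 1, rOut := 2, rIn_pos := by norm_num, rIn_lt_rOut := by norm_num }
  -- Dilating a fixed bump by `c k` spreads its plateau to the whole space and multiplies its
  -- gradient by `c k`.
  let c : ℕ → ℝ := fun k => 1 / ((k : ℝ) + 1)
  have hcpos : ∀ k, 0 < c k := fun k => by positivity
  have hcle : ∀ k, c k ≤ 1 := fun k => by
    simp only [c]
    rw [div_le_one (by positivity)]
    linarith [(Nat.cast_nonneg k : (0 : ℝ) ≤ k)]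
  have hc0 : Tendsto c atTop (𝓝 0) := tendsto_one_div_add_atTop_nhds_zero_nat
  let θ : ℕ → Horiz d → ℝ := fun k X => f (c k • X)
  have hθ : ∀ k, ContDiff ℝ ∞ (θ k) := fun k => f.contDiff.comp (contDiff_id.const_smul (c k))
  have hθc : ∀ k, HasCompactSupport (θ k) := fun k =>
    f.hasCompactSupport.comp_smul (hcpos k).ne'
  have hθ1 : ∀ k X, |θ k X| ≤ 1 := fun k X => by
    rw [abs_of_nonneg f.nonneg]; exact f.le_one
  have hθe : ∀ X, ∀ᶠ k in atTop, θ k X = 1 := fun X => by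
    have : Tendsto (fun k => c k • X) atTop (𝓝 0) := by simpa using hc0.smul_const X
    filter_upwards [this.eventually (Metric.closedBall_mem_nhds 0 one_pos)] with k hk
    exact f.one_of_mem_closedBall hk
  have hfderiv : ∀ k X v, fderiv ℝ (θ k) X v = c k * fderiv ℝ f (c k • X) v := fun k X v => by
    have h1 : HasFDerivAt f (fderiv ℝ f (c k • X)) (c k • X) :=
      ((f.contDiff (n := 1)).differentiable (by simp) _).hasFDerivAt
    have h2 : HasFDerivAt (fun X : Horiz d => c k • X) (c k • ContinuousLinearMap.id ℝ _) X :=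
      (hasFDerivAt_id X).const_smul (c k)
    have := (h1.comp X h2).fderiv
    change fderiv ℝ (θ k) X = _ at this
    rw [this]; simp
  obtain ⟨M, hM⟩ : ∃ M, ∀ X, ‖fderiv ℝ f X‖ ≤ M :=
    (f.hasCompactSupport.fderiv ℝ).exists_bound_of_continuous
      ((f.contDiff (n := 1)).continuous_fderiv (by simp))
  have hM0 : 0 ≤ M := (norm_nonneg _).trans (hM 0)
  have hdir1 : ∀ i : Fin d, ‖(hdir i : Horiz d)‖ = 1 := fun i => by simp [hdir]
  have hfb : ∀ k X (i : Fin d), |fderiv ℝ (θ k) X (hdir i)| ≤ c k * M := fun k X i => by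
    rw [hfderiv, abs_mul, abs_of_pos (hcpos k)]
    refine mul_le_mul_of_nonneg_left ?_ (hcpos k).le
    have := (fderiv ℝ f (c k • X)).le_opNorm (hdir i)
    rw [hdir1, mul_one] at this
    exact this.trans (hM _)
  exact ⟨θ, c, M, hθ, hθc, hθ1, hθe, hc0, hcle, hM0, hfb⟩

/-- The equations are given against compactly supported tests, a class preserved neither by `Λ^r`
nor by the Fourier transform. Cutting off `χ` and passing to the limit is legitimate because `a`, `b
i`, `χ` and its derivatives are in `L²`; the term where the derivative falls on the cut-off tends to
zero. -/
theorem schwartz_test_of_real_test {a : Horiz d → ℂ} {b : Fin d → Horiz d → ℂ}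
    (ha : MemLp a 2 volume) (hb : ∀ i, MemLp (b i) 2 volume)
    (h : ∀ χ : Horiz d → ℝ, ContDiff ℝ ∞ χ → HasCompactSupport χ →
      (∫ X, a X * (χ X : ℂ)) + ∑ i, ∫ X, b i X * ((fderiv ℝ χ X (hdir i) : ℝ) : ℂ) = 0)
    (χ : 𝓢(Horiz d, ℂ)) :
    (∫ X, a X * χ X) + ∑ i, ∫ X, b i X * (∂_{hdir i} χ) X = 0 := by
  obtain ⟨θ, c, M, hθ, hθc, hθ1, hθe, hc0, hcle, hM0, hfb⟩ := exists_cutoff_seq d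
  let g : ℕ → Horiz d → ℂ := fun k X => (θ k X : ℂ) * χ X
  have hθC : ∀ k, ContDiff ℝ ∞ fun X => (θ k X : ℂ) := fun k =>
    Complex.ofRealCLM.contDiff.comp (hθ k)
  have hg : ∀ k, ContDiff ℝ ∞ (g k) := fun k => (hθC k).mul (χ.smooth ⊤)
  have hgc : ∀ k, HasCompactSupport (g k) := fun k =>
    ((hθc k).comp_left (g := fun x : ℝ => (x : ℂ)) rfl).mul_right
  have hgd : ∀ k X (i : Fin d), fderiv ℝ (g k) X (hdir i) =
      (θ k X : ℂ) * (∂_{hdir i} χ) X + ((fderiv ℝ (θ k) X (hdir i) : ℝ) : ℂ) * χ X := by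
    intro k X i
    have h1 : HasFDerivAt (fun X => (θ k X : ℂ)) (Complex.ofRealCLM.comp (fderiv ℝ (θ k) X)) X :=
      Complex.ofRealCLM.hasFDerivAt.comp X
        (((hθ k).differentiable (by simp)) X).hasFDerivAt
    have h2 : HasFDerivAt χ (fderiv ℝ χ X) X := (χ.differentiableAt).hasFDerivAt
    have := (h1.mul h2).fderiv
    change fderiv ℝ (g k) X = _ at this
    rw [this, SchwartzMap.lineDerivOp_apply_eq_fderiv]
    simp [mul_comm]
  have hχ : MemLp χ 2 volume := χ.memLp 2
  have hχd : ∀ i : Fin d, MemLp (∂_{hdir i} χ : 𝓢(Horiz d, ℂ)) 2 volume := fun i => (∂_{hdir i} χ : 𝓢(Horiz d, ℂ)).memLp 2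
  have lim1 : Tendsto (fun k => ∫ X, a X * g k X) atTop (𝓝 (∫ X, a X * χ X)) := by
    refine tendsto_integral_of_dominated_convergence (fun X => ‖a X * χ X‖)
      (fun k => ha.1.mul (hg k).continuous.aestronglyMeasurable)
      (ha.integrable_mul hχ).norm (fun k => ae_of_all _ fun X => ?_) (ae_of_all _ fun X => ?_)
    · simp only [g, norm_mul, Complex.norm_real, Real.norm_eq_abs]
      refine mul_le_mul_of_nonneg_left ?_ (norm_nonneg _)
      exact mul_le_of_le_one_left (norm_nonneg _) (hθ1 k X)
    · refine tendsto_const_nhds.congr' ?_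
      filter_upwards [hθe X] with k hk
      simp [g, hk]
  have lim2 : ∀ i, Tendsto (fun k => ∫ X, b i X * fderiv ℝ (g k) X (hdir i)) atTop
      (𝓝 (∫ X, b i X * (∂_{hdir i} χ) X)) := by
    intro i
    have j1 : Integrable (fun X => b i X * (∂_{hdir i} χ) X) := (hb i).integrable_mul (hχd i)
    have j2 : Integrable (fun X => b i X * χ X) := (hb i).integrable_mul hχ
    let χi : 𝓢(Horiz d, ℂ) := ∂_{hdir i} χ
    let bd : Horiz d → ℝ := fun X => ‖b i X * χi X‖ + M * ‖b i X * χ X‖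
    have j3 : Integrable bd := j1.norm.add (j2.norm.const_mul M)
    have j4 : ∀ k, AEStronglyMeasurable (fun X => b i X * fderiv ℝ (g k) X (hdir i)) volume :=
      fun k => (hb i).1.mul (((hg k).continuous_fderiv (by simp)).clm_apply
        continuous_const).aestronglyMeasurable
    refine tendsto_integral_of_dominated_convergence
      bd j4 j3 (fun k => ae_of_all _ fun X => ?_) (ae_of_all _ fun X => ?_)
    · rw [hgd, mul_add]
      refine (norm_add_le _ _).trans (add_le_add ?_ ?_)
      · simp only [norm_mul, Complex.norm_real, Real.norm_eq_abs]
        refine mul_le_mul_of_nonneg_left ?_ (norm_nonneg _)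
        exact mul_le_of_le_one_left (norm_nonneg _) (hθ1 k X)
      · simp only [norm_mul, Complex.norm_real, Real.norm_eq_abs]
        have := (hfb k X i).trans (mul_le_of_le_one_left hM0 (hcle k))
        calc _ ≤ ‖b i X‖ * (M * ‖χ X‖) := by gcongr
          _ = _ := by ring
    · have t1 : Tendsto (fun k => (θ k X : ℂ) * (∂_{hdir i} χ) X) atTop
          (𝓝 ((∂_{hdir i} χ) X)) := by
        refine tendsto_const_nhds.congr' ?_
        filter_upwards [hθe X] with k hk
        simp [hk]
      have t2 : Tendsto (fun k => ((fderiv ℝ (θ k) X (hdir i) : ℝ) : ℂ) * χ X) atTop (𝓝 0) := by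
        rw [tendsto_zero_iff_norm_tendsto_zero]
        refine squeeze_zero (fun k => norm_nonneg _) (g := fun k => c k * M * ‖χ X‖) (fun k => ?_) ?_
        · rw [norm_mul, Complex.norm_real, Real.norm_eq_abs]
          exact mul_le_mul_of_nonneg_right (hfb k X i) (norm_nonneg _)
        · simpa using (hc0.mul_const M).mul_const ‖χ X‖
      simp_rw [hgd]
      simpa using (t1.add t2).const_mul (b i X)
  have lim := lim1.add (tendsto_finsetSum Finset.univ fun i _ => lim2 i)
  refine tendsto_nhds_unique lim (tendsto_const_nhds.congr fun k => ?_)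
  exact (complex_test_of_real_test ha hb h (g k) (hg k) (hgc k)).symm

end Cutoff

/-! ### Fourier multipliers on Schwartz functions and on square-integrable functions -/

section Symbols

open scoped FourierTransform LineDeriv

variable {d : ℕ}

/-- Complex `L²` functions of the horizontal variable. -/
abbrev HorizL2 (d : ℕ) : Type := Lp ℂ 2 (volume : Measure (Horiz d))

/-- Complex `L²` functions on the strip. -/
abbrev StripL2 (d : ℕ) (H : ℝ) : Type := Lp ℂ 2 (volume.restrict (strip d H))

theorem volume_restrict_strip (d : ℕ) (H : ℝ) :
    (volume.restrict (strip d H) : Measure (Horiz d × ℝ)) =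
      (volume : Measure (Horiz d)).prod (volume.restrict (Ioo (-H) 0)) := by
  rw [strip, Measure.volume_eq_prod, ← Measure.prod_restrict, Measure.restrict_univ]

theorem lambdaSymbol_pos (r : ℝ) (ξ : Horiz d) : 0 < lambdaSymbol d r ξ :=
  Real.rpow_pos_of_pos (by positivity) _

theorem continuous_lambdaSymbol (r : ℝ) : Continuous (lambdaSymbol d r) :=
  (lambdaSymbol_hasTemperateGrowth d r).1.continuous

theorem lambdaSymbol_add (r r' : ℝ) (ξ : Horiz d) :
    lambdaSymbol d (r + r') ξ = lambdaSymbol d r ξ * lambdaSymbol d r' ξ := by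
  rw [lambdaSymbol, lambdaSymbol, lambdaSymbol, ← Real.rpow_add (by positivity), add_div]

theorem lambdaSymbol_le_one {r : ℝ} (hr : r ≤ 0) (ξ : Horiz d) : lambdaSymbol d r ξ ≤ 1 :=
  Real.rpow_le_one_of_one_le_of_nonpos (by linarith [sq_nonneg ‖(2 * Real.pi) • ξ‖])
    (by linarith)

theorem hasTemperateGrowth_lambdaSymbol_complex (r : ℝ) :
    (fun ξ : Horiz d => ((lambdaSymbol d r ξ : ℝ) : ℂ)).HasTemperateGrowth := by
  have := lambdaSymbol_hasTemperateGrowth d r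
  fun_prop

/-- Multiplication of a Schwartz function by the symbol of `Λ^r`. -/
def symbolMul (r : ℝ) (φ : 𝓢(Horiz d, ℂ)) : 𝓢(Horiz d, ℂ) :=
  SchwartzMap.smulLeftCLM ℂ (fun ξ : Horiz d => ((lambdaSymbol d r ξ : ℝ) : ℂ)) φ

theorem symbolMul_apply (r : ℝ) (φ : 𝓢(Horiz d, ℂ)) (ξ : Horiz d) :
    symbolMul r φ ξ = (lambdaSymbol d r ξ : ℂ) * φ ξ := by
  rw [symbolMul, SchwartzMap.smulLeftCLM_apply_apply (hasTemperateGrowth_lambdaSymbol_complex r)]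
  rfl

/-- Every Schwartz function is `𝓕⁻ φ`, and in the variable `φ` the operator is multiplication by its
symbol. All later computations with `Λ^r` and `∂_i` are done in this form. -/
theorem lambdaPow_fourierInv (r : ℝ) (φ : 𝓢(Horiz d, ℂ)) :
    lambdaPow d r (𝓕⁻ φ) = 𝓕⁻ (symbolMul r φ) := by
  rw [lambdaPow, SchwartzMap.fourierMultiplierCLM_apply, FourierTransform.fourier_fourierInv_eq,
    symbolMul]

theorem lambdaPow_lambdaPow (r r' : ℝ) (χ : 𝓢(Horiz d, ℂ)) :
    lambdaPow d r (lambdaPow d r' χ) = lambdaPow d (r + r') χ := by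
  obtain ⟨φ, rfl⟩ : ∃ φ : 𝓢(Horiz d, ℂ), χ = 𝓕⁻ φ :=
    ⟨𝓕 χ, (FourierTransform.fourierInv_fourier_eq χ).symm⟩
  rw [lambdaPow_fourierInv, lambdaPow_fourierInv, lambdaPow_fourierInv]
  congr 1
  ext ξ
  simp only [symbolMul_apply, lambdaSymbol_add]
  push_cast; ring

theorem lambdaPow_zero (χ : 𝓢(Horiz d, ℂ)) : lambdaPow d 0 χ = χ := by
  obtain ⟨φ, rfl⟩ : ∃ φ : 𝓢(Horiz d, ℂ), χ = 𝓕⁻ φ :=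
    ⟨𝓕 χ, (FourierTransform.fourierInv_fourier_eq χ).symm⟩
  rw [lambdaPow_fourierInv]
  congr 1
  ext ξ
  simp [symbolMul_apply, lambdaSymbol]

/-- The multiplication by the symbol `2πi ξ_i` of `∂_i`. -/
def dirMul (i : Fin d) (φ : 𝓢(Horiz d, ℂ)) : 𝓢(Horiz d, ℂ) :=
  (2 * ↑Real.pi * Complex.I) •
    SchwartzMap.smulLeftCLM ℂ (fun x : Horiz d => inner ℝ x (hdir i)) φ

theorem dirMul_apply (i : Fin d) (φ : 𝓢(Horiz d, ℂ)) (ξ : Horiz d) :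
    dirMul i φ ξ = (2 * ↑Real.pi * Complex.I * (ξ i : ℂ)) * φ ξ := by
  rw [dirMul, smul_apply, SchwartzMap.smulLeftCLM_apply_apply (by fun_prop)]
  simp [EuclideanSpace.inner_single_right]
  ring

theorem lineDeriv_fourierInv (i : Fin d) (φ : 𝓢(Horiz d, ℂ)) :
    ∂_{hdir i} (𝓕⁻ φ) = 𝓕⁻ (dirMul i φ) := by
  rw [SchwartzMap.lineDerivOp_fourierInv_eq, dirMul]

/-- For the pairing without conjugation, `𝓕⁻` is its own transpose. For this reason the transforms
of the modal coefficients below are taken with `𝓕⁻`. -/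
theorem integral_mul_fourierInv (a : HorizL2 d) (φ : 𝓢(Horiz d, ℂ)) :
    ∫ X, a X * (𝓕⁻ φ) X = ∫ ξ, (𝓕⁻ a) ξ * φ ξ := by
  have h := DFunLike.congr_fun (Lp.fourierInv_toTemperedDistribution_eq a) φ
  rw [TemperedDistribution.fourierInv_apply] at h
  simp only [Lp.toTemperedDistribution_apply] at h
  simpa [mul_comm] using h

theorem ae_eq_zero_of_forall_schwartz {G : Horiz d → ℂ} (hG : LocallyIntegrable G volume)
    (h : ∀ φ : 𝓢(Horiz d, ℂ), ∫ ξ, G ξ * φ ξ = 0) : G =ᵐ[volume] 0 := by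
  refine ae_eq_zero_of_integral_contDiff_smul_eq_zero hG fun g hg hgc => ?_
  have h1 : HasCompactSupport (Complex.ofRealCLM ∘ g) := hgc.comp_left rfl
  have h2 : ContDiff ℝ ∞ (Complex.ofRealCLM ∘ g) := by fun_prop
  rw [← h (h1.toSchwartzMap h2)]
  refine integral_congr_ae (ae_of_all _ fun ξ => ?_)
  simp [mul_comm]

theorem locallyIntegrable_mul_L2 (U : HorizL2 d) {c : Horiz d → ℂ} (hc : Continuous c) :
    LocallyIntegrable (fun ξ => c ξ * U ξ) volume := by
  have h := (Lp.memLp U).locallyIntegrable (by norm_num : (1 : ℝ≥0∞) ≤ 2)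
  rw [← locallyIntegrableOn_univ] at h ⊢
  exact LocallyIntegrableOn.continuousOn_mul h hc.continuousOn isOpen_univ.isLocallyClosed

theorem integrable_L2_mul_schwartz (U : HorizL2 d) (φ : 𝓢(Horiz d, ℂ)) :
    Integrable (fun ξ => U ξ * φ ξ) volume :=
  (Lp.memLp U).integrable_mul (φ.memLp 2)

/-- Multiplication by a bounded function on `L²(ℝ^d)`. -/
theorem exists_mulCLM {q : Horiz d → ℝ} (hq : Measurable q) {K : ℝ} (hK : ∀ ξ, |q ξ| ≤ K) :
    ∃ M : HorizL2 d →L[ℂ] HorizL2 d, ∀ U, M U =ᵐ[volume] fun ξ => (q ξ : ℂ) * U ξ := by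
  have hm : AEStronglyMeasurable (fun ξ => (q ξ : ℂ)) (volume : Measure (Horiz d)) :=
    (Complex.measurable_ofReal.comp hq).aestronglyMeasurable
  have hmem : ∀ U : HorizL2 d, MemLp (fun ξ => (q ξ : ℂ) * U ξ) 2 volume := fun U =>
    MemLp.of_le_mul (Lp.memLp U) (hm.mul (Lp.memLp U).1) (c := K) (ae_of_all _ fun ξ => by
      rw [norm_mul, Complex.norm_real]
      exact mul_le_mul_of_nonneg_right (hK ξ) (norm_nonneg _))
  refine ⟨LinearMap.mkContinuous
    { toFun := fun U => (hmem U).toLp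
      map_add' := fun U U' => ?_
      map_smul' := fun c U => ?_ } K ?_, fun U => (hmem U).coeFn_toLp⟩
  · rw [← MemLp.toLp_add]
    refine MemLp.toLp_congr _ _ ?_
    filter_upwards [Lp.coeFn_add U U'] with ξ h
    simp only [h, Pi.add_apply]; ring
  · rw [RingHom.id_apply, ← MemLp.toLp_const_smul]
    refine MemLp.toLp_congr _ _ ?_
    filter_upwards [Lp.coeFn_smul c U] with ξ h
    simp only [h, Pi.smul_apply, smul_eq_mul]; ring
  · intro U
    refine Lp.norm_le_mul_norm_of_ae_le_mul ?_
    filter_upwards [(hmem U).coeFn_toLp] with ξ h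
    simp only [LinearMap.coe_mk, AddHom.coe_mk]
    rw [h, norm_mul, Complex.norm_real]
    exact mul_le_mul_of_nonneg_right (hK ξ) (norm_nonneg _)

/-- Writing the pairing as an inner product with the conjugate of `G` makes it continuous and
linear, hence compatible with differences and with Bochner integrals in time. -/
theorem exists_pairingCLM {α : Type*} [MeasurableSpace α] {μ : Measure α} {G : α → ℂ}
    (hG : MemLp G 2 μ) :
    ∃ L : Lp ℂ 2 μ →L[ℂ] ℂ, ∀ v, L v = ∫ p, v p * G p ∂μ := by
  have hc : MemLp (fun p => starRingEnd ℂ (G p)) 2 μ := hG.star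
  refine ⟨innerSL ℂ hc.toLp, fun v => ?_⟩
  rw [innerSL_apply_apply, L2.inner_def]
  refine integral_congr_ae ?_
  filter_upwards [hc.coeFn_toLp] with p h
  rw [h]
  simp

end Symbols

/-! ### Slices and vertical modes of functions on the strip -/

section Modes

open scoped FourierTransform

variable {d : ℕ} {H : ℝ}

/-- The function `z ↦ ∫ u(X, z) χ(X) dX`. -/
def slice (u : Horiz d × ℝ → ℂ) (χ : 𝓢(Horiz d, ℂ)) (z : ℝ) : ℂ := ∫ X, u (X, z) * χ X

/-- This form of Fubini sees the modal coefficient as a function of `X`. Its companion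
`strip_integral_eq_right` sees the slice as a function of `z`. -/
theorem strip_integral_eq_left {u : Horiz d × ℝ → ℂ}
    (hu : MemLp u 2 (volume.restrict (strip d H))) (χ : 𝓢(Horiz d, ℂ)) {h : ℝ → ℂ}
    (hh : MemLp h 2 (volume.restrict (Ioo (-H) 0))) :
    ∫ p in strip d H, u p * χ p.1 * h p.2 = ∫ X, (∫ z in Ioo (-H) 0, u (X, z) * h z) * χ X := by
  rw [volume_restrict_strip] at hu ⊢
  exact integral_mul_tensor_eq_left hu (χ.memLp 2) hh

theorem strip_integral_eq_right {u : Horiz d × ℝ → ℂ}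
    (hu : MemLp u 2 (volume.restrict (strip d H))) (χ : 𝓢(Horiz d, ℂ)) {h : ℝ → ℂ}
    (hh : MemLp h 2 (volume.restrict (Ioo (-H) 0))) :
    ∫ p in strip d H, u p * χ p.1 * h p.2 = ∫ z in Ioo (-H) 0, slice u χ z * h z := by
  rw [volume_restrict_strip] at hu ⊢
  exact integral_mul_tensor_eq_right hu (χ.memLp 2) hh

theorem memLp_slice {u : Horiz d × ℝ → ℂ} (hu : MemLp u 2 (volume.restrict (strip d H)))
    (χ : 𝓢(Horiz d, ℂ)) : MemLp (slice u χ) 2 (volume.restrict (Ioo (-H) 0)) := by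
  rw [volume_restrict_strip] at hu
  exact memLp_integral_mul_left hu (χ.memLp 2)

theorem memLp_profile {u : Horiz d × ℝ → ℂ} (hu : MemLp u 2 (volume.restrict (strip d H)))
    {h : ℝ → ℂ} (hh : MemLp h 2 (volume.restrict (Ioo (-H) 0))) :
    MemLp (fun X => ∫ z in Ioo (-H) 0, u (X, z) * h z) 2 volume := by
  rw [volume_restrict_strip] at hu
  exact memLp_integral_mul_right hu hh

theorem lintegral_profile_le {u : Horiz d × ℝ → ℂ}
    (hu : MemLp u 2 (volume.restrict (strip d H)))
    {h : ℝ → ℂ} (hh : MemLp h 2 (volume.restrict (Ioo (-H) 0))) :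
    ∫⁻ X, ‖∫ z in Ioo (-H) 0, u (X, z) * h z‖ₑ ^ 2 ≤
      (∫⁻ p in strip d H, ‖u p‖ₑ ^ 2) * ∫⁻ z in Ioo (-H) 0, ‖h z‖ₑ ^ 2 := by
  rw [volume_restrict_strip] at hu ⊢
  exact lintegral_integral_mul_le hu.1 hh.1

theorem ae_memLp_slice {u : Horiz d × ℝ → ℂ} (hu : MemLp u 2 (volume.restrict (strip d H))) :
    ∀ᵐ X, MemLp (fun z => u (X, z)) 2 (volume.restrict (Ioo (-H) 0)) := by
  rw [volume_restrict_strip] at hu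
  have hm := hu.1.enorm.pow_const 2
  have hfin := (memLp_two_iff.1 hu).2
  rw [lintegral_prod _ hm] at hfin
  filter_upwards [hu.1.prodMk_left, ae_lt_top' hm.lintegral_prod_right' hfin.ne] with X h1 h2
  exact memLp_two_iff.2 ⟨h1, h2⟩

theorem ae_ae_of_ae_strip {p : Horiz d × ℝ → Prop}
    (h : ∀ᵐ q ∂(volume.restrict (strip d H)), p q) :
    ∀ᵐ X, ∀ᵐ z ∂(volume.restrict (Ioo (-H) 0)), p (X, z) := by
  rw [volume_restrict_strip] at h
  exact Measure.ae_ae_of_ae_prod h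

/-- The integration against a vertical profile, as a map from `L²` of the strip to `L²(ℝ^d)`. -/
theorem exists_modeCLM {h : ℝ → ℂ} (hh : MemLp h 2 (volume.restrict (Ioo (-H) 0))) :
    ∃ M : StripL2 d H →L[ℂ] HorizL2 d,
      ∀ v, M v =ᵐ[volume] fun X => ∫ z in Ioo (-H) 0, v (X, z) * h z := by
  have hmem : ∀ v : StripL2 d H, MemLp (fun X => ∫ z in Ioo (-H) 0, v (X, z) * h z) 2 volume :=
    fun v => memLp_profile (Lp.memLp v) hh
  set I := ∫⁻ z in Ioo (-H) 0, ‖h z‖ₑ ^ 2 with hI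
  have hIfin : I < ⊤ := (memLp_two_iff.1 hh).2
  refine ⟨LinearMap.mkContinuous
    { toFun := fun v => (hmem v).toLp
      map_add' := fun v v' => ?_
      map_smul' := fun c v => ?_ } (Real.sqrt I.toReal) ?_, fun v => (hmem v).coeFn_toLp⟩
  · rw [← MemLp.toLp_add]
    refine MemLp.toLp_congr _ _ ?_
    filter_upwards [ae_ae_of_ae_strip (Lp.coeFn_add v v'), ae_memLp_slice (Lp.memLp v),
      ae_memLp_slice (Lp.memLp v')] with X h1 h2 h3
    simp only [Pi.add_apply]
    have i1 : Integrable (fun z => v (X, z) * h z) (volume.restrict (Ioo (-H) 0)) :=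
      h2.integrable_mul hh
    have i2 : Integrable (fun z => v' (X, z) * h z) (volume.restrict (Ioo (-H) 0)) :=
      h3.integrable_mul hh
    rw [← integral_add i1 i2]
    refine integral_congr_ae ?_
    filter_upwards [h1] with z hz
    rw [hz, Pi.add_apply, add_mul]
  · rw [RingHom.id_apply, ← MemLp.toLp_const_smul]
    refine MemLp.toLp_congr _ _ ?_
    filter_upwards [ae_ae_of_ae_strip (Lp.coeFn_smul c v)] with X h1
    simp only [Pi.smul_apply, smul_eq_mul]
    rw [← integral_const_mul]
    refine integral_congr_ae ?_
    filter_upwards [h1] with z hz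
    rw [hz, Pi.smul_apply, smul_eq_mul, mul_assoc]
  · intro v
    have hb : ‖(hmem v).toLp‖ₑ ^ 2 ≤ ‖v‖ₑ ^ 2 * I := by
      rw [Lp.enorm_toLp, eLpNorm_two_sq, Lp.enorm_def, eLpNorm_two_sq]
      exact lintegral_profile_le (Lp.memLp v) hh
    have hb2 : ‖(hmem v).toLp‖ ^ 2 ≤ ‖v‖ ^ 2 * I.toReal := by
      have := ENNReal.toReal_mono (ENNReal.mul_ne_top (by simp) hIfin.ne) hb
      simpa [ENNReal.toReal_mul, ENNReal.toReal_pow] using this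
    have h3 : ‖v‖ ^ 2 * I.toReal = (Real.sqrt I.toReal * ‖v‖) ^ 2 := by
      rw [mul_pow, Real.sq_sqrt ENNReal.toReal_nonneg]; ring
    rw [h3] at hb2
    exact (pow_le_pow_iff_left₀ (norm_nonneg _) (by positivity) two_ne_zero).1 hb2

theorem memLp_strip_tensor (χ : 𝓢(Horiz d, ℂ)) {h : ℝ → ℂ}
    (hh : MemLp h 2 (volume.restrict (Ioo (-H) 0))) :
    MemLp (fun p : Horiz d × ℝ => χ p.1 * h p.2) 2 (volume.restrict (strip d H)) := by
  rw [volume_restrict_strip]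
  exact memLp_tensor (χ.memLp 2) hh

/-- For `r ≥ 0`, the map `v ↦ 𝓕⁻¹ Λ^{-r} ∫ v h dz`, where `h` is a vertical profile. -/
theorem exists_hatCLM {r : ℝ} (hr : 0 ≤ r) {h : ℝ → ℂ}
    (hh : MemLp h 2 (volume.restrict (Ioo (-H) 0))) :
    ∃ M : StripL2 d H →L[ℂ] HorizL2 d, ∀ v, ∀ φ : 𝓢(Horiz d, ℂ),
      ∫ ξ, M v ξ * φ ξ =
        ∫ p in strip d H, v p * lambdaPow d (-r) (𝓕⁻ φ) p.1 * h p.2 := by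
  obtain ⟨M, hM⟩ := exists_modeCLM (d := d) hh
  -- The sign of `r` matters here: the symbol of `Λ^{-r}` is at most `1`, so that it acts boundedly
  -- on `L²`.
  obtain ⟨Q, hQ⟩ := exists_mulCLM (d := d) (continuous_lambdaSymbol (-r)).measurable (K := 1)
    (fun ξ => by
      rw [abs_of_pos (lambdaSymbol_pos _ _)]; exact lambdaSymbol_le_one (by linarith) ξ)
  refine ⟨Q ∘L (FourierTransform.fourierInvCLM ℂ (HorizL2 d)) ∘L M, fun v φ => ?_⟩
  rw [strip_integral_eq_left (Lp.memLp v) _ hh]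
  have e1 : ∫ X, (∫ z in Ioo (-H) 0, v (X, z) * h z) * lambdaPow d (-r) (𝓕⁻ φ) X =
      ∫ X, M v X * (𝓕⁻ (symbolMul (-r) φ)) X := by
    rw [lambdaPow_fourierInv]
    refine integral_congr_ae ?_
    filter_upwards [hM v] with X hX
    rw [hX]
  rw [e1, integral_mul_fourierInv]
  refine integral_congr_ae ?_
  filter_upwards [hQ (𝓕⁻ (M v))] with ξ hξ
  simp only [ContinuousLinearMap.comp_apply, FourierTransform.fourierInvCLM_apply]
  rw [hξ, symbolMul_apply]
  ring

end Modes

/-! ### Sobolev norms in Fourier variables -/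

section Sobolev

open scoped FourierTransform

variable {d : ℕ}

/-- By Plancherel: if the right side is finite, the transform of the symbol times `U` is a
square-integrable representative of `Λ^r f`, hence admissible in the infimum; otherwise there is
nothing to show. -/
theorem sobolevNormSq_le {f : Horiz d → ℝ} (hf : MemLp f 2 volume) (r : ℝ) {U : HorizL2 d}
    (hU : ∀ φ : 𝓢(Horiz d, ℂ), ∫ X, (f X : ℂ) * (𝓕⁻ φ) X = ∫ ξ, U ξ * φ ξ) :
    sobolevNormSq r f ≤ ∫⁻ ξ, ENNReal.ofReal (lambdaSymbol d r ξ) ^ 2 * ‖U ξ‖ₑ ^ 2 := by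
  by_cases hfin : ∫⁻ ξ, ENNReal.ofReal (lambdaSymbol d r ξ) ^ 2 * ‖U ξ‖ₑ ^ 2 = ⊤
  · rw [hfin]; exact le_top
  have hnorm : ∀ ξ, ‖(lambdaSymbol d r ξ : ℂ) * U ξ‖ₑ ^ 2 =
      ENNReal.ofReal (lambdaSymbol d r ξ) ^ 2 * ‖U ξ‖ₑ ^ 2 := fun ξ => by
    rw [enorm_mul, mul_pow, ← ofReal_norm, Complex.norm_real, Real.norm_eq_abs,
      abs_of_pos (lambdaSymbol_pos _ _)]
  have hg : MemLp (fun ξ => (lambdaSymbol d r ξ : ℂ) * U ξ) 2 volume := by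
    refine memLp_two_iff.2 ⟨?_, ?_⟩
    · exact (Complex.continuous_ofReal.comp
        (continuous_lambdaSymbol r)).aestronglyMeasurable.mul (Lp.memLp U).1
    · simp_rw [hnorm]
      exact lt_top_iff_ne_top.2 hfin
  have hv : IsLambdaPow r f (𝓕 hg.toLp) := by
    intro χ
    obtain ⟨φ, rfl⟩ : ∃ φ : 𝓢(Horiz d, ℂ), χ = 𝓕⁻ φ :=
      ⟨𝓕 χ, (FourierTransform.fourierInv_fourier_eq χ).symm⟩
    rw [lambdaPow_fourierInv, hU, integral_mul_fourierInv, FourierTransform.fourierInv_fourier_eq]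
    refine integral_congr_ae ?_
    filter_upwards [hg.coeFn_toLp] with ξ hξ
    rw [hξ, symbolMul_apply]
    ring
  calc sobolevNormSq r f ≤ ‖(𝓕 hg.toLp : HorizL2 d)‖ₑ ^ 2 :=
        iInf₂_le_of_le hf _ (iInf_le _ hv)
    _ = ‖hg.toLp‖ₑ ^ 2 := by
        rw [← ofReal_norm, ← ofReal_norm, Lp.norm_fourier_eq]
    _ = _ := by
        rw [Lp.enorm_toLp, eLpNorm_two_sq]
        simp_rw [hnorm]

end Sobolev

/-! ### The exponential background and the Sturm–Liouville modes -/

section BackgroundFacts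

/-- A positive density profile that decreases exponentially: `ρ_eq' = -b ρ_eq` and
`N² = b g` is constant. -/
structure IsBackground (H g : ℝ) (ρeq : ℝ → ℝ) (b N : ℝ) : Prop where
  depth_pos : 0 < H
  gravity_pos : 0 < g
  rate_pos : 0 < b
  freq_pos : 0 < N
  rate_mul_gravity : b * g = N ^ 2
  continuousOn : ContinuousOn ρeq (Icc (-H) 0)
  density_pos : ∀ z ∈ Icc (-H) 0, 0 < ρeq z
  hasDerivAt : ∀ z ∈ Ioo (-H) 0, HasDerivAt ρeq (-(b * ρeq z)) z
  nsq_eq : ∀ z ∈ Ioo (-H) 0, Nsq g ρeq z = N ^ 2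

theorem exists_isBackground {H g : ℝ} (hH : 0 < H) (hg : 0 < g) {ρeq : ℝ → ℝ}
    (hρcont : ContinuousOn ρeq (Icc (-H) 0)) (hρpos : ∀ z ∈ Icc (-H) 0, 0 < ρeq z)
    (hN : ∃ N : ℝ, 0 < N ∧ ∀ z ∈ Ioo (-H) 0, Nsq g ρeq z = N ^ 2) :
    ∃ b N, IsBackground H g ρeq b N := by
  obtain ⟨N, hN0, hN⟩ := hN
  have hder : ∀ z ∈ Ioo (-H) 0, deriv ρeq z = -(N ^ 2 / g * ρeq z) := fun z hz => by
    have h := hN z hz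
    have hp := hρpos z (Ioo_subset_Icc_self hz)
    rw [Nsq] at h
    field_simp at h ⊢
    linarith
  refine ⟨N ^ 2 / g, N, hH, hg, by positivity, hN0, by field_simp, hρcont, hρpos,
    fun z hz => ?_, hN⟩
  have hp := hρpos z (Ioo_subset_Icc_self hz)
  -- Differentiability comes from here: `deriv` takes the value `0` wherever the function is not
  -- differentiable.
  have hne : deriv ρeq z ≠ 0 := by
    rw [hder z hz]
    exact (neg_neg_of_pos (by positivity)).ne
  rw [← hder z hz]
  exact (differentiableAt_of_deriv_ne_zero hne).hasDerivAt

variable {H g : ℝ} {ρeq : ℝ → ℝ} {b N : ℝ}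

theorem IsBackground.neg_lt_zero (hB : IsBackground H g ρeq b N) : -H < 0 := by
  linarith [hB.depth_pos]

/-- The product `ρ_eq e^{bz}` has zero derivative on an interval. -/
theorem IsBackground.exists_eq_exp (hB : IsBackground H g ρeq b N) :
    ∃ ρ0 : ℝ, 0 < ρ0 ∧ ∀ z ∈ Ioo (-H) 0, ρeq z = ρ0 * Real.exp (-(b * z)) := by
  have hd : ∀ z ∈ Ioo (-H) 0, HasDerivAt (fun z => ρeq z * Real.exp (b * z)) 0 z := fun z hz => by
    have h1 := hB.hasDerivAt z hz
    have h2 : HasDerivAt (fun z => Real.exp (b * z)) (Real.exp (b * z) * b) z := by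
      have h3 : HasDerivAt (fun z => b * z) b z := by
        simpa using (hasDerivAt_id z).const_mul b
      exact h3.exp
    have h4 := h1.mul h2
    have h5 : -(b * ρeq z) * Real.exp (b * z) + ρeq z * (Real.exp (b * z) * b) = 0 := by ring
    rw [h5] at h4
    exact h4
  have hneg := hB.neg_lt_zero
  obtain ⟨C, hC⟩ := isOpen_Ioo.exists_is_const_of_deriv_eq_zero (isPreconnected_Ioo)
    (fun z hz => (hd z hz).differentiableAt.differentiableWithinAt)
    (fun z hz => (hd z hz).deriv)
  have key : ∀ z ∈ Ioo (-H) 0, ρeq z = C * Real.exp (-(b * z)) := fun z hz => by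
    rw [← hC z hz, mul_assoc, ← Real.exp_add]; simp
  refine ⟨C, ?_, key⟩
  have hm : -H / 2 ∈ Ioo (-H) 0 := ⟨by linarith, by linarith⟩
  have := hB.density_pos _ (Ioo_subset_Icc_self hm)
  rw [key _ hm] at this
  exact pos_of_mul_pos_left this (Real.exp_pos _).le

theorem IsBackground.exists_bounds (hB : IsBackground H g ρeq b N) :
    ∃ m K : ℝ, 0 < m ∧ 0 < K ∧ ∀ z ∈ Icc (-H) 0, m ≤ ρeq z ∧ ρeq z ≤ K := by
  have hne : (Icc (-H) 0).Nonempty := nonempty_Icc.2 hB.neg_lt_zero.le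
  obtain ⟨x, hx, hx'⟩ := isCompact_Icc.exists_isMinOn hne hB.continuousOn
  obtain ⟨y, hy, hy'⟩ := isCompact_Icc.exists_isMaxOn hne hB.continuousOn
  exact ⟨ρeq x, ρeq y, hB.density_pos x hx, hB.density_pos y hy, fun z hz => ⟨hx' hz, hy' hz⟩⟩

/-- The properties of a single vertical mode that enter the integrations by parts. -/
structure IsMode (H : ℝ) (ρeq : ℝ → ℝ) (N c : ℝ) (f : ℝ → ℝ) : Prop where
  speed_pos : 0 < c
  hasDerivAt : ∀ z ∈ Ioo (-H) 0, HasDerivAt f (deriv f z) z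
  continuousOn_deriv : ContinuousOn (deriv f) (Ioo (-H) 0)
  equation : ∀ z ∈ Ioo (-H) 0, HasDerivAt (fun y => ρeq y * deriv f y)
    (-(N ^ 2 / c ^ 2 * (ρeq z * f z))) z
  bottom : Tendsto f (𝓝[>] (-H)) (𝓝 0)
  top : Tendsto f (𝓝[<] 0) (𝓝 0)
  bounded : ∃ K, ∀ z ∈ Ioo (-H) 0, |f z| ≤ K ∧ |deriv f z| ≤ K ∧ |ρeq z * deriv f z| ≤ K ∧
    |N ^ 2 / c ^ 2 * (ρeq z * f z)| ≤ K

/-- The bounds come from the equation: it bounds the derivative of `ρ_eq f'`, the mean value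
inequality from the midpoint then bounds `ρ_eq f'`, and the positive lower bound of `ρ_eq` gives a
bound on `f'` up to the ends. -/
theorem IsSturmLiouvilleBasis.isMode (hB : IsBackground H g ρeq b N) {c : ℕ+ → ℝ}
    {f : ℕ+ → ℝ → ℝ} (hSL : IsSturmLiouvilleBasis H g ρeq c f) (n : ℕ+) :
    IsMode H ρeq N (c n) (f n) := by
  have hneg := hB.neg_lt_zero
  obtain ⟨m, K, hm, hK, hmK⟩ := hB.exists_bounds
  have hc := hSL.speed_pos n
  have heq : ∀ z ∈ Ioo (-H) 0, HasDerivAt (fun y => ρeq y * deriv (f n) y)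
      (-(N ^ 2 / c n ^ 2 * (ρeq z * f n z))) z := fun z hz => by
    have := hSL.equation n z hz
    rw [hB.nsq_eq z hz] at this
    convert! this using 1
    ring
  obtain ⟨F, hF⟩ := isCompact_Icc.exists_bound_of_continuousOn (hSL.continuousOn n)
  have hF0 : 0 ≤ F := (norm_nonneg _).trans (hF 0 (right_mem_Icc.2 hneg.le))
  set L := N ^ 2 / c n ^ 2 * (K * F) with hL
  have hLb : ∀ z ∈ Ioo (-H) 0, |N ^ 2 / c n ^ 2 * (ρeq z * f n z)| ≤ L := fun z hz => by
    have hz' := Ioo_subset_Icc_self hz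
    rw [abs_mul, abs_mul, abs_of_nonneg (by positivity : 0 ≤ N ^ 2 / c n ^ 2),
      abs_of_pos (hB.density_pos z hz')]
    have h1 := (hmK z hz').2
    have h2 := hF z hz'
    rw [Real.norm_eq_abs] at h2
    rw [hL]
    gcongr
  have hL0 : 0 ≤ L := by positivity
  set z0 := -H / 2
  have hz0 : z0 ∈ Ioo (-H) 0 := ⟨by simp only [z0]; linarith, by simp only [z0]; linarith⟩
  have hP : ∀ z ∈ Ioo (-H) 0,
      |ρeq z * deriv (f n) z| ≤ |ρeq z0 * deriv (f n) z0| + L * H := fun z hz => by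
    have h := Convex.norm_image_sub_le_of_norm_hasDerivWithin_le
      (f := fun y => ρeq y * deriv (f n) y) (s := Ioo (-H) 0) (C := L) (x := z0) (y := z)
      (fun x hx => (heq x hx).hasDerivWithinAt)
      (fun x hx => by rw [norm_neg]; exact hLb x hx) (convex_Ioo _ _) hz0 hz
    simp only [Real.norm_eq_abs] at h
    have h2 : |z - z0| ≤ H := by
      rw [abs_le]; constructor <;> linarith [hz.1, hz.2, hz0.1, hz0.2]
    have h3 := abs_sub_abs_le_abs_sub (ρeq z * deriv (f n) z) (ρeq z0 * deriv (f n) z0)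
    have h4 := mul_le_mul_of_nonneg_left h2 hL0
    linarith
  set Q := |ρeq z0 * deriv (f n) z0| + L * H
  have hQ0 : 0 ≤ Q := by have := hB.depth_pos; positivity
  have hD : ∀ z ∈ Ioo (-H) 0, |deriv (f n) z| ≤ Q / m := fun z hz => by
    have hz' := Ioo_subset_Icc_self hz
    rw [le_div_iff₀ hm]
    have h := hP z hz
    rw [abs_mul, abs_of_pos (hB.density_pos z hz')] at h
    have := mul_le_mul_of_nonneg_right (hmK z hz').1 (abs_nonneg (deriv (f n) z))
    linarith
  refine ⟨hc, fun z hz => ?_, ?_, heq, ?_, ?_, F + Q / m + Q + L, fun z hz => ?_⟩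
  · exact ((hSL.differentiableOn n z hz).differentiableAt (isOpen_Ioo.mem_nhds hz)).hasDerivAt
  · have h1 : ContinuousOn (fun y => ρeq y * deriv (f n) y) (Ioo (-H) 0) := fun z hz =>
      (heq z hz).continuousAt.continuousWithinAt
    have h2 : ContinuousOn (fun y => ρeq y * deriv (f n) y / ρeq y) (Ioo (-H) 0) :=
      h1.div (hB.continuousOn.mono Ioo_subset_Icc_self)
        (fun z hz => (hB.density_pos z (Ioo_subset_Icc_self hz)).ne')
    refine h2.congr fun z hz => ?_
    have := (hB.density_pos z (Ioo_subset_Icc_self hz)).ne'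
    field_simp
  · rw [← hSL.bottom n]
    exact ((hSL.continuousOn n) _ (left_mem_Icc.2 hneg.le)).mono_left
      ((nhdsWithin_Ioo_eq_nhdsGT hneg).symm.le.trans (nhdsWithin_mono _ Ioo_subset_Icc_self))
  · have := ((hSL.continuousOn n) _ (right_mem_Icc.2 hneg.le)).mono_left
      ((nhdsWithin_Ioo_eq_nhdsLT hneg).symm.le.trans (nhdsWithin_mono _ Ioo_subset_Icc_self))
    rwa [hSL.top n] at this
  · have h1 := hF z (Ioo_subset_Icc_self hz)
    rw [Real.norm_eq_abs] at h1
    have h2 := hD z hz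
    have h3 := hP z hz
    have h4 := hLb z hz
    have h5 : 0 ≤ Q / m := by positivity
    refine ⟨by linarith, by linarith, by linarith, by linarith⟩

theorem IsMode.continuousOn {c : ℝ} {f : ℝ → ℝ} (hf : IsMode H ρeq N c f) :
    ContinuousOn f (Ioo (-H) 0) :=
  fun z hz => (hf.hasDerivAt z hz).continuousAt.continuousWithinAt

theorem memLp_of_continuousOn_of_bounded {h : ℝ → ℝ} (hc : ContinuousOn h (Ioo (-H) 0))
    (hb : ∃ K, ∀ z ∈ Ioo (-H) 0, |h z| ≤ K) :
    MemLp (fun z => (h z : ℂ)) 2 (volume.restrict (Ioo (-H) 0)) := by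
  obtain ⟨K, hK⟩ := hb
  refine MemLp.of_bound
    ((Complex.continuous_ofReal.comp_continuousOn hc).aestronglyMeasurable measurableSet_Ioo) K ?_
  filter_upwards [ae_restrict_mem measurableSet_Ioo] with z hz
  simpa using hK z hz

theorem IsBackground.continuousOn_Ioo (hB : IsBackground H g ρeq b N) :
    ContinuousOn ρeq (Ioo (-H) 0) := hB.continuousOn.mono Ioo_subset_Icc_self

/-- The profile `ρ_eq N² f` of the modal coefficients of `w`. -/
def profW (ρeq : ℝ → ℝ) (N : ℝ) (f : ℝ → ℝ) (z : ℝ) : ℂ := ((ρeq z * N ^ 2 * f z : ℝ) : ℂ)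

/-- The profile `c ρ_eq f'` of the modal coefficients of `V`. -/
def profV (ρeq : ℝ → ℝ) (c : ℝ) (f : ℝ → ℝ) (z : ℝ) : ℂ := ((c * (ρeq z * deriv f z) : ℝ) : ℂ)

/-- The profile `g f` of the modal coefficients of `ρ`. -/
def profRho (g : ℝ) (f : ℝ → ℝ) (z : ℝ) : ℂ := ((g * f z : ℝ) : ℂ)

theorem IsMode.memLp_profW (hB : IsBackground H g ρeq b N) {c : ℝ} {f : ℝ → ℝ}
    (hf : IsMode H ρeq N c f) : MemLp (profW ρeq N f) 2 (volume.restrict (Ioo (-H) 0)) := by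
  obtain ⟨K, hK⟩ := hf.bounded
  refine memLp_of_continuousOn_of_bounded
    ((hB.continuousOn_Ioo.mul continuousOn_const).mul hf.continuousOn) ⟨c ^ 2 * K, fun z hz => ?_⟩
  have hc := hf.speed_pos
  have e : ρeq z * N ^ 2 * f z = c ^ 2 * (N ^ 2 / c ^ 2 * (ρeq z * f z)) := by field_simp
  rw [e, abs_mul, abs_of_pos (by positivity : 0 < c ^ 2)]
  exact mul_le_mul_of_nonneg_left (hK z hz).2.2.2 (by positivity)

theorem IsMode.memLp_profV (hB : IsBackground H g ρeq b N) {c : ℝ} {f : ℝ → ℝ}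
    (hf : IsMode H ρeq N c f) : MemLp (profV ρeq c f) 2 (volume.restrict (Ioo (-H) 0)) := by
  obtain ⟨K, hK⟩ := hf.bounded
  refine memLp_of_continuousOn_of_bounded
    (continuousOn_const.mul (hB.continuousOn_Ioo.mul hf.continuousOn_deriv))
    ⟨c * K, fun z hz => ?_⟩
  rw [abs_mul, abs_of_pos hf.speed_pos]
  exact mul_le_mul_of_nonneg_left (hK z hz).2.2.1 hf.speed_pos.le

theorem IsMode.memLp_profRho {c : ℝ} {f : ℝ → ℝ}
    (hf : IsMode H ρeq N c f) (g : ℝ) : MemLp (profRho g f) 2 (volume.restrict (Ioo (-H) 0)) := by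
  obtain ⟨K, hK⟩ := hf.bounded
  refine memLp_of_continuousOn_of_bounded
    (continuousOn_const.mul hf.continuousOn) ⟨|g| * K, fun z hz => ?_⟩
  rw [abs_mul]
  exact mul_le_mul_of_nonneg_left (hK z hz).1 (abs_nonneg _)

/-- Since `f` vanishes at both ends, `p` needs no trace condition. -/
theorem IsWeakDeriv.integral_mode_eq (hH : 0 < H) {c : ℝ} {f : ℝ → ℝ} (hf : IsMode H ρeq N c f)
    {p q : ℝ → ℂ} (hp : IntegrableOn p (Ioo (-H) 0)) (hq : IntegrableOn q (Ioo (-H) 0))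
    (h : IsWeakDeriv (-H) 0 p q) :
    ∫ z in Ioo (-H) 0, (p z * ((deriv f z : ℝ) : ℂ) + q z * (f z : ℂ)) = 0 := by
  obtain ⟨K, hK⟩ := hf.bounded
  exact h.integral_mul_add_eq_zero (by linarith) hp hq hf.hasDerivAt hf.continuousOn_deriv
    (fun z hz => (hK z hz).1) (fun z hz => (hK z hz).2.1) (Or.inr ⟨hf.bottom, hf.top⟩)

/-- The multiplier is now `ρ_eq f'`, whose derivative is given by the eigenvalue equation. It need
not vanish at the ends, so `p` has to. -/
theorem IsWeakDeriv.integral_flux_eq (hB : IsBackground H g ρeq b N) {c : ℝ} {f : ℝ → ℝ}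
    (hf : IsMode H ρeq N c f)
    {p q : ℝ → ℂ} (hp : IntegrableOn p (Ioo (-H) 0)) (hq : IntegrableOn q (Ioo (-H) 0))
    (h : IsWeakDeriv (-H) 0 p q) (hv : VanishesAtEnds (-H) 0 p) :
    ∫ z in Ioo (-H) 0, (p z * ((-(N ^ 2 / c ^ 2 * (ρeq z * f z)) : ℝ) : ℂ) +
      q z * ((ρeq z * deriv f z : ℝ) : ℂ)) = 0 := by
  obtain ⟨K, hK⟩ := hf.bounded
  refine h.integral_mul_add_eq_zero hB.neg_lt_zero hp hq (K := K)
    (f := fun z => ρeq z * deriv f z) (f1 := fun z => -(N ^ 2 / c ^ 2 * (ρeq z * f z)))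
    hf.equation ?_
    (fun z hz => (hK z hz).2.2.1) (fun z hz => by rw [abs_neg]; exact (hK z hz).2.2.2) (Or.inl hv)
  exact (continuousOn_const.mul (hB.continuousOn_Ioo.mul hf.continuousOn)).neg

/-- The weak form of the eigenvalue equation. It transfers the orthonormality of the `f_n` to the
functions `c_n f_n'` for the weight `ρ_eq`. -/
theorem integral_deriv_mul_deriv_eq (hB : IsBackground H g ρeq b N) {c c' : ℝ} {f f' : ℝ → ℝ}
    (hf : IsMode H ρeq N c f) (hf' : IsMode H ρeq N c' f') :
    ∫ z in Ioo (-H) 0, ρeq z * deriv f z * deriv f' z =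
      ∫ z in Ioo (-H) 0, N ^ 2 / c ^ 2 * (ρeq z * f z) * f' z := by
  have hneg := hB.neg_lt_zero
  obtain ⟨K, hK⟩ := hf.bounded
  obtain ⟨K', hK'⟩ := hf'.bounded
  have hcont : ContinuousOn (fun z => -(N ^ 2 / c ^ 2 * (ρeq z * f z)) * f' z +
      ρeq z * deriv f z * deriv f' z) (Ioo (-H) 0) :=
    (((continuousOn_const.mul (hB.continuousOn_Ioo.mul hf.continuousOn)).neg).mul
      hf'.continuousOn).add ((hB.continuousOn_Ioo.mul hf.continuousOn_deriv).mul
      hf'.continuousOn_deriv)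
  have integrable_of {h : ℝ → ℝ} (hc : ContinuousOn h (Ioo (-H) 0)) {L : ℝ}
      (hb : ∀ z ∈ Ioo (-H) 0, |h z| ≤ L) : IntegrableOn h (Ioo (-H) 0) := by
    refine Integrable.of_bound (hc.aestronglyMeasurable measurableSet_Ioo) L ?_
    filter_upwards [ae_restrict_mem measurableSet_Ioo] with z hz using hb z hz
  have i1 : IntegrableOn (fun z => -(N ^ 2 / c ^ 2 * (ρeq z * f z)) * f' z) (Ioo (-H) 0) :=
    integrable_of (((continuousOn_const.mul (hB.continuousOn_Ioo.mul hf.continuousOn)).neg).mul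
      hf'.continuousOn) (L := K * K') (fun z hz => by
        rw [abs_mul, abs_neg]
        exact mul_le_mul (hK z hz).2.2.2 (hK' z hz).1 (abs_nonneg _)
          ((abs_nonneg _).trans (hK z hz).1))
  have i2 : IntegrableOn (fun z => ρeq z * deriv f z * deriv f' z) (Ioo (-H) 0) :=
    integrable_of ((hB.continuousOn_Ioo.mul hf.continuousOn_deriv).mul
      hf'.continuousOn_deriv) (L := K * K') (fun z hz => by
        rw [abs_mul]
        exact mul_le_mul (hK z hz).2.2.1 (hK' z hz).2.1 (abs_nonneg _)
          ((abs_nonneg _).trans (hK z hz).1))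
  have hlim : ∀ l : Filter ℝ, (∀ᶠ z in l, z ∈ Ioo (-H) 0) → Tendsto f' l (𝓝 0) →
      Tendsto (fun z => ρeq z * deriv f z * f' z) l (𝓝 0) := fun l hl ht => by
    have hbd : IsBoundedUnder (· ≤ ·) l (fun z => ‖ρeq z * deriv f z‖) :=
      isBoundedUnder_of_eventually_le (a := K) (by
        filter_upwards [hl] with z hz using (hK z hz).2.2.1)
    simpa [mul_comm] using ht.zero_mul_isBoundedUnder_le hbd
  have h := intervalIntegral.integral_eq_sub_of_hasDerivAt_of_tendsto hneg
    (f := fun z => ρeq z * deriv f z * f' z)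
    (fun z hz => (hf.equation z hz).mul (hf'.hasDerivAt z hz))
    ((intervalIntegrable_iff_integrableOn_Ioo_of_le hneg.le).2 (i1.add i2))
    (hlim _ (Ioo_mem_nhdsGT hneg) hf'.bottom) (hlim _ (Ioo_mem_nhdsLT hneg) hf'.top)
  rw [intervalIntegral.integral_of_le hneg.le, integral_Ioc_eq_integral_Ioo,
    integral_add i1 i2, sub_zero] at h
  have h2 : ∫ z in Ioo (-H) 0, -(N ^ 2 / c ^ 2 * (ρeq z * f z)) * f' z =
      -∫ z in Ioo (-H) 0, N ^ 2 / c ^ 2 * (ρeq z * f z) * f' z := by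
    rw [← integral_neg]; congr 1; ext z; ring
  linarith

/-- The functions `N √ρ_eq f_n` are orthonormal for `dz`, and the profiles are their products with
the bounded function `N √ρ_eq`. -/
theorem isBesselFamily_profW (hB : IsBackground H g ρeq b N) {c : ℕ+ → ℝ}
    {f : ℕ+ → ℝ → ℝ} (hSL : IsSturmLiouvilleBasis H g ρeq c f) :
    IsBesselFamily (volume.restrict (Ioo (-H) 0)) (fun n => profW ρeq N (f n)) := by
  obtain ⟨m, K, hm, hK, hmK⟩ := hB.exists_bounds
  have hcs : ContinuousOn (fun z => Real.sqrt (ρeq z)) (Ioo (-H) 0) :=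
    hB.continuousOn_Ioo.sqrt
  have hsb : ∀ z ∈ Ioo (-H) 0, |Real.sqrt (ρeq z)| ≤ Real.sqrt K := fun z hz => by
    rw [abs_of_nonneg (Real.sqrt_nonneg _)]
    exact Real.sqrt_le_sqrt (hmK z (Ioo_subset_Icc_self hz)).2
  have hON := isBesselFamily_of_orthonormal (ν := volume.restrict (Ioo (-H) 0))
    (e := fun n z => N * Real.sqrt (ρeq z) * f n z) (fun n => by
      obtain ⟨F, hF⟩ := (hSL.isMode hB n).bounded
      refine memLp_of_continuousOn_of_bounded
        ((continuousOn_const.mul hcs).mul (hSL.isMode hB n).continuousOn)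
        ⟨N * Real.sqrt K * F, fun z hz => ?_⟩
      rw [abs_mul, abs_mul, abs_of_pos hB.freq_pos]
      have := hB.freq_pos
      exact mul_le_mul (mul_le_mul_of_nonneg_left (hsb z hz) this.le) (hF z hz).1 (abs_nonneg _)
        (by positivity))
    (fun i j => by
      rw [← hSL.orthonormal i j]
      refine setIntegral_congr_fun measurableSet_Ioo fun z hz => ?_
      rw [hB.nsq_eq z hz]
      have := Real.mul_self_sqrt (hB.density_pos z (Ioo_subset_Icc_self hz)).le
      linear_combination (N ^ 2 * f i z * f j z) * this)
  have := hON.mul_bounded (e := fun z => ((N * Real.sqrt (ρeq z) : ℝ) : ℂ)) (K := N * Real.sqrt K)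
    ((Complex.continuous_ofReal.comp_continuousOn
      (continuousOn_const.mul hcs)).aestronglyMeasurable measurableSet_Ioo) (by
      filter_upwards [ae_restrict_mem measurableSet_Ioo] with z hz
      rw [Complex.norm_real, Real.norm_eq_abs, abs_mul, abs_of_pos hB.freq_pos]
      exact mul_le_mul_of_nonneg_left (hsb z hz) hB.freq_pos.le)
  refine this.congr_ae fun n => ?_
  filter_upwards [ae_restrict_mem measurableSet_Ioo] with z hz
  have := Real.mul_self_sqrt (hB.density_pos z (Ioo_subset_Icc_self hz)).le
  rw [profW, ← Complex.ofReal_mul]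
  congr 1
  linear_combination (-N ^ 2 * f n z) * this

/-- The same with `c_n √ρ_eq f_n'`, orthonormal by `integral_deriv_mul_deriv_eq`, and the bounded
factor `√ρ_eq`. -/
theorem isBesselFamily_profV (hB : IsBackground H g ρeq b N) {c : ℕ+ → ℝ}
    {f : ℕ+ → ℝ → ℝ} (hSL : IsSturmLiouvilleBasis H g ρeq c f) :
    IsBesselFamily (volume.restrict (Ioo (-H) 0)) (fun n => profV ρeq (c n) (f n)) := by
  obtain ⟨m, K, hm, hK, hmK⟩ := hB.exists_bounds
  have hcs : ContinuousOn (fun z => Real.sqrt (ρeq z)) (Ioo (-H) 0) :=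
    hB.continuousOn_Ioo.sqrt
  have hsb : ∀ z ∈ Ioo (-H) 0, |Real.sqrt (ρeq z)| ≤ Real.sqrt K := fun z hz => by
    rw [abs_of_nonneg (Real.sqrt_nonneg _)]
    exact Real.sqrt_le_sqrt (hmK z (Ioo_subset_Icc_self hz)).2
  have hON := isBesselFamily_of_orthonormal (ν := volume.restrict (Ioo (-H) 0))
    (e := fun n z => c n * Real.sqrt (ρeq z) * deriv (f n) z) (fun n => by
      have hn := hSL.isMode hB n
      obtain ⟨F, hF⟩ := hn.bounded
      refine memLp_of_continuousOn_of_bounded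
        ((continuousOn_const.mul hcs).mul hn.continuousOn_deriv)
        ⟨c n * Real.sqrt K * F, fun z hz => ?_⟩
      rw [abs_mul, abs_mul, abs_of_pos hn.speed_pos]
      have := hn.speed_pos
      exact mul_le_mul (mul_le_mul_of_nonneg_left (hsb z hz) this.le) (hF z hz).2.1 (abs_nonneg _)
        (by positivity))
    (fun i j => by
      have hi := hSL.isMode hB i
      have hj := hSL.isMode hB j
      have h1 : ∫ z in Ioo (-H) 0, c i * Real.sqrt (ρeq z) * deriv (f i) z *
          (c j * Real.sqrt (ρeq z) * deriv (f j) z) =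
          c i * c j * ∫ z in Ioo (-H) 0, ρeq z * deriv (f i) z * deriv (f j) z := by
        rw [← integral_const_mul]
        refine setIntegral_congr_fun measurableSet_Ioo fun z hz => ?_
        have := Real.mul_self_sqrt (hB.density_pos z (Ioo_subset_Icc_self hz)).le
        linear_combination (c i * c j * deriv (f i) z * deriv (f j) z) * this
      have h2 : ∫ z in Ioo (-H) 0, N ^ 2 / c i ^ 2 * (ρeq z * f i z) * f j z =
          1 / c i ^ 2 * if i = j then 1 else 0 := by
        rw [← hSL.orthonormal i j, ← integral_const_mul]
        refine setIntegral_congr_fun measurableSet_Ioo fun z hz => ?_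
        rw [hB.nsq_eq z hz]
        ring
      rw [h1, integral_deriv_mul_deriv_eq hB hi hj, h2]
      split_ifs with hij
      · subst hij
        have := hi.speed_pos.ne'
        field_simp
      · simp)
  have := hON.mul_bounded (e := fun z => ((Real.sqrt (ρeq z) : ℝ) : ℂ)) (K := Real.sqrt K)
    ((Complex.continuous_ofReal.comp_continuousOn hcs).aestronglyMeasurable measurableSet_Ioo) (by
      filter_upwards [ae_restrict_mem measurableSet_Ioo] with z hz
      rw [Complex.norm_real, Real.norm_eq_abs]
      exact hsb z hz)
  refine this.congr_ae fun n => ?_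
  filter_upwards [ae_restrict_mem measurableSet_Ioo] with z hz
  have := Real.mul_self_sqrt (hB.density_pos z (Ioo_subset_Icc_self hz)).le
  rw [profV, ← Complex.ofReal_mul]
  congr 1
  linear_combination (-c n * deriv (f n) z) * this

end BackgroundFacts

/-! ### Brackets of strip functions with horizontal and vertical test functions -/

section Brackets

open scoped FourierTransform LineDeriv

variable {d : ℕ} {H s : ℝ}

/-- The bracket `⟨Λ^{-s} v, χ ⊗ h⟩` of an element of `L²` of the strip with a horizontal
Schwartz function and a vertical profile. -/
def br (s : ℝ) (v : StripL2 d H) (χ : 𝓢(Horiz d, ℂ)) (h : ℝ → ℂ) : ℂ :=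
  ∫ p in strip d H, v p * lambdaPow d (-s) χ p.1 * h p.2

theorem exists_brCLM (s : ℝ) (χ : 𝓢(Horiz d, ℂ)) {h : ℝ → ℂ}
    (hh : MemLp h 2 (volume.restrict (Ioo (-H) 0))) :
    ∃ L : StripL2 d H →L[ℂ] ℂ, ∀ v, L v = br s v χ h := by
  obtain ⟨L, hL⟩ := exists_pairingCLM (memLp_strip_tensor (d := d) (lambdaPow d (-s) χ) hh)
  refine ⟨L, fun v => ?_⟩
  rw [hL, br]
  refine integral_congr_ae (ae_of_all _ fun p => ?_)
  simp only
  ring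

theorem br_sub (v v' : StripL2 d H) (χ : 𝓢(Horiz d, ℂ)) {h : ℝ → ℂ}
    (hh : MemLp h 2 (volume.restrict (Ioo (-H) 0))) :
    br s (v - v') χ h = br s v χ h - br s v' χ h := by
  obtain ⟨L, hL⟩ := exists_brCLM (d := d) s χ hh
  rw [← hL, ← hL, ← hL, map_sub]

theorem br_eq_slice (v : StripL2 d H) (χ : 𝓢(Horiz d, ℂ)) {h : ℝ → ℂ}
    (hh : MemLp h 2 (volume.restrict (Ioo (-H) 0))) :
    br s v χ h = ∫ z in Ioo (-H) 0, slice v (lambdaPow d (-s) χ) z * h z :=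
  strip_integral_eq_right (Lp.memLp v) _ hh

theorem br_const_mul (v : StripL2 d H) (χ : 𝓢(Horiz d, ℂ)) (c : ℂ) (h : ℝ → ℂ) :
    br s v χ (fun z => c * h z) = c * br s v χ h := by
  rw [br, br, ← integral_const_mul]
  refine integral_congr_ae (ae_of_all _ fun p => ?_)
  simp only
  ring

/-- For `s ≥ 0` the function `Λ^{-s} ∫ v h dz` is in `L²`. This is what allows brackets to be
determined by compactly supported tests. -/
theorem exists_br_rep (hs : 0 ≤ s) (v : StripL2 d H) {h : ℝ → ℂ}
    (hh : MemLp h 2 (volume.restrict (Ioo (-H) 0))) :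
    ∃ a : HorizL2 d, ∀ χ, br s v χ h = ∫ X, a X * χ X := by
  obtain ⟨M, hM⟩ := exists_hatCLM (d := d) hs hh
  refine ⟨𝓕 (M v), fun χ => ?_⟩
  obtain ⟨φ, rfl⟩ : ∃ φ : 𝓢(Horiz d, ℂ), χ = 𝓕⁻ φ :=
    ⟨𝓕 χ, (FourierTransform.fourierInv_fourier_eq χ).symm⟩
  rw [integral_mul_fourierInv, FourierTransform.fourierInv_fourier_eq, hM, br]

theorem memLp_complex {u : Horiz d × ℝ → ℝ} (hu : MemLp u 2 (volume.restrict (strip d H))) :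
    MemLp (fun p => (u p : ℂ)) 2 (volume.restrict (strip d H)) := hu.ofReal

theorem memLp_testFunction {ψ : ℝ → ℝ} (hψ : IsTestFunction (Ioo (-H) 0) ψ) :
    MemLp (fun z => (ψ z : ℂ)) 2 (volume.restrict (Ioo (-H) 0)) := hψ.memLp_ofReal 2

theorem integrableOn_slice (v : StripL2 d H) (χ : 𝓢(Horiz d, ℂ)) :
    IntegrableOn (slice v χ) (Ioo (-H) 0) :=
  (memLp_slice (Lp.memLp v) χ).integrable (by norm_num)

/-- Testing with `Λ^{-s} χ` undoes the operator in `v = Λ^s u`. -/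
theorem slice_eq_of_isLambdaPowDz {u : Horiz d × ℝ → ℝ} {v : StripL2 d H}
    (hu : MemLp u 2 (volume.restrict (strip d H))) (h : IsLambdaPowDz H s 0 u v)
    (χ : 𝓢(Horiz d, ℂ)) :
    slice (fun p => (u p : ℂ)) χ =ᵐ[volume.restrict (Ioo (-H) 0)]
      slice v (lambdaPow d (-s) χ) := by
  have hC := memLp_complex hu
  have i1 : IntegrableOn (slice (fun p => (u p : ℂ)) χ) (Ioo (-H) 0) :=
    (memLp_slice hC χ).integrable (by norm_num)
  have i2 := integrableOn_slice v (lambdaPow d (-s) χ)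
  have := ae_eq_zero_of_forall_testFunction (i1.sub i2) (fun ψ hψ => by
    have h1 := h (lambdaPow d (-s) χ) ψ hψ
    rw [lambdaPow_lambdaPow, add_neg_cancel, lambdaPow_zero] at h1
    simp only [iteratedDeriv_zero, pow_zero, one_mul] at h1
    rw [strip_integral_eq_right hC _ (memLp_testFunction hψ),
      strip_integral_eq_right (Lp.memLp v) _ (memLp_testFunction hψ)] at h1
    simp only [Pi.sub_apply, sub_mul]
    rw [integral_sub (hψ.integrable_mul i1) (hψ.integrable_mul i2), h1, sub_self])
  filter_upwards [this] with z hz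
  exact sub_eq_zero.1 hz

theorem strip_integral_eq_br {u : Horiz d × ℝ → ℝ} {v : StripL2 d H}
    (hu : MemLp u 2 (volume.restrict (strip d H))) (h : IsLambdaPowDz H s 0 u v)
    (χ : 𝓢(Horiz d, ℂ)) {k : ℝ → ℂ} (hk : MemLp k 2 (volume.restrict (Ioo (-H) 0))) :
    ∫ p in strip d H, (u p : ℂ) * χ p.1 * k p.2 = br s v χ k := by
  rw [strip_integral_eq_right (memLp_complex hu) _ hk, br_eq_slice v χ hk]
  refine integral_congr_ae ?_
  filter_upwards [slice_eq_of_isLambdaPowDz hu h χ] with z hz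
  rw [hz]

/-- A real test function as a Schwartz function. -/
def testS (χ : Horiz d → ℝ) (h1 : ContDiff ℝ ∞ χ) (h2 : HasCompactSupport χ) : 𝓢(Horiz d, ℂ) :=
  (h2.comp_left (g := fun x : ℝ => (x : ℂ)) rfl).toSchwartzMap
    (Complex.ofRealCLM.contDiff.comp h1)

theorem testS_apply (χ : Horiz d → ℝ) (h1 : ContDiff ℝ ∞ χ) (h2 : HasCompactSupport χ)
    (X : Horiz d) : testS χ h1 h2 X = (χ X : ℂ) := rfl

theorem contDiff_dir {χ : Horiz d → ℝ} (h1 : ContDiff ℝ ∞ χ) (v : Horiz d) :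
    ContDiff ℝ ∞ (fun X => fderiv ℝ χ X v) :=
  (h1.fderiv_right (by simp)).clm_apply contDiff_const

theorem hasCompactSupport_dir {χ : Horiz d → ℝ} (h2 : HasCompactSupport χ) (v : Horiz d) :
    HasCompactSupport (fun X => fderiv ℝ χ X v) := h2.fderiv_apply (𝕜 := ℝ) v

theorem lineDeriv_testS (χ : Horiz d → ℝ) (h1 : ContDiff ℝ ∞ χ) (h2 : HasCompactSupport χ)
    (i : Fin d) : ∂_{hdir i} (testS χ h1 h2) =
      testS _ (contDiff_dir h1 (hdir i)) (hasCompactSupport_dir h2 (hdir i)) := by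
  ext X
  rw [SchwartzMap.lineDerivOp_apply_eq_fderiv, testS_apply]
  have h := Complex.ofRealCLM.hasFDerivAt.comp X ((h1.differentiable (by simp)) X).hasFDerivAt
  have e : fderiv ℝ (testS χ h1 h2) X = _ := h.fderiv
  rw [e]
  simp

end Brackets

/-! ### Tensor products of test functions -/

section Tensor

variable {d : ℕ} {H T : ℝ}

theorem isTestFunction_tensor {χ : Horiz d → ℝ} (h1 : ContDiff ℝ ∞ χ) (h2 : HasCompactSupport χ)
    {η : ℝ → ℝ} (hη : IsTestFunction (Ioo (-H) 0) η) :
    IsTestFunction (strip d H) (fun p => χ p.1 * η p.2) := by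
  have hsub : tsupport (fun p : Horiz d × ℝ => χ p.1 * η p.2) ⊆ tsupport χ ×ˢ tsupport η := by
    refine closure_minimal (fun p hp => ?_) ((isClosed_tsupport _).prod (isClosed_tsupport _))
    rw [Function.mem_support] at hp
    exact ⟨subset_tsupport _ (left_ne_zero_of_mul hp), subset_tsupport _ (right_ne_zero_of_mul hp)⟩
  refine ⟨(h1.comp contDiff_fst).mul (hη.1.comp contDiff_snd), ?_, hsub.trans ?_⟩
  · exact IsCompact.of_isClosed_subset (h2.prod hη.2.1) (isClosed_tsupport _) hsub
  · exact prod_mono (subset_univ _) hη.2.2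

theorem isTestFunction_time_tensor {θ : ℝ → ℝ} (hθ : IsTestFunction (Ioo 0 T) θ)
    {χ : Horiz d → ℝ} (h1 : ContDiff ℝ ∞ χ) (h2 : HasCompactSupport χ)
    {η : ℝ → ℝ} (hη : IsTestFunction (Ioo (-H) 0) η) :
    IsTestFunction (Ioo 0 T ×ˢ strip d H)
      (fun q : ℝ × (Horiz d × ℝ) => θ q.1 * (χ q.2.1 * η q.2.2)) := by
  obtain ⟨g1, g2, g3⟩ := isTestFunction_tensor h1 h2 hη
  have hsub : tsupport (fun q : ℝ × (Horiz d × ℝ) => θ q.1 * (χ q.2.1 * η q.2.2)) ⊆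
      tsupport θ ×ˢ tsupport (fun p : Horiz d × ℝ => χ p.1 * η p.2) := by
    refine closure_minimal (fun p hp => ?_) ((isClosed_tsupport _).prod (isClosed_tsupport _))
    rw [Function.mem_support] at hp
    exact ⟨subset_tsupport _ (left_ne_zero_of_mul hp),
      subset_tsupport (fun p : Horiz d × ℝ => χ p.1 * η p.2) (right_ne_zero_of_mul hp)⟩
  refine ⟨(hθ.1.comp contDiff_fst).mul (g1.comp contDiff_snd), ?_, hsub.trans ?_⟩
  · exact IsCompact.of_isClosed_subset (hθ.2.1.prod g2) (isClosed_tsupport _) hsub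
  · exact prod_mono hθ.2.2 g3

theorem hasFDerivAt_tensor {χ : Horiz d → ℝ} (h1 : ContDiff ℝ ∞ χ) {η : ℝ → ℝ}
    (hη : ContDiff ℝ ∞ η) (p : Horiz d × ℝ) :
    HasFDerivAt (fun p : Horiz d × ℝ => χ p.1 * η p.2)
      (χ p.1 • (deriv η p.2 • ContinuousLinearMap.snd ℝ (Horiz d) ℝ) +
        η p.2 • (fderiv ℝ χ p.1 ∘L ContinuousLinearMap.fst ℝ (Horiz d) ℝ)) p := by
  have e1 : HasFDerivAt (fun p : Horiz d × ℝ => χ p.1)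
      (fderiv ℝ χ p.1 ∘L ContinuousLinearMap.fst ℝ (Horiz d) ℝ) p :=
    ((h1.differentiable (by simp)) p.1).hasFDerivAt.comp p hasFDerivAt_fst
  have e2 : HasFDerivAt (fun p : Horiz d × ℝ => η p.2)
      (deriv η p.2 • ContinuousLinearMap.snd ℝ (Horiz d) ℝ) p :=
    ((hη.differentiable (by simp)) p.2).hasDerivAt.comp_hasFDerivAt p hasFDerivAt_snd
  exact e1.mul e2

theorem fderiv_tensor_eX {χ : Horiz d → ℝ} (h1 : ContDiff ℝ ∞ χ) {η : ℝ → ℝ}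
    (hη : ContDiff ℝ ∞ η) (p : Horiz d × ℝ) (i : Fin d) :
    fderiv ℝ (fun p : Horiz d × ℝ => χ p.1 * η p.2) p (eX i) =
      fderiv ℝ χ p.1 (hdir i) * η p.2 := by
  rw [(hasFDerivAt_tensor h1 hη p).fderiv]
  simp [eX, mul_comm]

theorem fderiv_tensor_eZ {χ : Horiz d → ℝ} (h1 : ContDiff ℝ ∞ χ) {η : ℝ → ℝ}
    (hη : ContDiff ℝ ∞ η) (p : Horiz d × ℝ) :
    fderiv ℝ (fun p : Horiz d × ℝ => χ p.1 * η p.2) p eZ = χ p.1 * deriv η p.2 := by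
  rw [(hasFDerivAt_tensor h1 hη p).fderiv]
  simp [eZ]

theorem hasFDerivAt_time_tensor {θ : ℝ → ℝ} (hθ : ContDiff ℝ ∞ θ) {χ : Horiz d → ℝ}
    (h1 : ContDiff ℝ ∞ χ) {η : ℝ → ℝ} (hη : ContDiff ℝ ∞ η) (q : ℝ × (Horiz d × ℝ)) :
    HasFDerivAt (fun q : ℝ × (Horiz d × ℝ) => θ q.1 * (χ q.2.1 * η q.2.2))
      (θ q.1 • (fderiv ℝ (fun p : Horiz d × ℝ => χ p.1 * η p.2) q.2 ∘L
        ContinuousLinearMap.snd ℝ ℝ (Horiz d × ℝ)) +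
        (χ q.2.1 * η q.2.2) • (deriv θ q.1 • ContinuousLinearMap.fst ℝ ℝ (Horiz d × ℝ))) q := by
  have e1 : HasFDerivAt (fun q : ℝ × (Horiz d × ℝ) => θ q.1)
      (deriv θ q.1 • ContinuousLinearMap.fst ℝ ℝ (Horiz d × ℝ)) q :=
    ((hθ.differentiable (by simp)) q.1).hasDerivAt.comp_hasFDerivAt q hasFDerivAt_fst
  have e2 : HasFDerivAt (fun q : ℝ × (Horiz d × ℝ) => χ q.2.1 * η q.2.2)
      (fderiv ℝ (fun p : Horiz d × ℝ => χ p.1 * η p.2) q.2 ∘L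
        ContinuousLinearMap.snd ℝ ℝ (Horiz d × ℝ)) q :=
    (hasFDerivAt_tensor h1 hη q.2).differentiableAt.hasFDerivAt.comp q hasFDerivAt_snd
  exact e1.mul e2

theorem fderiv_time_tensor_time {θ : ℝ → ℝ} (hθ : ContDiff ℝ ∞ θ) {χ : Horiz d → ℝ}
    (h1 : ContDiff ℝ ∞ χ) {η : ℝ → ℝ} (hη : ContDiff ℝ ∞ η) (q : ℝ × (Horiz d × ℝ)) :
    fderiv ℝ (fun q : ℝ × (Horiz d × ℝ) => θ q.1 * (χ q.2.1 * η q.2.2)) q (1, 0) =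
      deriv θ q.1 * (χ q.2.1 * η q.2.2) := by
  rw [(hasFDerivAt_time_tensor hθ h1 hη q).fderiv]
  simp [mul_comm]

theorem fderiv_time_tensor_space {θ : ℝ → ℝ} (hθ : ContDiff ℝ ∞ θ) {χ : Horiz d → ℝ}
    (h1 : ContDiff ℝ ∞ χ) {η : ℝ → ℝ} (hη : ContDiff ℝ ∞ η) (q : ℝ × (Horiz d × ℝ))
    (v : Horiz d × ℝ) :
    fderiv ℝ (fun q : ℝ × (Horiz d × ℝ) => θ q.1 * (χ q.2.1 * η q.2.2)) q (0, v) =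
      θ q.1 * fderiv ℝ (fun p : Horiz d × ℝ => χ p.1 * η p.2) q.2 v := by
  rw [(hasFDerivAt_time_tensor hθ h1 hη q).fderiv]
  simp

theorem pairing_tensor (a : ℝ → Horiz d × ℝ → ℝ) (θ : ℝ → ℝ) (χ : Horiz d → ℝ) (η : ℝ → ℝ) :
    ((pairing H T a (fun q => θ q.1 * (χ q.2.1 * η q.2.2)) : ℝ) : ℂ) =
      ∫ t in Ioo 0 T, (∫ p in strip d H, (a t p : ℂ) * (χ p.1 : ℂ) * (η p.2 : ℂ)) * (θ t : ℂ) := by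
  rw [pairing, ← integral_complex_ofReal]
  refine integral_congr_ae (ae_of_all _ fun t => ?_)
  simp only
  rw [← integral_complex_ofReal, ← integral_mul_const]
  refine integral_congr_ae (ae_of_all _ fun p => ?_)
  simp only
  push_cast
  ring

end Tensor

/-! ### The equations against tensor test functions, integrated in time -/

section TestedEquations

open scoped FourierTransform LineDeriv

variable {d : ℕ} {H T s g : ℝ}

/-- The curve `v` in `L²` of the strip is `t ↦ Λ^s u(t)`. -/
structure IsHsCurve (H T s : ℝ) (u : ℝ → Horiz d × ℝ → ℝ) (v : ℝ → StripL2 d H) : Prop where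
  memLp : ∀ t ∈ Icc 0 T, MemLp (u t) 2 (volume.restrict (strip d H))
  continuousOn : ContinuousOn v (Icc 0 T)
  rep : ∀ t ∈ Icc 0 T, IsLambdaPowDz H s 0 (u t) (v t)

theorem IsContinuousIntoHsm.exists_isHsCurve {m : ℕ} {u : ℝ → Horiz d × ℝ → ℝ}
    (h : IsContinuousIntoHsm H T s m u) : ∃ v, IsHsCurve H T s u v := by
  obtain ⟨v, hv, hr⟩ := h.2 0 (Nat.zero_le _)
  exact ⟨v, h.1, hv, fun t ht => by simpa using hr t ht⟩

variable {u : ℝ → Horiz d × ℝ → ℝ} {v : ℝ → StripL2 d H}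

theorem IsHsCurve.continuousOn_br (h : IsHsCurve H T s u v) (χ : 𝓢(Horiz d, ℂ)) {k : ℝ → ℂ}
    (hk : MemLp k 2 (volume.restrict (Ioo (-H) 0))) :
    ContinuousOn (fun t => br s (v t) χ k) (Icc 0 T) := by
  obtain ⟨L, hL⟩ := exists_brCLM s χ hk
  simp_rw [← hL]
  exact L.continuous.comp_continuousOn h.continuousOn

theorem IsHsCurve.intervalIntegrable (h : IsHsCurve H T s u v) {t : ℝ} (ht : t ∈ Icc 0 T) :
    IntervalIntegrable v volume 0 t := by
  refine (h.continuousOn.mono ?_).intervalIntegrable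
  rw [uIcc_of_le ht.1]
  exact Icc_subset_Icc_right ht.2

theorem IsHsCurve.integral_br (h : IsHsCurve H T s u v) (χ : 𝓢(Horiz d, ℂ)) {k : ℝ → ℂ}
    (hk : MemLp k 2 (volume.restrict (Ioo (-H) 0))) {t : ℝ} (ht : t ∈ Icc 0 T) :
    ∫ τ in (0)..t, br s (v τ) χ k = br s (∫ τ in (0)..t, v τ) χ k := by
  obtain ⟨L, hL⟩ := exists_brCLM s χ hk
  simp_rw [← hL]
  exact L.intervalIntegral_comp_comm (h.intervalIntegrable ht)

theorem memLp_of_continuousOn_Icc {h : ℝ → ℝ} (hc : ContinuousOn h (Icc (-H) 0)) :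
    MemLp (fun z => (h z : ℂ)) 2 (volume.restrict (Ioo (-H) 0)) := by
  obtain ⟨K, hK⟩ := isCompact_Icc.exists_bound_of_continuousOn hc
  exact memLp_of_continuousOn_of_bounded (hc.mono Ioo_subset_Icc_self)
    ⟨K, fun z hz => hK z (Ioo_subset_Icc_self hz)⟩

theorem measurableSet_strip (d : ℕ) (H : ℝ) : MeasurableSet (strip d H) :=
  MeasurableSet.univ.prod measurableSet_Ioo

theorem IsHsCurve.weighted_eq_br (h : IsHsCurve H T s u v) {t : ℝ} (ht : t ∈ Icc 0 T)
    (κ κ' : ℝ → ℝ) (hκ : ∀ z ∈ Ioo (-H) 0, κ z = κ' z) {χ : Horiz d → ℝ}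
    (h1 : ContDiff ℝ ∞ χ) (h2 : HasCompactSupport χ) (η : ℝ → ℝ)
    (hk : MemLp (fun z => ((κ' z * η z : ℝ) : ℂ)) 2 (volume.restrict (Ioo (-H) 0))) :
    ∫ p in strip d H, ((κ p.2 * u t p : ℝ) : ℂ) * (χ p.1 : ℂ) * (η p.2 : ℂ) =
      br s (v t) (testS χ h1 h2) (fun z => ((κ' z * η z : ℝ) : ℂ)) := by
  rw [← strip_integral_eq_br (h.memLp t ht) (h.rep t ht) _ hk]
  refine setIntegral_congr_fun (measurableSet_strip d H) fun p hp => ?_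
  simp only [testS_apply]
  rw [hκ p.2 hp.2]
  push_cast
  ring

theorem IsHsCurve.eq_br (h : IsHsCurve H T s u v) {t : ℝ} (ht : t ∈ Icc 0 T) {χ : Horiz d → ℝ}
    (h1 : ContDiff ℝ ∞ χ) (h2 : HasCompactSupport χ) {η : ℝ → ℝ}
    (hη : IsTestFunction (Ioo (-H) 0) η) :
    ∫ p in strip d H, (u t p : ℂ) * (χ p.1 : ℂ) * (η p.2 : ℂ) =
      br s (v t) (testS χ h1 h2) (fun z => (η z : ℂ)) :=
  strip_integral_eq_br (h.memLp t ht) (h.rep t ht) (testS χ h1 h2) (memLp_testFunction hη)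

variable {ρeq : ℝ → ℝ} {b N : ℝ} {V : Fin d → ℝ → Horiz d × ℝ → ℝ}
  {w ρ P : ℝ → Horiz d × ℝ → ℝ} {Vv : Fin d → ℝ → StripL2 d H} {wv ρv : ℝ → StripL2 d H}

theorem IsTestFunction.memLp_weight (hB : IsBackground H g ρeq b N) {η : ℝ → ℝ}
    (hη : ContDiff ℝ ∞ η) (c : ℝ) :
    MemLp (fun z => ((c * ρeq z * η z : ℝ) : ℂ)) 2 (volume.restrict (Ioo (-H) 0)) :=
  memLp_of_continuousOn_Icc ((continuousOn_const.mul hB.continuousOn).mul hη.continuous.continuousOn)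

/-- With space tests fixed, the equation is a weak derivative in time between continuous functions,
hence an integrated identity valid at every `t`. The weight `b ρ_eq` is `-ρ_eq'`. -/
theorem density_tested (hT : 0 < T) (hB : IsBackground H g ρeq b N)
    (hsol : IsLinearSolution H g T ρeq V w ρ P) (hw : IsHsCurve H T s w wv)
    (hρ : IsHsCurve H T s ρ ρv) {t : ℝ} (ht : t ∈ Icc 0 T) {χ : Horiz d → ℝ}
    (h1 : ContDiff ℝ ∞ χ) (h2 : HasCompactSupport χ) {η : ℝ → ℝ}
    (hη : IsTestFunction (Ioo (-H) 0) η) :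
    br s (ρv t - ρv 0) (testS χ h1 h2) (fun z => (η z : ℂ)) =
      br s (∫ τ in (0)..t, wv τ) (testS χ h1 h2) (fun z => ((b * ρeq z * η z : ℝ) : ℂ)) := by
  have hk := IsTestFunction.memLp_weight hB hη.1 b
  have hk' := IsTestFunction.memLp_weight hB hη.1 (-b)
  have hweak : IsWeakDeriv 0 T (fun t => br s (ρv t) (testS χ h1 h2) (fun z => (η z : ℂ)))
      (fun t => br s (wv t) (testS χ h1 h2) (fun z => ((b * ρeq z * η z : ℝ) : ℂ))) := by
    intro θ hθ
    have e := hsol.density _ (isTestFunction_time_tensor hθ h1 h2 hη)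
    simp_rw [fderiv_time_tensor_time hθ.1 h1 hη.1] at e
    have e' := congrArg (fun x : ℝ => (x : ℂ)) (sub_eq_zero.1 e)
    rw [pairing_tensor, pairing_tensor] at e'
    rw [← integral_neg]
    calc _ = _ := setIntegral_congr_fun measurableSet_Ioo fun τ hτ => by
          simp only
          rw [hρ.eq_br (Ioo_subset_Icc_self hτ) h1 h2 hη]
      _ = _ := e'
      _ = _ := setIntegral_congr_fun measurableSet_Ioo fun τ hτ => by
          simp only
          rw [hw.weighted_eq_br (Ioo_subset_Icc_self hτ) (deriv ρeq) (fun z => -b * ρeq z)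
            (fun z hz => by rw [(hB.hasDerivAt z hz).deriv]; ring) h1 h2 η hk', ← neg_mul]
          congr 1
          rw [neg_eq_neg_one_mul (br s _ _ _), ← br_const_mul]
          congr 1
          ext z
          push_cast
          ring
  have := hweak.eq_add_integral hT (hρ.continuousOn_br _ (memLp_testFunction hη))
    (hw.continuousOn_br _ hk) t ht
  rw [br_sub _ _ _ (memLp_testFunction hη), this, hw.integral_br _ hk ht]
  ring

/-- Elimination of the pressure: horizontal momentum tested with `χ ⊗ η'` and vertical momentum with
`∂_i χ ⊗ η` contain the same pressure term, with `∂_i χ ⊗ η'`, and are subtracted. -/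
theorem vorticity_tested (hT : 0 < T) (hB : IsBackground H g ρeq b N)
    (hsol : IsLinearSolution H g T ρeq V w ρ P) (hV : ∀ i, IsHsCurve H T s (V i) (Vv i))
    (hw : IsHsCurve H T s w wv)
    (hρ : IsHsCurve H T s ρ ρv) {t : ℝ} (ht : t ∈ Icc 0 T) (i : Fin d) {χ : Horiz d → ℝ}
    (h1 : ContDiff ℝ ∞ χ) (h2 : HasCompactSupport χ) {η : ℝ → ℝ}
    (hη : IsTestFunction (Ioo (-H) 0) η) :
    br s (Vv i t - Vv i 0) (testS χ h1 h2) (fun z => ((1 * ρeq z * deriv η z : ℝ) : ℂ)) -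
      br s (wv t - wv 0) (∂_{hdir i} (testS χ h1 h2)) (fun z => ((1 * ρeq z * η z : ℝ) : ℂ)) =
      g * br s (∫ τ in (0)..t, ρv τ) (∂_{hdir i} (testS χ h1 h2)) (fun z => (η z : ℂ)) := by
  have hη' := hη.deriv
  have hk := IsTestFunction.memLp_weight hB hη.1 1
  have hk' := IsTestFunction.memLp_weight hB hη'.1 1
  have hmη := memLp_testFunction hη
  have c1 := contDiff_dir h1 (hdir i)
  have c2 := hasCompactSupport_dir h2 (hdir i)
  rw [lineDeriv_testS]
  set χS := testS χ h1 h2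
  set χi := testS _ c1 c2
  have cA := hV i |>.continuousOn_br χS hk'
  have cW := hw.continuousOn_br χi hk
  have cR := hρ.continuousOn_br χi hmη
  have hweak : IsWeakDeriv 0 T
      (fun t => br s (Vv i t) χS (fun z => ((1 * ρeq z * deriv η z : ℝ) : ℂ)) -
        br s (wv t) χi (fun z => ((1 * ρeq z * η z : ℝ) : ℂ)))
      (fun t => g * br s (ρv t) χi (fun z => (η z : ℂ))) := by
    intro θ hθ
    have eh := hsol.horizontal_momentum _ (isTestFunction_time_tensor hθ h1 h2 hη') i
    have ev := hsol.vertical_momentum _ (isTestFunction_time_tensor hθ c1 c2 hη)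
    simp_rw [fderiv_time_tensor_time hθ.1 h1 hη'.1, fderiv_time_tensor_space hθ.1 h1 hη'.1,
      fderiv_tensor_eX h1 hη'.1] at eh
    simp_rw [fderiv_time_tensor_time hθ.1 c1 hη.1, fderiv_time_tensor_space hθ.1 c1 hη.1,
      fderiv_tensor_eZ c1 hη.1] at ev
    have ee : pairing H T (fun t p => ρeq p.2 * V i t p)
        (fun q => deriv θ q.1 * (χ q.2.1 * deriv η q.2.2)) -
        pairing H T (fun t p => ρeq p.2 * w t p)
          (fun q => deriv θ q.1 * (fderiv ℝ χ q.2.1 (hdir i) * η q.2.2)) =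
        -pairing H T (fun t p => g * ρ t p)
          (fun q => θ q.1 * (fderiv ℝ χ q.2.1 (hdir i) * η q.2.2)) := by linarith
    have e' := congrArg (fun x : ℝ => (x : ℂ)) ee
    simp only [Complex.ofReal_sub, Complex.ofReal_neg] at e'
    rw [pairing_tensor, pairing_tensor _ _ (fun X => fderiv ℝ χ X (hdir i)) η,
      pairing_tensor _ _ (fun X => fderiv ℝ χ X (hdir i)) η] at e'
    have integ : ∀ (A : ℝ → ℂ), ContinuousOn A (Icc 0 T) → ∀ ψ, IsTestFunction (Ioo 0 T) ψ →
        IntegrableOn (fun τ => A τ * (ψ τ : ℂ)) (Ioo 0 T) := fun A hA ψ hψ =>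
      hψ.integrable_mul ((hA.integrableOn_compact isCompact_Icc).mono_set Ioo_subset_Icc_self)
    simp_rw [sub_mul]
    rw [integral_sub (integ _ cA _ hθ.deriv) (integ _ cW _ hθ.deriv)]
    refine Eq.trans ?_ (e'.trans ?_)
    · congr 1
      · exact setIntegral_congr_fun measurableSet_Ioo fun τ hτ => by
          rw [(hV i).weighted_eq_br (Ioo_subset_Icc_self hτ) ρeq (fun z => 1 * ρeq z)
            (fun z hz => by ring) h1 h2 (deriv η) hk']
      · exact setIntegral_congr_fun measurableSet_Ioo fun τ hτ => by
          rw [hw.weighted_eq_br (Ioo_subset_Icc_self hτ) ρeq (fun z => 1 * ρeq z)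
            (fun z hz => by ring) c1 c2 η hk]
    · congr 1
      exact setIntegral_congr_fun measurableSet_Ioo fun τ hτ => by
        rw [← hρ.eq_br (Ioo_subset_Icc_self hτ) c1 c2 hη, ← integral_const_mul]
        congr 2
        ext p
        push_cast
        ring
  have cAW : ContinuousOn (fun t =>
      br s (Vv i t) χS (fun z => ((1 * ρeq z * deriv η z : ℝ) : ℂ)) -
        br s (wv t) χi (fun z => ((1 * ρeq z * η z : ℝ) : ℂ))) (Icc 0 T) := cA.sub cW
  have cgR : ContinuousOn (fun t => (g : ℂ) * br s (ρv t) χi (fun z => (η z : ℂ))) (Icc 0 T) :=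
    continuousOn_const.mul cR
  have := hweak.eq_add_integral hT cAW cgR t ht
  rw [intervalIntegral.integral_const_mul, hρ.integral_br _ hmη ht] at this
  rw [br_sub _ _ _ hk', br_sub _ _ _ hk]
  linear_combination this

theorem divergence_tested (hsol : IsLinearSolution H g T ρeq V w ρ P)
    (hV : ∀ i, IsHsCurve H T s (V i) (Vv i)) (hw : IsHsCurve H T s w wv) {t : ℝ}
    (ht : t ∈ Icc 0 T) {χ : Horiz d → ℝ}
    (h1 : ContDiff ℝ ∞ χ) (h2 : HasCompactSupport χ) {η : ℝ → ℝ}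
    (hη : IsTestFunction (Ioo (-H) 0) η) :
    br s (wv t) (testS χ h1 h2) (fun z => ((deriv η z : ℝ) : ℂ)) +
      ∑ i, br s (Vv i t) (∂_{hdir i} (testS χ h1 h2)) (fun z => (η z : ℂ)) = 0 := by
  have hη' := hη.deriv
  have e := hsol.divergence_free t ht _ (isTestFunction_tensor h1 h2 hη)
  simp_rw [fderiv_tensor_eX h1 hη.1, fderiv_tensor_eZ h1 hη.1] at e
  have e' := congrArg (fun x : ℝ => (x : ℂ)) e
  simp only [← integral_complex_ofReal] at e'
  have iV : ∀ i, Integrable (fun p : Horiz d × ℝ => ((V i t p : ℝ) : ℂ) *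
      ((fderiv ℝ χ p.1 (hdir i) : ℝ) : ℂ) * (η p.2 : ℂ)) (volume.restrict (strip d H)) := by
    intro i
    have := (memLp_complex ((hV i).memLp t ht)).integrable_mul (memLp_strip_tensor
      (testS _ (contDiff_dir h1 (hdir i)) (hasCompactSupport_dir h2 (hdir i)))
      (memLp_testFunction hη))
    refine this.congr (ae_of_all _ fun p => ?_)
    simp [testS_apply, mul_assoc]
  have iw : Integrable (fun p : Horiz d × ℝ => ((w t p : ℝ) : ℂ) *
      (χ p.1 : ℂ) * ((deriv η p.2 : ℝ) : ℂ)) (volume.restrict (strip d H)) := by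
    have := (memLp_complex (hw.memLp t ht)).integrable_mul (memLp_strip_tensor
      (testS _ h1 h2) (memLp_testFunction hη'))
    refine this.congr (ae_of_all _ fun p => ?_)
    simp [testS_apply, mul_assoc]
  rw [← hw.eq_br ht h1 h2 hη']
  simp_rw [lineDeriv_testS]
  simp_rw [← fun i => (hV i).eq_br ht (contDiff_dir h1 (hdir i))
    (hasCompactSupport_dir h2 (hdir i)) hη]
  rw [← integral_finsetSum _ (fun i _ => iV i), ← integral_add iw
    (integrable_finsetSum _ fun i _ => iV i)]
  rw [← Complex.ofReal_zero, ← e']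
  refine integral_congr_ae (ae_of_all _ fun p => ?_)
  simp only
  push_cast
  rw [add_comm]
  congr 1
  · exact Finset.sum_congr rfl fun i _ => by ring
  · ring

/-- The vorticity is conserved: the `i`-th equation tested with `∂_j χ` and the `j`-th with `∂_i χ`
have equal pressure terms by the symmetry of second derivatives. -/
theorem curl_tested (hT : 0 < T) (hB : IsBackground H g ρeq b N)
    (hsol : IsLinearSolution H g T ρeq V w ρ P) (hV : ∀ i, IsHsCurve H T s (V i) (Vv i))
    {t : ℝ} (ht : t ∈ Icc 0 T) (i j : Fin d) {χ : Horiz d → ℝ}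
    (h1 : ContDiff ℝ ∞ χ) (h2 : HasCompactSupport χ) {η : ℝ → ℝ}
    (hη : IsTestFunction (Ioo (-H) 0) η) :
    br s (Vv i t - Vv i 0) (∂_{hdir j} (testS χ h1 h2)) (fun z => ((1 * ρeq z * η z : ℝ) : ℂ)) =
      br s (Vv j t - Vv j 0) (∂_{hdir i} (testS χ h1 h2))
        (fun z => ((1 * ρeq z * η z : ℝ) : ℂ)) := by
  have hk := IsTestFunction.memLp_weight hB hη.1 1
  have a1 := contDiff_dir h1 (hdir i)
  have a2 := hasCompactSupport_dir h2 (hdir i)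
  have b1 := contDiff_dir h1 (hdir j)
  have b2 := hasCompactSupport_dir h2 (hdir j)
  rw [lineDeriv_testS, lineDeriv_testS]
  set χi := testS _ a1 a2
  set χj := testS _ b1 b2
  have cI := hV i |>.continuousOn_br χj hk
  have cJ := hV j |>.continuousOn_br χi hk
  have hsymm : ∀ X, fderiv ℝ (fun X => fderiv ℝ χ X (hdir j)) X (hdir i) =
      fderiv ℝ (fun X => fderiv ℝ χ X (hdir i)) X (hdir j) := by
    intro X
    have hs : IsSymmSndFDerivAt ℝ χ X :=
      (h1.contDiffAt).isSymmSndFDerivAt (by simpa using WithTop.coe_le_coe.2 (le_top : (2 : ℕ∞) ≤ ⊤))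
    have hd : DifferentiableAt ℝ (fderiv ℝ χ) X :=
      ((h1.fderiv_right (m := ∞) (by simp)).differentiable (by simp)) X
    rw [fderiv_clm_apply hd (differentiableAt_const _), fderiv_clm_apply hd (differentiableAt_const _)]
    simpa using hs.eq (hdir i) (hdir j)
  have hweak : IsWeakDeriv 0 T
      (fun t => br s (Vv i t) χj (fun z => ((1 * ρeq z * η z : ℝ) : ℂ)) -
        br s (Vv j t) χi (fun z => ((1 * ρeq z * η z : ℝ) : ℂ))) (fun _ => 0) := by
    intro θ hθ
    have ei := hsol.horizontal_momentum _ (isTestFunction_time_tensor hθ b1 b2 hη) i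
    have ej := hsol.horizontal_momentum _ (isTestFunction_time_tensor hθ a1 a2 hη) j
    simp_rw [fderiv_time_tensor_time hθ.1 b1 hη.1, fderiv_time_tensor_space hθ.1 b1 hη.1,
      fderiv_tensor_eX b1 hη.1, hsymm] at ei
    simp_rw [fderiv_time_tensor_time hθ.1 a1 hη.1, fderiv_time_tensor_space hθ.1 a1 hη.1,
      fderiv_tensor_eX a1 hη.1] at ej
    have ee : pairing H T (fun t p => ρeq p.2 * V i t p)
          (fun q => deriv θ q.1 * (fderiv ℝ χ q.2.1 (hdir j) * η q.2.2)) -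
        pairing H T (fun t p => ρeq p.2 * V j t p)
          (fun q => deriv θ q.1 * (fderiv ℝ χ q.2.1 (hdir i) * η q.2.2)) = 0 := by linarith
    have e' := congrArg (fun x : ℝ => (x : ℂ)) ee
    simp only [Complex.ofReal_sub, Complex.ofReal_zero] at e'
    rw [pairing_tensor _ _ (fun X => fderiv ℝ χ X (hdir j)) η,
      pairing_tensor _ _ (fun X => fderiv ℝ χ X (hdir i)) η] at e'
    have integ : ∀ (A : ℝ → ℂ), ContinuousOn A (Icc 0 T) → ∀ ψ, IsTestFunction (Ioo 0 T) ψ →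
        IntegrableOn (fun τ => A τ * (ψ τ : ℂ)) (Ioo 0 T) := fun A hA ψ hψ =>
      hψ.integrable_mul ((hA.integrableOn_compact isCompact_Icc).mono_set Ioo_subset_Icc_self)
    simp_rw [sub_mul]
    rw [integral_sub (integ _ cI _ hθ.deriv) (integ _ cJ _ hθ.deriv)]
    simp only [zero_mul, integral_zero, neg_zero]
    refine Eq.trans ?_ e'
    congr 1
    · exact setIntegral_congr_fun measurableSet_Ioo fun τ hτ => by
        rw [(hV i).weighted_eq_br (Ioo_subset_Icc_self hτ) ρeq (fun z => 1 * ρeq z)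
          (fun z hz => by ring) b1 b2 η hk]
    · exact setIntegral_congr_fun measurableSet_Ioo fun τ hτ => by
        rw [(hV j).weighted_eq_br (Ioo_subset_Icc_self hτ) ρeq (fun z => 1 * ρeq z)
          (fun z hz => by ring) a1 a2 η hk]
  have cIJ : ContinuousOn (fun t => br s (Vv i t) χj (fun z => ((1 * ρeq z * η z : ℝ) : ℂ)) -
      br s (Vv j t) χi (fun z => ((1 * ρeq z * η z : ℝ) : ℂ))) (Icc 0 T) := cI.sub cJ
  have := hweak.eq_add_integral hT cIJ continuousOn_const t ht
  simp only [intervalIntegral.integral_zero, add_zero] at this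
  rw [br_sub _ _ _ hk, br_sub _ _ _ hk]
  linear_combination this

theorem curl_initial_tested (hT : 0 < T) (hV : ∀ i, IsHsCurve H T s (V i) (Vv i))
    (hcurl : HasZeroVerticalVorticity H (fun i => V i 0)) (i j : Fin d) {χ : Horiz d → ℝ}
    (h1 : ContDiff ℝ ∞ χ) (h2 : HasCompactSupport χ) {η : ℝ → ℝ}
    (hη : IsTestFunction (Ioo (-H) 0) η) :
    br s (Vv i 0) (∂_{hdir j} (testS χ h1 h2)) (fun z => (η z : ℂ)) =
      br s (Vv j 0) (∂_{hdir i} (testS χ h1 h2)) (fun z => (η z : ℂ)) := by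
  have h0 : (0 : ℝ) ∈ Icc 0 T := ⟨le_rfl, hT.le⟩
  have e := hcurl j i _ (isTestFunction_tensor h1 h2 hη)
  simp_rw [fderiv_tensor_eX h1 hη.1] at e
  have e' := congrArg (fun x : ℝ => (x : ℂ)) e
  simp only [← integral_complex_ofReal] at e'
  rw [lineDeriv_testS, lineDeriv_testS, ← (hV i).eq_br h0 _ _ hη, ← (hV j).eq_br h0 _ _ hη]
  refine Eq.trans ?_ (e'.trans ?_)
  · congr 1; ext p; push_cast; ring
  · congr 1; ext p; push_cast; ring

end TestedEquations

/-! ### Extension of the tested identities to all Schwartz functions -/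

section SchwartzExtension

open scoped FourierTransform LineDeriv

variable {d : ℕ} {H s : ℝ}

/-- A functional of the form `χ ↦ ∫ a χ + ∑ i, ∫ b_i ∂_i χ` with `a` and `b_i` in `L²`. -/
def IsFirstOrder (L : 𝓢(Horiz d, ℂ) → ℂ) : Prop :=
  ∃ (a : HorizL2 d) (b : Fin d → HorizL2 d),
    ∀ χ, L χ = (∫ X, a X * χ X) + ∑ i, ∫ X, b i X * (∂_{hdir i} χ) X

theorem IsFirstOrder.sub {L L' : 𝓢(Horiz d, ℂ) → ℂ} (h : IsFirstOrder L) (h' : IsFirstOrder L') :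
    IsFirstOrder (fun χ => L χ - L' χ) := by
  obtain ⟨a, b, hL⟩ := h
  obtain ⟨a', b', hL'⟩ := h'
  have key : ∀ (v v' : HorizL2 d) (χ : 𝓢(Horiz d, ℂ)), ∫ X, (v - v') X * χ X =
      (∫ X, v X * χ X) - ∫ X, v' X * χ X := fun v v' χ => by
    obtain ⟨Φ, hΦ⟩ := exists_pairingCLM (χ.memLp 2 (μ := (volume : Measure (Horiz d))))
    rw [← hΦ, ← hΦ, ← hΦ, map_sub]
  refine ⟨a - a', fun i => b i - b' i, fun χ => ?_⟩
  simp only [hL, hL', key, Finset.sum_sub_distrib]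
  ring

theorem IsFirstOrder.const_mul {L : 𝓢(Horiz d, ℂ) → ℂ} (h : IsFirstOrder L) (c : ℂ) :
    IsFirstOrder (fun χ => c * L χ) := by
  obtain ⟨a, b, hL⟩ := h
  have key : ∀ (v : HorizL2 d) (χ : 𝓢(Horiz d, ℂ)), ∫ X, (c • v) X * χ X =
      c * ∫ X, v X * χ X := fun v χ => by
    obtain ⟨Φ, hΦ⟩ := exists_pairingCLM (χ.memLp 2 (μ := (volume : Measure (Horiz d))))
    rw [← hΦ, ← hΦ, map_smul, smul_eq_mul]
  refine ⟨c • a, fun i => c • b i, fun χ => ?_⟩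
  simp only [hL, key, mul_add, Finset.mul_sum]

theorem IsFirstOrder.add {L L' : 𝓢(Horiz d, ℂ) → ℂ} (h : IsFirstOrder L) (h' : IsFirstOrder L') :
    IsFirstOrder (fun χ => L χ + L' χ) := by
  have := h.sub (h'.const_mul (-1))
  simpa using this

/-- Each tested identity is the vanishing of a combination of brackets with `χ` or `∂_i χ`, so this
single density argument serves them all. -/
theorem IsFirstOrder.eq_zero {L : 𝓢(Horiz d, ℂ) → ℂ} (h : IsFirstOrder L)
    (h0 : ∀ (χ : Horiz d → ℝ) (h1 : ContDiff ℝ ∞ χ) (h2 : HasCompactSupport χ),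
      L (testS χ h1 h2) = 0) (χ : 𝓢(Horiz d, ℂ)) : L χ = 0 := by
  obtain ⟨a, b, hL⟩ := h
  rw [hL]
  refine schwartz_test_of_real_test (Lp.memLp a) (fun i => Lp.memLp (b i)) (fun χ h1 h2 => ?_) χ
  have := h0 χ h1 h2
  simp only [hL, lineDeriv_testS, testS_apply] at this
  exact this

theorem integral_zero_mul (χ : 𝓢(Horiz d, ℂ)) : ∫ X, (0 : HorizL2 d) X * χ X = 0 := by
  obtain ⟨Φ, hΦ⟩ := exists_pairingCLM (χ.memLp 2 (μ := (volume : Measure (Horiz d))))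
  rw [← hΦ, map_zero]

theorem isFirstOrder_br (hs : 0 ≤ s) (v : StripL2 d H) {h : ℝ → ℂ}
    (hh : MemLp h 2 (volume.restrict (Ioo (-H) 0))) : IsFirstOrder (fun χ => br s v χ h) := by
  obtain ⟨a, ha⟩ := exists_br_rep hs v hh
  exact ⟨a, fun _ => 0, fun χ => by simp only [ha, integral_zero_mul]; simp⟩

theorem isFirstOrder_br_dir (hs : 0 ≤ s) (v : StripL2 d H) (i : Fin d) {h : ℝ → ℂ}
    (hh : MemLp h 2 (volume.restrict (Ioo (-H) 0))) :
    IsFirstOrder (fun χ : 𝓢(Horiz d, ℂ) => br s v (∂_{hdir i} χ) h) := by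
  obtain ⟨a, ha⟩ := exists_br_rep hs v hh
  refine ⟨0, fun j => if j = i then a else 0, fun χ => ?_⟩
  simp only [ha]
  rw [integral_zero_mul, zero_add, Finset.sum_eq_single i]
  · simp
  · intro j _ hj
    simp only [if_neg hj, integral_zero_mul]
  · simp

theorem isFirstOrder_sum_br_dir (hs : 0 ≤ s) (v : Fin d → StripL2 d H) {h : ℝ → ℂ}
    (hh : MemLp h 2 (volume.restrict (Ioo (-H) 0))) :
    IsFirstOrder (fun χ : 𝓢(Horiz d, ℂ) => ∑ i, br s (v i) (∂_{hdir i} χ) h) := by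
  choose b hb using fun i => exists_br_rep hs (v i) hh
  refine ⟨0, b, fun χ => ?_⟩
  simp only [hb, integral_zero_mul, zero_add]

end SchwartzExtension

/-! ### Equations for the modal coefficients -/

section ModalEquations

open scoped FourierTransform LineDeriv

variable {d : ℕ} {H T s g : ℝ} {ρeq : ℝ → ℝ} {b N : ℝ} {V : Fin d → ℝ → Horiz d × ℝ → ℝ}
  {w ρ P : ℝ → Horiz d × ℝ → ℝ} {Vv : Fin d → ℝ → StripL2 d H} {wv ρv : ℝ → StripL2 d H}

theorem integrableOn_mul_background (hB : IsBackground H g ρeq b N) {p : ℝ → ℂ}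
    (hp : IntegrableOn p (Ioo (-H) 0)) :
    IntegrableOn (fun z => p z * (ρeq z : ℂ)) (Ioo (-H) 0) := by
  obtain ⟨m, K, hm, hK, hb⟩ := hB.exists_bounds
  refine Integrable.mul_bdd (c := K) hp
    ((Complex.continuous_ofReal.comp_continuousOn hB.continuousOn_Ioo).aestronglyMeasurable
      measurableSet_Ioo) ?_
  filter_upwards [ae_restrict_mem measurableSet_Ioo] with z hz
  have := hb z (Ioo_subset_Icc_self hz)
  rw [Complex.norm_real, Real.norm_of_nonneg (hm.le.trans this.1)]
  exact this.2

theorem ae_eq_of_forall_integral_test_eq {p q : ℝ → ℂ} (hp : IntegrableOn p (Ioo (-H) 0))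
    (hq : IntegrableOn q (Ioo (-H) 0))
    (h : ∀ ψ, IsTestFunction (Ioo (-H) 0) ψ → ∫ z in Ioo (-H) 0, p z * (ψ z : ℂ) =
      ∫ z in Ioo (-H) 0, q z * (ψ z : ℂ)) : p =ᵐ[volume.restrict (Ioo (-H) 0)] q := by
  have := ae_eq_zero_of_forall_testFunction (hp.sub hq) (fun ψ hψ => by
    simp only [Pi.sub_apply, sub_mul]
    rw [integral_sub (hψ.integrable_mul hp) (hψ.integrable_mul hq), h ψ hψ, sub_self])
  filter_upwards [this] with z hz
  exact sub_eq_zero.1 hz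

/-- Varying `η` gives an almost everywhere identity between slices, which may be multiplied by `g
f`; then `b g = N²` produces the profile of `w`. -/
theorem density_modal (hs : 0 ≤ s) (hT : 0 < T) (hB : IsBackground H g ρeq b N)
    (hsol : IsLinearSolution H g T ρeq V w ρ P) (hw : IsHsCurve H T s w wv)
    (hρ : IsHsCurve H T s ρ ρv) {t : ℝ} (ht : t ∈ Icc 0 T) {c : ℝ} {f : ℝ → ℝ}
    (hf : IsMode H ρeq N c f) (χ : 𝓢(Horiz d, ℂ)) :
    br s (ρv t - ρv 0) χ (profRho g f) = br s (∫ τ in (0)..t, wv τ) χ (profW ρeq N f) := by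
  set IW : StripL2 d H := ∫ τ in (0)..t, wv τ
  have hηS : ∀ η, IsTestFunction (Ioo (-H) 0) η →
      br s (ρv t - ρv 0) χ (fun z => (η z : ℂ)) =
        br s IW χ (fun z => ((b * ρeq z * η z : ℝ) : ℂ)) := fun η hη => by
    refine sub_eq_zero.1 (((isFirstOrder_br hs (ρv t - ρv 0) (memLp_testFunction hη)).sub
      (isFirstOrder_br hs IW (IsTestFunction.memLp_weight hB hη.1 b))).eq_zero
      (fun χ h1 h2 => ?_) χ)
    exact sub_eq_zero.2 (density_tested hT hB hsol hw hρ ht h1 h2 hη)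
  have hae : slice (ρv t - ρv 0) (lambdaPow d (-s) χ) =ᵐ[volume.restrict (Ioo (-H) 0)]
      fun z => slice IW (lambdaPow d (-s) χ) z * (ρeq z : ℂ) * b := by
    refine ae_eq_of_forall_integral_test_eq (integrableOn_slice _ _)
      ((integrableOn_mul_background hB (integrableOn_slice _ _)).mul_const _) fun ψ hψ => ?_
    have := hηS ψ hψ
    rw [br_eq_slice _ _ (memLp_testFunction hψ),
      br_eq_slice _ _ (IsTestFunction.memLp_weight hB hψ.1 b)] at this
    rw [this]
    refine integral_congr_ae (ae_of_all _ fun z => ?_)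
    simp only
    push_cast
    ring
  rw [br_eq_slice _ _ (hf.memLp_profRho g), br_eq_slice _ _ (hf.memLp_profW hB)]
  refine integral_congr_ae ?_
  filter_upwards [hae] with z hz
  have hb : (b : ℂ) * g = (N : ℂ) ^ 2 := by exact_mod_cast hB.rate_mul_gravity
  rw [hz, profRho, profW]
  push_cast
  rw [← hb]
  ring

theorem vorticity_modal (hs : 0 ≤ s) (hT : 0 < T) (hB : IsBackground H g ρeq b N)
    (hsol : IsLinearSolution H g T ρeq V w ρ P) (hV : ∀ i, IsHsCurve H T s (V i) (Vv i))
    (hw : IsHsCurve H T s w wv) (hρ : IsHsCurve H T s ρ ρv) {t : ℝ} (ht : t ∈ Icc 0 T) (i : Fin d)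
    {c : ℝ} {f : ℝ → ℝ} (hf : IsMode H ρeq N c f) (χ : 𝓢(Horiz d, ℂ)) :
    1 / (c : ℂ) * br s (Vv i t - Vv i 0) χ (profV ρeq c f) -
      1 / (N : ℂ) ^ 2 * br s (wv t - wv 0) (∂_{hdir i} χ) (profW ρeq N f) =
      br s (∫ τ in (0)..t, ρv τ) (∂_{hdir i} χ) (profRho g f) := by
  set IR : StripL2 d H := ∫ τ in (0)..t, ρv τ
  have hηS : ∀ η, IsTestFunction (Ioo (-H) 0) η →
      br s (Vv i t - Vv i 0) χ (fun z => ((1 * ρeq z * deriv η z : ℝ) : ℂ)) -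
      br s (wv t - wv 0) (∂_{hdir i} χ) (fun z => ((1 * ρeq z * η z : ℝ) : ℂ)) =
      g * br s IR (∂_{hdir i} χ) (fun z => (η z : ℂ)) := fun η hη => by
    have hη' := hη.deriv
    refine sub_eq_zero.1 ((((isFirstOrder_br hs (Vv i t - Vv i 0)
      (IsTestFunction.memLp_weight hB hη'.1 1)).sub (isFirstOrder_br_dir hs (wv t - wv 0) i
      (IsTestFunction.memLp_weight hB hη.1 1))).sub ((isFirstOrder_br_dir hs
      IR i (memLp_testFunction hη)).const_mul g)).eq_zero
      (fun χ h1 h2 => ?_) χ)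
    exact sub_eq_zero.2 (vorticity_tested hT hB hsol hV hw hρ ht i h1 h2 hη)
  set sV := slice (Vv i t - Vv i 0) (lambdaPow d (-s) χ) with hsV
  set sW := slice (wv t - wv 0) (lambdaPow d (-s) (∂_{hdir i} χ)) with hsW
  set sR := slice IR (lambdaPow d (-s) (∂_{hdir i} χ)) with hsR
  have iV : IntegrableOn (fun z => sV z * (ρeq z : ℂ)) (Ioo (-H) 0) :=
    integrableOn_mul_background hB (integrableOn_slice _ _)
  have iW : IntegrableOn (fun z => sW z * (ρeq z : ℂ)) (Ioo (-H) 0) :=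
    integrableOn_mul_background hB (integrableOn_slice _ _)
  have iR : IntegrableOn (fun z => (g : ℂ) * sR z) (Ioo (-H) 0) :=
    (integrableOn_slice IR
      (lambdaPow d (-s) (∂_{hdir i} χ))).const_mul (g : ℂ)
  have iq : IntegrableOn (fun z => -(sW z * (ρeq z : ℂ) + g * sR z)) (Ioo (-H) 0) :=
    (iW.add iR).neg
  -- The tested identity, read as a statement on `z`, gives the weak derivative of the slice of
  -- `ρ_eq V`. It can then be paired with `f` in place of `η`, because `f` vanishes at the ends.
  have hweak : IsWeakDeriv (-H) 0 (fun z => sV z * (ρeq z : ℂ))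
      (fun z => -(sW z * (ρeq z : ℂ) + g * sR z)) := by
    intro ψ hψ
    have := hηS ψ hψ
    rw [br_eq_slice _ _ (memLp_testFunction hψ),
      br_eq_slice _ _ (IsTestFunction.memLp_weight hB hψ.1 1),
      br_eq_slice _ _ (IsTestFunction.memLp_weight hB hψ.deriv.1 1), ← hsV, ← hsW, ← hsR,
      sub_eq_iff_eq_add, ← integral_const_mul] at this
    simp only [neg_mul, integral_neg, neg_neg, add_mul]
    rw [integral_add (hψ.integrable_mul iW) (hψ.integrable_mul iR)]
    refine Eq.trans ?_ (this.trans ?_)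
    · refine integral_congr_ae (ae_of_all _ fun z => ?_)
      simp only
      push_cast
      ring
    · rw [add_comm]
      congr 1
      · refine integral_congr_ae (ae_of_all _ fun z => ?_)
        simp only
        push_cast
        ring
      · refine integral_congr_ae (ae_of_all _ fun z => ?_)
        simp only
        ring
  have key := hweak.integral_mode_eq hB.depth_pos hf iV iq
  have hc : (c : ℂ) ≠ 0 := by exact_mod_cast hf.speed_pos.ne'
  have hN : (N : ℂ) ≠ 0 := by exact_mod_cast hB.freq_pos.ne'
  rw [br_eq_slice _ _ (hf.memLp_profV hB), br_eq_slice _ _ (hf.memLp_profW hB),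
    br_eq_slice _ _ (hf.memLp_profRho g), ← hsV, ← hsW, ← hsR, ← sub_eq_zero,
    ← integral_const_mul, ← integral_const_mul]
  have jV : IntegrableOn (fun z => 1 / (c : ℂ) * (sV z * profV ρeq c f z)) (Ioo (-H) 0) :=
    ((memLp_slice (Lp.memLp _) _).integrable_mul (hf.memLp_profV hB)).const_mul _
  have jW : IntegrableOn (fun z => 1 / (N : ℂ) ^ 2 * (sW z * profW ρeq N f z)) (Ioo (-H) 0) :=
    ((memLp_slice (Lp.memLp _) _).integrable_mul (hf.memLp_profW hB)).const_mul _
  have jR : IntegrableOn (fun z => sR z * profRho g f z) (Ioo (-H) 0) :=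
    (memLp_slice (Lp.memLp _) _).integrable_mul (hf.memLp_profRho g)
  have jVW : IntegrableOn (fun z => 1 / (c : ℂ) * (sV z * profV ρeq c f z) -
      1 / (N : ℂ) ^ 2 * (sW z * profW ρeq N f z)) (Ioo (-H) 0) := jV.sub jW
  rw [← integral_sub jV jW, ← integral_sub jVW jR, ← key]
  refine integral_congr_ae (ae_of_all _ fun z => ?_)
  simp only [profV, profW, profRho]
  push_cast
  field_simp
  ring

/-- `∂_z w = -∇·V` for the vertical slices. -/
theorem isWeakDeriv_slice_divergence (hs : 0 ≤ s) (hsol : IsLinearSolution H g T ρeq V w ρ P)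
    (hV : ∀ i, IsHsCurve H T s (V i) (Vv i)) (hw : IsHsCurve H T s w wv) {t : ℝ}
    (ht : t ∈ Icc 0 T) (χ : 𝓢(Horiz d, ℂ)) :
    IsWeakDeriv (-H) 0 (slice (wv t) (lambdaPow d (-s) χ))
      (fun z => ∑ i, slice (Vv i t) (lambdaPow d (-s) (∂_{hdir i} χ)) z) := by
  intro ψ hψ
  have hψ' := hψ.deriv
  have := ((isFirstOrder_br hs (wv t) (memLp_testFunction hψ')).add
    (isFirstOrder_sum_br_dir hs (fun i => Vv i t) (memLp_testFunction hψ))).eq_zero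
    (fun χ h1 h2 => divergence_tested hsol hV hw ht h1 h2 hψ) χ
  rw [br_eq_slice _ _ (memLp_testFunction hψ')] at this
  simp_rw [fun i => br_eq_slice (Vv i t) (∂_{hdir i} χ) (s := s) (memLp_testFunction hψ)] at this
  rw [eq_neg_of_add_eq_zero_left this]
  simp only [Finset.sum_mul]
  rw [integral_finsetSum _ fun i _ => hψ.integrable_mul (integrableOn_slice _ _)]

theorem vanishesAtEnds_slice (hsol : IsLinearSolution H g T ρeq V w ρ P)
    (hw : IsHsCurve H T s w wv) {t : ℝ} (ht : t ∈ Icc 0 T) (χ : 𝓢(Horiz d, ℂ)) :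
    VanishesAtEnds (-H) 0 (slice (wv t) (lambdaPow d (-s) χ)) := by
  obtain ⟨F, h1, h2, h3, h4⟩ := hsol.boundary t ht χ
  exact ⟨F, h1.continuousOn, ((slice_eq_of_isLambdaPowDz (hw.memLp t ht) (hw.rep t ht) χ).symm.trans
    (EventuallyEq.symm h2)), h3, h4⟩

/-- Pairing with the flux `ρ_eq f'`, which need not vanish at the ends: the boundary condition on
`w` is used here. -/
theorem divergence_modal (hs : 0 ≤ s) (hB : IsBackground H g ρeq b N)
    (hsol : IsLinearSolution H g T ρeq V w ρ P)
    (hV : ∀ i, IsHsCurve H T s (V i) (Vv i)) (hw : IsHsCurve H T s w wv) {t : ℝ}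
    (ht : t ∈ Icc 0 T) {c : ℝ} {f : ℝ → ℝ} (hf : IsMode H ρeq N c f) (χ : 𝓢(Horiz d, ℂ)) :
    ∑ i, br s (Vv i t) (∂_{hdir i} χ) (profV ρeq c f) =
      1 / (c : ℂ) * br s (wv t) χ (profW ρeq N f) := by
  have key := (isWeakDeriv_slice_divergence hs hsol hV hw ht χ).integral_flux_eq hB hf
    (integrableOn_slice _ _) (integrable_finsetSum _ fun i _ => integrableOn_slice _ _)
    (vanishesAtEnds_slice hsol hw ht χ)
  have hc : (c : ℂ) ≠ 0 := by exact_mod_cast hf.speed_pos.ne'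
  rw [br_eq_slice _ _ (hf.memLp_profW hB)]
  simp_rw [fun i => br_eq_slice (Vv i t) (∂_{hdir i} χ) (s := s) (hf.memLp_profV hB)]
  have jV : ∀ i, IntegrableOn (fun z => slice (Vv i t) (lambdaPow d (-s) (∂_{hdir i} χ)) z *
      profV ρeq c f z) (Ioo (-H) 0) := fun i =>
    (memLp_slice (Lp.memLp _) _).integrable_mul (hf.memLp_profV hB)
  have jW : IntegrableOn (fun z => 1 / (c : ℂ) * (slice (wv t) (lambdaPow d (-s) χ) z *
      profW ρeq N f z)) (Ioo (-H) 0) :=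
    ((memLp_slice (Lp.memLp _) _).integrable_mul (hf.memLp_profW hB)).const_mul _
  rw [← integral_finsetSum _ fun i _ => jV i, ← integral_const_mul, ← sub_eq_zero,
    ← integral_sub (integrable_finsetSum _ fun i _ => jV i) jW, ← mul_zero (c : ℂ), ← key,
    ← integral_const_mul]
  refine integral_congr_ae (ae_of_all _ fun z => ?_)
  simp only [profV, profW, ← Finset.sum_mul]
  push_cast
  field_simp
  ring

/-- The horizontal velocity is curl free at all times. -/
theorem slice_curl_eq (hs : 0 ≤ s) (hT : 0 < T) (hB : IsBackground H g ρeq b N)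
    (hsol : IsLinearSolution H g T ρeq V w ρ P) (hV : ∀ i, IsHsCurve H T s (V i) (Vv i))
    (hcurl : HasZeroVerticalVorticity H (fun i => V i 0)) {t : ℝ} (ht : t ∈ Icc 0 T)
    (i j : Fin d) (χ : 𝓢(Horiz d, ℂ)) :
    slice (Vv i t) (lambdaPow d (-s) (∂_{hdir j} χ)) =ᵐ[volume.restrict (Ioo (-H) 0)]
      slice (Vv j t) (lambdaPow d (-s) (∂_{hdir i} χ)) := by
  have h0 : slice (Vv i 0) (lambdaPow d (-s) (∂_{hdir j} χ)) =ᵐ[volume.restrict (Ioo (-H) 0)]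
      slice (Vv j 0) (lambdaPow d (-s) (∂_{hdir i} χ)) := by
    refine ae_eq_of_forall_integral_test_eq (integrableOn_slice _ _) (integrableOn_slice _ _)
      fun ψ hψ => ?_
    have hm := memLp_testFunction hψ
    rw [← br_eq_slice _ _ hm, ← br_eq_slice _ _ hm]
    exact sub_eq_zero.1 (((isFirstOrder_br_dir hs (Vv i 0) j hm).sub
      (isFirstOrder_br_dir hs (Vv j 0) i hm)).eq_zero (fun χ h1 h2 =>
        sub_eq_zero.2 (curl_initial_tested hT hV hcurl i j h1 h2 hψ)) χ)
  have hd : (fun z => slice (Vv i t - Vv i 0) (lambdaPow d (-s) (∂_{hdir j} χ)) z * (ρeq z : ℂ))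
      =ᵐ[volume.restrict (Ioo (-H) 0)]
      fun z => slice (Vv j t - Vv j 0) (lambdaPow d (-s) (∂_{hdir i} χ)) z * (ρeq z : ℂ) := by
    refine ae_eq_of_forall_integral_test_eq
      (integrableOn_mul_background hB (integrableOn_slice _ _))
      (integrableOn_mul_background hB (integrableOn_slice _ _)) fun ψ hψ => ?_
    have hm := IsTestFunction.memLp_weight hB hψ.1 1
    have := sub_eq_zero.1 (((isFirstOrder_br_dir hs (Vv i t - Vv i 0) j hm).sub
      (isFirstOrder_br_dir hs (Vv j t - Vv j 0) i hm)).eq_zero (fun χ h1 h2 =>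
        sub_eq_zero.2 (curl_tested hT hB hsol hV ht i j h1 h2 hψ)) χ)
    rw [br_eq_slice _ _ hm, br_eq_slice _ _ hm] at this
    refine Eq.trans ?_ (this.trans ?_)
    · refine integral_congr_ae (ae_of_all _ fun z => ?_)
      simp only
      push_cast
      ring
    · refine integral_congr_ae (ae_of_all _ fun z => ?_)
      simp only
      push_cast
      ring
  -- Subtraction in `L²` of the strip is defined up to null sets, so slices are additive only for
  -- almost every `z`.
  have hsub : ∀ (v v' : StripL2 d H) (ψ : 𝓢(Horiz d, ℂ)),
      slice (v - v') ψ =ᵐ[volume.restrict (Ioo (-H) 0)] fun z => slice v ψ z - slice v' ψ z := by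
    intro v v' ψ
    refine ae_eq_of_forall_integral_test_eq (integrableOn_slice _ _)
      ((integrableOn_slice _ _).sub (integrableOn_slice _ _)) fun η hη => ?_
    have hm := memLp_testFunction hη
    have h := br_sub (s := 0) v v' ψ hm
    simp only [br_eq_slice _ _ hm, neg_zero, lambdaPow_zero] at h
    rw [h]
    simp only [sub_mul]
    rw [integral_sub (hη.integrable_mul (integrableOn_slice _ _))
      (hη.integrable_mul (integrableOn_slice _ _))]
  filter_upwards [h0, hd, hsub (Vv i t) (Vv i 0) (lambdaPow d (-s) (∂_{hdir j} χ)),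
    hsub (Vv j t) (Vv j 0) (lambdaPow d (-s) (∂_{hdir i} χ)),
    ae_restrict_mem measurableSet_Ioo] with z e0 e1 e2 e3 hz
  have hp : (ρeq z : ℂ) ≠ 0 := by
    exact_mod_cast (hB.density_pos z (Ioo_subset_Icc_self hz)).ne'
  have := mul_right_cancel₀ hp e1
  rw [e2, e3, e0] at this
  linear_combination this

theorem br_curl_eq (hs : 0 ≤ s) (hT : 0 < T) (hB : IsBackground H g ρeq b N)
    (hsol : IsLinearSolution H g T ρeq V w ρ P) (hV : ∀ i, IsHsCurve H T s (V i) (Vv i))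
    (hcurl : HasZeroVerticalVorticity H (fun i => V i 0)) {t : ℝ} (ht : t ∈ Icc 0 T)
    (i j : Fin d) (χ : 𝓢(Horiz d, ℂ)) {h : ℝ → ℂ}
    (hh : MemLp h 2 (volume.restrict (Ioo (-H) 0))) :
    br s (Vv i t) (∂_{hdir j} χ) h = br s (Vv j t) (∂_{hdir i} χ) h := by
  rw [br_eq_slice _ _ hh, br_eq_slice _ _ hh]
  refine integral_congr_ae ?_
  filter_upwards [slice_curl_eq hs hT hB hsol hV hcurl ht i j χ] with z hz
  rw [hz]

end ModalEquations

/-! ### Conservation of energy for an abstract oscillator -/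

section EnergyAbstract

open scoped InnerProductSpace

/-- The system is `R' = W`, `W' = -M R`; the relation between `A`, `B` and `M` makes the cross terms
`⟪A W, A M R⟫` and `⟪B W, B R⟫` cancel in the derivative of the energy. -/
theorem inner_add_inner_eq_of_oscillator {E : Type*} [NormedAddCommGroup E]
    [InnerProductSpace ℂ E] [CompleteSpace E] {T : ℝ} (hT : 0 < T) {W R : ℝ → E}
    (hW : ContinuousOn W (Icc 0 T)) (hR : ContinuousOn R (Icc 0 T)) {A B M : E →L[ℂ] E}
    (hABM : ∀ x y, ⟪A x, A (M y)⟫_ℂ = ⟪B x, B y⟫_ℂ)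
    (eR : ∀ t ∈ Icc 0 T, R t = R 0 + ∫ τ in (0)..t, W τ)
    (eW : ∀ t ∈ Icc 0 T, W t = W 0 - M (∫ τ in (0)..t, R τ)) {t : ℝ} (ht : t ∈ Icc 0 T) :
    ⟪A (W t), A (W t)⟫_ℂ + ⟪B (R t), B (R t)⟫_ℂ =
      ⟪A (W 0), A (W 0)⟫_ℂ + ⟪B (R 0), B (R 0)⟫_ℂ := by
  have hABM' : ∀ x y, ⟪A (M y), A x⟫_ℂ = ⟪B y, B x⟫_ℂ := fun x y => by
    rw [← inner_conj_symm, hABM, inner_conj_symm]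
  -- Extending the curves continuously beyond `[0, T]` makes their primitives differentiable on the
  -- whole line, end points included. These primitives, `w` and `r` below, agree with `W` and `R` on
  -- `[0, T]`.
  have ext : ∀ {f : ℝ → E}, ContinuousOn f (Icc 0 T) → ∃ f' : ℝ → E, Continuous f' ∧
      ∀ t ∈ Icc 0 T, f' t = f t := fun {f} hf =>
    ⟨IccExtend hT.le ((Icc 0 T).domRestrict f), continuous_IccExtend_iff.2 hf.domRestrict,
      fun t ht => by rw [IccExtend_of_mem _ _ ht]; rfl⟩
  have cint : ∀ {f f' : ℝ → E}, (∀ t ∈ Icc 0 T, f' t = f t) → ∀ t ∈ Icc 0 T,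
      ∫ τ in (0)..t, f' τ = ∫ τ in (0)..t, f τ := fun {f f'} h t ht =>
    intervalIntegral.integral_congr fun τ hτ => by
      rw [uIcc_of_le ht.1] at hτ
      exact h τ ⟨hτ.1, hτ.2.trans ht.2⟩
  obtain ⟨W', cW', hW'⟩ := ext hW
  obtain ⟨R', cR', hR'⟩ := ext hR
  have dW : ∀ x, HasDerivAt (fun t => W 0 - M (∫ τ in (0)..t, R' τ)) (-M (R' x)) x := fun x => by
    have h1 : HasDerivAt (fun t => ∫ τ in (0)..t, R' τ) (R' x) x :=
      intervalIntegral.integral_hasDerivAt_right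
        (cR'.intervalIntegrable _ _) (cR'.stronglyMeasurableAtFilter _ _) cR'.continuousAt
    have h2 : HasDerivAt (fun t => M (∫ τ in (0)..t, R' τ)) (M (R' x)) x :=
      (M.restrictScalars ℝ).hasFDerivAt.comp_hasDerivAt x h1
    exact h2.const_sub _
  have dR : ∀ x, HasDerivAt (fun t => R 0 + ∫ τ in (0)..t, W' τ) (W' x) x := fun x =>
    (intervalIntegral.integral_hasDerivAt_right
      (cW'.intervalIntegrable _ _) (cW'.stronglyMeasurableAtFilter _ _) cW'.continuousAt).const_add _
  have eW' : ∀ t ∈ Icc 0 T, W 0 - M (∫ τ in (0)..t, R' τ) = W t := fun t ht => by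
    rw [cint hR' t ht, ← eW t ht]
  have eR' : ∀ t ∈ Icc 0 T, R 0 + ∫ τ in (0)..t, W' τ = R t := fun t ht => by
    rw [cint hW' t ht, ← eR t ht]
  generalize hw : (fun t => W 0 - M (∫ τ in (0)..t, R' τ)) = w at dW
  generalize hr : (fun t => R 0 + ∫ τ in (0)..t, W' τ) = r at dR
  have ew : ∀ t ∈ Icc 0 T, w t = W t := fun t ht => by rw [← hw]; exact eW' t ht
  have er : ∀ t ∈ Icc 0 T, r t = R t := fun t ht => by rw [← hr]; exact eR' t ht
  have dE : ∀ x ∈ Icc 0 T,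
      HasDerivAt (fun t => ⟪A (w t), A (w t)⟫_ℂ + ⟪B (r t), B (r t)⟫_ℂ) 0 x := fun x hx => by
    have d1 : HasDerivAt (fun t => A (w t)) (A (-M (R' x))) x :=
      (A.restrictScalars ℝ).hasFDerivAt.comp_hasDerivAt x (dW x)
    have d2 : HasDerivAt (fun t => B (r t)) (B (W' x)) x :=
      (B.restrictScalars ℝ).hasFDerivAt.comp_hasDerivAt x (dR x)
    have d := (d1.inner ℂ d1).add (d2.inner ℂ d2)
    convert! d using 1
    simp only [map_neg, inner_neg_right, inner_neg_left, hABM, hABM',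
      ew x hx, er x hx, hW' x hx, hR' x hx]
    ring
  have := constant_of_has_deriv_right_zero (f := fun t => ⟪A (w t), A (w t)⟫_ℂ +
    ⟪B (r t), B (r t)⟫_ℂ) (a := 0) (b := T) (fun x hx => (dE x hx).continuousAt.continuousWithinAt)
    (fun x hx => (dE x (Ico_subset_Icc_self hx)).hasDerivWithinAt) t ht
  have h0 : (0 : ℝ) ∈ Icc 0 T := ⟨le_rfl, hT.le⟩
  simpa only [ew t ht, er t ht, ew 0 h0, er 0 h0] using this

end EnergyAbstract

/-! ### Energy at almost every frequency -/

section EnergyL2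

variable {d : ℕ}

theorem inner_mulCLM {q q' : Horiz d → ℝ} {A A' : HorizL2 d →L[ℂ] HorizL2 d}
    (hA : ∀ U, A U =ᵐ[volume] fun ξ => (q ξ : ℂ) * U ξ)
    (hA' : ∀ U, A' U =ᵐ[volume] fun ξ => (q' ξ : ℂ) * U ξ) (x y : HorizL2 d) :
    inner ℂ (A x) (A' y) = ∫ ξ, ((q ξ * q' ξ : ℝ) : ℂ) * (y ξ * starRingEnd ℂ (x ξ)) := by
  rw [L2.inner_def]
  refine integral_congr_ae ?_
  filter_upwards [hA x, hA' y] with ξ h1 h2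
  rw [h1, h2, RCLike.inner_apply, map_mul, Complex.conj_ofReal]
  push_cast
  ring

/-- Pointwise conservation of energy for the oscillators `R' = W`, `W' = -m R`. -/
theorem oscillator_energy_ae {T : ℝ} (hT : 0 < T) {W R : ℝ → HorizL2 d}
    (hW : ContinuousOn W (Icc 0 T)) (hR : ContinuousOn R (Icc 0 T)) {m : Horiz d → ℝ}
    (hm : Measurable m) {K : ℝ} (hm0 : ∀ ξ, 0 ≤ m ξ) (hmK : ∀ ξ, m ξ ≤ K)
    (eR : ∀ t ∈ Icc 0 T, R t = R 0 + ∫ τ in (0)..t, W τ)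
    (eW : ∀ t ∈ Icc 0 T, ∀ᵐ ξ, W t ξ = W 0 ξ - (m ξ : ℂ) * (∫ τ in (0)..t, R τ : HorizL2 d) ξ)
    {t : ℝ} (ht : t ∈ Icc 0 T) :
    ∀ᵐ ξ, ‖W t ξ‖ ^ 2 + m ξ * ‖R t ξ‖ ^ 2 = ‖W 0 ξ‖ ^ 2 + m ξ * ‖R 0 ξ‖ ^ 2 := by
  obtain ⟨M, hM⟩ := exists_mulCLM hm (K := K) fun ξ => by rw [abs_of_nonneg (hm0 ξ)]; exact hmK ξ
  have hint : ∀ t, Integrable (fun ξ => ‖W t ξ‖ ^ 2 + m ξ * ‖R t ξ‖ ^ 2) volume := fun t => by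
    refine ((Lp.memLp (W t)).integrable_norm_pow (by norm_num)).add
      (Integrable.bdd_mul (c := K) ((Lp.memLp (R t)).integrable_norm_pow (by norm_num))
        hm.aestronglyMeasurable (ae_of_all _ fun ξ => ?_))
    rw [Real.norm_of_nonneg (hm0 ξ)]
    exact hmK ξ
  -- A curve in `L²` cannot be evaluated at a fixed `ξ`, so the energy is localised instead: `A`
  -- multiplies by the indicator of `S` and `B` by that of `S` times `√m`. Conservation for every
  -- `S` gives the pointwise statement.
  refine Integrable.ae_eq_of_forall_setIntegral_eq _ _ (hint t) (hint 0) fun S hS _ => ?_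
  obtain ⟨A, hA⟩ := exists_mulCLM (q := S.indicator fun _ => 1) (measurable_const.indicator hS)
    (K := 1) fun ξ => by
      by_cases h : ξ ∈ S <;> simp [h]
  obtain ⟨B, hB⟩ := exists_mulCLM (q := S.indicator fun ξ => √(m ξ)) (hm.sqrt.indicator hS)
    (K := √K) fun ξ => by
      by_cases h : ξ ∈ S
      · simp only [h, indicator_of_mem, abs_of_nonneg (Real.sqrt_nonneg _)]
        exact Real.sqrt_le_sqrt (hmK ξ)
      · simp [h]
  have hAM : ∀ U, (A ∘L M) U =ᵐ[volume] fun ξ => ((S.indicator m ξ : ℝ) : ℂ) * U ξ := fun U => by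
    filter_upwards [hA (M U), hM U] with ξ h1 h2
    rw [ContinuousLinearMap.comp_apply, h1, h2]
    by_cases h : ξ ∈ S <;> simp [h]
  have key := inner_add_inner_eq_of_oscillator hT hW hR (A := A) (B := B) (M := M)
    (fun x y => by
      rw [← ContinuousLinearMap.comp_apply A M, inner_mulCLM hA hAM, inner_mulCLM hB hB]
      refine integral_congr_ae (ae_of_all _ fun ξ => ?_)
      by_cases h : ξ ∈ S
      · simp [h, Real.mul_self_sqrt (hm0 ξ)]
      · simp [h]) eR
    (fun t ht => by
      refine Lp.ext ?_
      filter_upwards [eW t ht, Lp.coeFn_sub (W 0) (M (∫ τ in (0)..t, R τ)),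
        hM (∫ τ in (0)..t, R τ)] with ξ h1 h2 h3
      exact h1.trans (h2.trans (by rw [Pi.sub_apply, h3])).symm) ht
  have hE : ∀ t, inner ℂ (A (W t)) (A (W t)) + inner ℂ (B (R t)) (B (R t)) =
      ((∫ ξ in S, (‖W t ξ‖ ^ 2 + m ξ * ‖R t ξ‖ ^ 2) : ℝ) : ℂ) := fun t => by
    rw [inner_mulCLM hA hA, inner_mulCLM hB hB, ← integral_indicator hS, ← integral_complex_ofReal,
      ← integral_add]
    · refine integral_congr_ae (ae_of_all _ fun ξ => ?_)
      by_cases h : ξ ∈ S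
      · simp only [h, indicator_of_mem, Real.mul_self_sqrt (hm0 ξ), Complex.mul_conj']
        push_cast
        ring
      · simp [h]
    · refine ((L2.integrable_inner (𝕜 := ℂ) (A (W t)) (A (W t)))).congr ?_
      filter_upwards [hA (W t)] with ξ h1
      rw [h1, RCLike.inner_apply, map_mul, Complex.conj_ofReal]
      push_cast
      ring
    · refine ((L2.integrable_inner (𝕜 := ℂ) (B (R t)) (B (R t)))).congr ?_
      filter_upwards [hB (R t)] with ξ h1
      rw [h1, RCLike.inner_apply, map_mul, Complex.conj_ofReal]
      push_cast
      ring
  rw [hE, hE] at key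
  exact_mod_cast key

/-- The symbol `|2πξ|²` of `-Δ`. -/
def lapSymbol (ξ : Horiz d) : ℝ := ∑ i, (2 * Real.pi * ξ i) ^ 2

/-- The symbol `2πi ξ_i` of `∂_i`. -/
def dirSymbol (i : Fin d) (ξ : Horiz d) : ℂ := 2 * Real.pi * Complex.I * ξ i

theorem continuous_lapSymbol : Continuous (lapSymbol (d := d)) := by
  unfold lapSymbol; fun_prop

theorem continuous_dirSymbol (i : Fin d) : Continuous (dirSymbol i) := by
  unfold dirSymbol; fun_prop

theorem sum_dirSymbol_sq (ξ : Horiz d) : ∑ i, dirSymbol i ξ ^ 2 = -(lapSymbol ξ : ℂ) := by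
  simp only [dirSymbol, lapSymbol, mul_pow, Complex.I_sq]
  push_cast
  rw [← Finset.sum_neg_distrib]
  exact Finset.sum_congr rfl fun i _ => by ring

theorem conj_dirSymbol (i : Fin d) (ξ : Horiz d) :
    starRingEnd ℂ (dirSymbol i ξ) = -dirSymbol i ξ := by
  simp [dirSymbol, Complex.conj_ofNat]

theorem lapSymbol_nonneg (ξ : Horiz d) : 0 ≤ lapSymbol ξ :=
  Finset.sum_nonneg fun _ _ => sq_nonneg _

theorem ae_lapSymbol_ne_zero (hd : d ≠ 0) : ∀ᵐ ξ : Horiz d, lapSymbol ξ ≠ 0 := by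
  have : Nonempty (Fin d) := ⟨⟨0, Nat.pos_of_ne_zero hd⟩⟩
  have h0 : ∀ᵐ ξ : Horiz d, ξ ≠ 0 := by
    rw [ae_iff]
    simp
  filter_upwards [h0] with ξ hξ h
  apply hξ
  rw [lapSymbol, Finset.sum_eq_zero_iff_of_nonneg fun _ _ => sq_nonneg _] at h
  ext i
  have := h i (Finset.mem_univ i)
  have hp := Real.pi_pos
  simpa [hp.ne'] using this

/-- The equality case of Cauchy–Schwarz: the hypothesis says that `v` is parallel to `ξ` when `ξ ≠
0`. For curl-free fields the divergence thus controls the whole velocity. -/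
theorem lapSymbol_mul_sum_norm_sq {v : Fin d → ℂ} {ξ : Horiz d}
    (h : ∀ i j, dirSymbol j ξ * v i = dirSymbol i ξ * v j) :
    lapSymbol ξ * ∑ i, ‖v i‖ ^ 2 = ‖∑ i, dirSymbol i ξ * v i‖ ^ 2 := by
  have e : ((lapSymbol ξ * ∑ i, ‖v i‖ ^ 2 : ℝ) : ℂ) = ((‖∑ i, dirSymbol i ξ * v i‖ ^ 2 : ℝ) : ℂ) := by
    push_cast
    simp only [← Complex.mul_conj', map_sum, map_mul, conj_dirSymbol]
    rw [← neg_eq_iff_eq_neg.2 (sum_dirSymbol_sq ξ), Finset.sum_mul_sum, ← Finset.sum_neg_distrib,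
      Finset.sum_mul_sum, Finset.sum_comm]
    refine Finset.sum_congr rfl fun i _ => Finset.sum_congr rfl fun j _ => ?_
    have h' := congrArg (starRingEnd ℂ) (h i j)
    simp only [map_mul, conj_dirSymbol] at h'
    linear_combination (dirSymbol j ξ * v i) * h'
  exact_mod_cast e

end EnergyL2

/-! ### Conservation of the energy of each mode -/

section ModalEnergy

open scoped FourierTransform LineDeriv

variable {d : ℕ}

/-- Contracting `e2` with the symbol of the gradient and inserting `e3` gives `D (W - W₀) = -κ ∫ R`,
an oscillator with `m = κ / D ≤ N²`. Its invariant `|W|² + m |R|²`, multiplied by `D / κ`, is the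
stated energy, because `κ |V|² = |W|² / c²` by `e3` and `e4`. -/
theorem modal_energy_ae (hd : d ≠ 0) {T c N : ℝ} (hT : 0 < T) (hc : 0 < c) (hN : 0 < N)
    {Vh : Fin d → ℝ → HorizL2 d} {Wh Rh : ℝ → HorizL2 d} (cW : ContinuousOn Wh (Icc 0 T))
    (cR : ContinuousOn Rh (Icc 0 T))
    (e1 : ∀ t ∈ Icc 0 T, Rh t = Rh 0 + ∫ τ in (0)..t, Wh τ)
    (e2 : ∀ t ∈ Icc 0 T, ∀ i, ∀ᵐ ξ, 1 / (c : ℂ) * (Vh i t ξ - Vh i 0 ξ) -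
      1 / (N : ℂ) ^ 2 * (dirSymbol i ξ * (Wh t ξ - Wh 0 ξ)) =
        dirSymbol i ξ * (∫ τ in (0)..t, Rh τ : HorizL2 d) ξ)
    (e3 : ∀ t ∈ Icc 0 T, ∀ᵐ ξ, ∑ i, dirSymbol i ξ * Vh i t ξ = 1 / (c : ℂ) * Wh t ξ)
    (e4 : ∀ t ∈ Icc 0 T, ∀ i j, ∀ᵐ ξ, dirSymbol j ξ * Vh i t ξ = dirSymbol i ξ * Vh j t ξ)
    {t : ℝ} (ht : t ∈ Icc 0 T) :
    ∀ᵐ ξ, ∑ i, ‖Vh i t ξ‖ ^ 2 + ‖Wh t ξ‖ ^ 2 / N ^ 2 + ‖Rh t ξ‖ ^ 2 =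
      ∑ i, ‖Vh i 0 ξ‖ ^ 2 + ‖Wh 0 ξ‖ ^ 2 / N ^ 2 + ‖Rh 0 ξ‖ ^ 2 := by
  have h0 : (0 : ℝ) ∈ Icc 0 T := ⟨le_rfl, hT.le⟩
  set D : Horiz d → ℝ := fun ξ => 1 / c ^ 2 + lapSymbol ξ / N ^ 2 with hD
  have hDpos : ∀ ξ, 0 < D ξ := fun ξ => by
    have := lapSymbol_nonneg ξ
    simp only [hD]; positivity
  set m : Horiz d → ℝ := fun ξ => lapSymbol ξ / D ξ with hm
  have hcm : Continuous m :=
    continuous_lapSymbol.div (continuous_const.add (continuous_lapSymbol.div_const _))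
      fun ξ => (hDpos ξ).ne'
  have hmN : ∀ ξ, m ξ ≤ N ^ 2 := fun ξ => by
    rw [hm, div_le_iff₀ (hDpos ξ)]
    have : N ^ 2 * D ξ = N ^ 2 / c ^ 2 + lapSymbol ξ := by simp only [hD]; field_simp
    rw [this]
    have : 0 ≤ N ^ 2 / c ^ 2 := by positivity
    linarith
  have eW : ∀ t ∈ Icc 0 T, ∀ᵐ ξ, Wh t ξ = Wh 0 ξ -
      (m ξ : ℂ) * (∫ τ in (0)..t, Rh τ : HorizL2 d) ξ := fun t ht => by
    filter_upwards [ae_all_iff.2 (e2 t ht), e3 t ht, e3 0 h0] with ξ a2 a3 a30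
    have hcC : (c : ℂ) ≠ 0 := by exact_mod_cast hc.ne'
    have hNC : (N : ℂ) ≠ 0 := by exact_mod_cast hN.ne'
    have hDC : (D ξ : ℂ) ≠ 0 := by exact_mod_cast (hDpos ξ).ne'
    generalize (∫ τ in (0)..t, Rh τ : HorizL2 d) ξ = I at *
    have s2 : ∑ i, dirSymbol i ξ * (1 / (c : ℂ) * (Vh i t ξ - Vh i 0 ξ) -
        1 / (N : ℂ) ^ 2 * (dirSymbol i ξ * (Wh t ξ - Wh 0 ξ))) =
        ∑ i, dirSymbol i ξ * (dirSymbol i ξ * I) :=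
      Finset.sum_congr rfl fun i _ => by rw [a2 i]
    have l2 : ∑ i, dirSymbol i ξ * (1 / (c : ℂ) * (Vh i t ξ - Vh i 0 ξ) -
        1 / (N : ℂ) ^ 2 * (dirSymbol i ξ * (Wh t ξ - Wh 0 ξ))) =
        1 / (c : ℂ) * (∑ i, dirSymbol i ξ * Vh i t ξ - ∑ i, dirSymbol i ξ * Vh i 0 ξ) -
        1 / (N : ℂ) ^ 2 * ((∑ i, dirSymbol i ξ ^ 2) * (Wh t ξ - Wh 0 ξ)) := by
      rw [← Finset.sum_sub_distrib, Finset.mul_sum, Finset.sum_mul, Finset.mul_sum,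
        ← Finset.sum_sub_distrib]
      exact Finset.sum_congr rfl fun i _ => by ring
    have r2 : ∑ i, dirSymbol i ξ * (dirSymbol i ξ * I) = (∑ i, dirSymbol i ξ ^ 2) * I := by
      rw [Finset.sum_mul]
      exact Finset.sum_congr rfl fun i _ => by ring
    rw [l2, r2, a3, a30, sum_dirSymbol_sq] at s2
    have hDm : (m ξ : ℂ) * D ξ = lapSymbol ξ := by
      rw [← Complex.ofReal_mul, hm, div_mul_cancel₀ _ (hDpos ξ).ne']
    have hDe : (D ξ : ℂ) = 1 / (c : ℂ) ^ 2 + lapSymbol ξ / (N : ℂ) ^ 2 := by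
      simp only [hD]; push_cast; ring
    refine mul_left_cancel₀ hDC (sub_eq_zero.1 ?_)
    have : (D ξ : ℂ) * Wh t ξ - D ξ * (Wh 0 ξ - m ξ * I) =
        D ξ * (Wh t ξ - Wh 0 ξ) + (m ξ * D ξ) * I := by ring
    rw [this, hDm, hDe]
    linear_combination s2
  filter_upwards [oscillator_energy_ae hT cW cR hcm.measurable
    (fun ξ => div_nonneg (lapSymbol_nonneg ξ) (hDpos ξ).le) hmN e1 eW ht, e3 t ht, e3 0 h0,
    ae_all_iff.2 fun i => ae_all_iff.2 (e4 t ht i), ae_all_iff.2 fun i => ae_all_iff.2 (e4 0 h0 i),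
    ae_lapSymbol_ne_zero hd] with ξ hE a3 a30 a4 a40 hκ
  have b := lapSymbol_mul_sum_norm_sq (v := fun i => Vh i t ξ) a4
  have b0 := lapSymbol_mul_sum_norm_sq (v := fun i => Vh i 0 ξ) a40
  simp only [a3, a30, norm_mul, norm_div, norm_one, Complex.norm_real,
    Real.norm_of_nonneg hc.le] at b b0
  have hDm : m ξ * D ξ = lapSymbol ξ := by rw [hm, div_mul_cancel₀ _ (hDpos ξ).ne']
  have fin : ∀ x y v : ℝ, lapSymbol ξ * v = (1 / c * x) ^ 2 →
      lapSymbol ξ * (v + x ^ 2 / N ^ 2 + y ^ 2) = D ξ * (x ^ 2 + m ξ * y ^ 2) := fun x y v h => by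
    have : D ξ * (x ^ 2 + m ξ * y ^ 2) = D ξ * x ^ 2 + (m ξ * D ξ) * y ^ 2 := by ring
    rw [this, hDm]
    simp only [hD]
    linear_combination h
  refine mul_left_cancel₀ hκ ?_
  rw [fin _ _ _ b, fin _ _ _ b0, hE]

theorem dirMul_eq (i : Fin d) (φ : 𝓢(Horiz d, ℂ)) (ξ : Horiz d) :
    dirMul i φ ξ = dirSymbol i ξ * φ ξ := by
  rw [dirMul_apply, dirSymbol]

theorem integral_dirSymbol_mul (i : Fin d) (U : HorizL2 d) (φ : 𝓢(Horiz d, ℂ)) :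
    ∫ ξ, dirSymbol i ξ * U ξ * φ ξ = ∫ ξ, U ξ * dirMul i φ ξ :=
  integral_congr_ae (ae_of_all _ fun ξ => by simp only [dirMul_eq]; ring)

theorem integrable_dirSymbol_mul (i : Fin d) (U : HorizL2 d) (φ : 𝓢(Horiz d, ℂ)) :
    Integrable (fun ξ => dirSymbol i ξ * U ξ * φ ξ) :=
  (integrable_L2_mul_schwartz U (dirMul i φ)).congr
    (ae_of_all _ fun ξ => by simp only [dirMul_eq]; ring)

theorem ae_eq_of_forall_schwartz {F G : Horiz d → ℂ} (hF : LocallyIntegrable F volume)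
    (hG : LocallyIntegrable G volume)
    (iF : ∀ φ : 𝓢(Horiz d, ℂ), Integrable (fun ξ => F ξ * φ ξ))
    (iG : ∀ φ : 𝓢(Horiz d, ℂ), Integrable (fun ξ => G ξ * φ ξ))
    (h : ∀ φ : 𝓢(Horiz d, ℂ), ∫ ξ, F ξ * φ ξ = ∫ ξ, G ξ * φ ξ) : F =ᵐ[volume] G := by
  have := ae_eq_zero_of_forall_schwartz (hF.sub hG) (fun φ => by
    simp only [Pi.sub_apply, sub_mul]
    rw [integral_sub (iF φ) (iG φ), h, sub_self])
  filter_upwards [this] with ξ hξ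
  exact sub_eq_zero.1 hξ

theorem locallyIntegrable_L2 (U : HorizL2 d) : LocallyIntegrable U volume :=
  (Lp.memLp U).locallyIntegrable (by norm_num)

variable {H T s g : ℝ} {ρeq : ℝ → ℝ} {b N : ℝ} {V : Fin d → ℝ → Horiz d × ℝ → ℝ}
  {w ρ P : ℝ → Horiz d × ℝ → ℝ} {Vv : Fin d → ℝ → StripL2 d H} {wv ρv : ℝ → StripL2 d H}

/-- The Fourier transforms of the modal coefficients, and the conservation of their energy. -/
theorem exists_modal_hats (hd : d ≠ 0) (hs : 0 ≤ s) (hT : 0 < T) (hB : IsBackground H g ρeq b N)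
    (hsol : IsLinearSolution H g T ρeq V w ρ P) (hV : ∀ i, IsHsCurve H T s (V i) (Vv i))
    (hw : IsHsCurve H T s w wv) (hρ : IsHsCurve H T s ρ ρv)
    (hcurl : HasZeroVerticalVorticity H (fun i => V i 0)) {c : ℝ} {f : ℝ → ℝ}
    (hf : IsMode H ρeq N c f) :
    ∃ (Vh : Fin d → ℝ → HorizL2 d) (Wh Rh : ℝ → HorizL2 d),
      (∀ (i : Fin d) (t : ℝ) (φ : 𝓢(Horiz d, ℂ)), ∫ ξ, Vh i t ξ * φ ξ = br s (Vv i t) (𝓕⁻ φ) (profV ρeq c f)) ∧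
      (∀ (t : ℝ) (φ : 𝓢(Horiz d, ℂ)), ∫ ξ, Wh t ξ * φ ξ = br s (wv t) (𝓕⁻ φ) (profW ρeq N f)) ∧
      (∀ (t : ℝ) (φ : 𝓢(Horiz d, ℂ)), ∫ ξ, Rh t ξ * φ ξ = br s (ρv t) (𝓕⁻ φ) (profRho g f)) ∧
      ∀ t ∈ Icc 0 T, ∀ᵐ ξ, ∑ i, ‖Vh i t ξ‖ ^ 2 + ‖Wh t ξ‖ ^ 2 / N ^ 2 + ‖Rh t ξ‖ ^ 2 =
        ∑ i, ‖Vh i 0 ξ‖ ^ 2 + ‖Wh 0 ξ‖ ^ 2 / N ^ 2 + ‖Rh 0 ξ‖ ^ 2 := by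
  -- The transforms are values of fixed continuous linear maps, so continuity in time and the
  -- exchange with time integrals are inherited from the curves. The hypotheses of `modal_energy_ae`
  -- are then checked against Schwartz functions.
  obtain ⟨KV, hKV⟩ := exists_hatCLM (d := d) hs (hf.memLp_profV hB)
  obtain ⟨KW, hKW⟩ := exists_hatCLM (d := d) hs (hf.memLp_profW hB)
  obtain ⟨KR, hKR⟩ := exists_hatCLM (d := d) hs (hf.memLp_profRho g)
  have hKV' : ∀ v (φ : 𝓢(Horiz d, ℂ)), ∫ ξ, KV v ξ * φ ξ = br s v (𝓕⁻ φ) (profV ρeq c f) := hKV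
  have hKW' : ∀ v (φ : 𝓢(Horiz d, ℂ)), ∫ ξ, KW v ξ * φ ξ = br s v (𝓕⁻ φ) (profW ρeq N f) := hKW
  have hKR' : ∀ v (φ : 𝓢(Horiz d, ℂ)), ∫ ξ, KR v ξ * φ ξ = br s v (𝓕⁻ φ) (profRho g f) := hKR
  refine ⟨fun i t => KV (Vv i t), fun t => KW (wv t), fun t => KR (ρv t),
    fun i t φ => hKV' _ φ, fun t φ => hKW' _ φ, fun t φ => hKR' _ φ, fun t ht => ?_⟩
  refine modal_energy_ae hd hT hf.speed_pos hB.freq_pos (Vh := fun i t => KV (Vv i t))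
    (Wh := fun t => KW (wv t)) (Rh := fun t => KR (ρv t))
    (KW.continuous.comp_continuousOn hw.continuousOn)
    (KR.continuous.comp_continuousOn hρ.continuousOn) (fun t ht => ?_) (fun t ht i => ?_)
    (fun t ht => ?_) (fun t ht i j => ?_) ht
  · rw [KW.intervalIntegral_comp_comm (hw.intervalIntegrable ht), ← sub_eq_iff_eq_add', ← map_sub]
    refine Lp.ext (ae_eq_of_forall_schwartz (locallyIntegrable_L2 _) (locallyIntegrable_L2 _)
      (integrable_L2_mul_schwartz _) (integrable_L2_mul_schwartz _) fun φ => ?_)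
    rw [hKR', hKW', density_modal hs hT hB hsol hw hρ ht hf]
  · have eI : (∫ τ in (0)..t, KR (ρv τ) : HorizL2 d) = KR (∫ τ in (0)..t, ρv τ) :=
      KR.intervalIntegral_comp_comm (hρ.intervalIntegrable ht)
    rw [eI]
    have key : (fun ξ => 1 / (c : ℂ) * KV (Vv i t - Vv i 0) ξ -
        1 / (N : ℂ) ^ 2 * (dirSymbol i ξ * KW (wv t - wv 0) ξ)) =ᵐ[volume]
        fun ξ => dirSymbol i ξ * KR (∫ τ in (0)..t, ρv τ) ξ := by
      have j1 : ∀ φ : 𝓢(Horiz d, ℂ),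
          Integrable (fun ξ => 1 / (c : ℂ) * (KV (Vv i t - Vv i 0) ξ * φ ξ)) := fun φ =>
        (integrable_L2_mul_schwartz _ φ).const_mul _
      have j2 : ∀ φ : 𝓢(Horiz d, ℂ), Integrable (fun ξ =>
          1 / (N : ℂ) ^ 2 * (dirSymbol i ξ * KW (wv t - wv 0) ξ * φ ξ)) := fun φ =>
        (integrable_dirSymbol_mul i _ φ).const_mul _
      have esplit : ∀ φ : 𝓢(Horiz d, ℂ), (fun ξ => (1 / (c : ℂ) * KV (Vv i t - Vv i 0) ξ -
          1 / (N : ℂ) ^ 2 * (dirSymbol i ξ * KW (wv t - wv 0) ξ)) * φ ξ) =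
          fun ξ => 1 / (c : ℂ) * (KV (Vv i t - Vv i 0) ξ * φ ξ) -
            1 / (N : ℂ) ^ 2 * (dirSymbol i ξ * KW (wv t - wv 0) ξ * φ ξ) := fun φ => by
        ext ξ; ring
      refine ae_eq_of_forall_schwartz ?_ (locallyIntegrable_mul_L2 _ (continuous_dirSymbol i))
        (fun φ => ?_) (integrable_dirSymbol_mul i _) fun φ => ?_
      · refine LocallyIntegrable.sub (locallyIntegrable_mul_L2 _ continuous_const) ?_
        simp_rw [← mul_assoc]
        exact locallyIntegrable_mul_L2 _ (continuous_const.mul (continuous_dirSymbol i))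
      · rw [esplit]
        exact (j1 φ).sub (j2 φ)
      · rw [esplit, integral_sub (j1 φ) (j2 φ), integral_const_mul, integral_const_mul,
          integral_dirSymbol_mul, integral_dirSymbol_mul, hKV', hKW', hKR',
          ← lineDeriv_fourierInv]
        exact vorticity_modal hs hT hB hsol hV hw hρ ht i hf _
    rw [map_sub, map_sub] at key
    filter_upwards [key, Lp.coeFn_sub (KV (Vv i t)) (KV (Vv i 0)),
      Lp.coeFn_sub (KW (wv t)) (KW (wv 0))] with ξ h1 h2 h3
    rw [Pi.sub_apply] at h2 h3
    rw [← h2, ← h3]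
    exact h1
  · refine ae_eq_of_forall_schwartz
      (locallyIntegrable_finsetSum _ fun i _ => locallyIntegrable_mul_L2 _ (continuous_dirSymbol i))
      (locallyIntegrable_mul_L2 _ continuous_const) (fun φ => ?_) (fun φ => ?_) fun φ => ?_
    · simp_rw [Finset.sum_mul]
      exact integrable_finsetSum _ fun i _ => integrable_dirSymbol_mul i _ φ
    · simp_rw [mul_assoc]
      exact (integrable_L2_mul_schwartz _ φ).const_mul _
    · simp_rw [Finset.sum_mul, mul_assoc (1 / (c : ℂ))]
      rw [integral_finsetSum _ fun i _ => integrable_dirSymbol_mul i _ φ, integral_const_mul, hKW',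
        ← divergence_modal hs hB hsol hV hw ht hf]
      exact Finset.sum_congr rfl fun i _ => by
        rw [integral_dirSymbol_mul, hKV', lineDeriv_fourierInv]
  · refine ae_eq_of_forall_schwartz (locallyIntegrable_mul_L2 _ (continuous_dirSymbol j))
      (locallyIntegrable_mul_L2 _ (continuous_dirSymbol i)) (integrable_dirSymbol_mul j _)
      (integrable_dirSymbol_mul i _) fun φ => ?_
    rw [integral_dirSymbol_mul, integral_dirSymbol_mul, hKV', hKV', ← lineDeriv_fourierInv,
      ← lineDeriv_fourierInv]
    exact br_curl_eq hs hT hB hsol hV hcurl ht i j _ (hf.memLp_profV hB)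

end ModalEnergy

/-! ### Sequences of weak derivatives and constant-coefficient operators -/

section Jets

variable {H : ℝ}

/-- `D 0, …, D m` are integrable on `(-H, 0)` and are successive weak derivatives. -/
structure IsJet (H : ℝ) (m : ℕ) (D : ℕ → ℝ → ℂ) : Prop where
  integrableOn : ∀ j ≤ m, IntegrableOn (D j) (Ioo (-H) 0)
  isWeakDeriv : ∀ j < m, IsWeakDeriv (-H) 0 (D j) (D (j + 1))

/-- The operator `∂ + a` on jets. -/
def shiftOp (a : ℂ) (D : ℕ → ℝ → ℂ) (j : ℕ) (z : ℝ) : ℂ := D (j + 1) z + a * D j z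

/-- The operator `∂ (∂ + a)` on jets. -/
def opL (a : ℂ) (D : ℕ → ℝ → ℂ) (j : ℕ) (z : ℝ) : ℂ := D (j + 2) z + a * D (j + 1) z

theorem IsWeakDeriv.add_const_mul {p q p' q' : ℝ → ℂ} (h : IsWeakDeriv (-H) 0 p q)
    (h' : IsWeakDeriv (-H) 0 p' q') (ip : IntegrableOn p (Ioo (-H) 0))
    (iq : IntegrableOn q (Ioo (-H) 0)) (ip' : IntegrableOn p' (Ioo (-H) 0))
    (iq' : IntegrableOn q' (Ioo (-H) 0)) (a : ℂ) :
    IsWeakDeriv (-H) 0 (fun z => p z + a * p' z) (fun z => q z + a * q' z) := by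
  intro ψ hψ
  simp only [add_mul, mul_assoc]
  rw [integral_add (hψ.deriv.integrable_mul ip) ((hψ.deriv.integrable_mul ip').const_mul a),
    integral_add (hψ.integrable_mul iq) ((hψ.integrable_mul iq').const_mul a),
    integral_const_mul, integral_const_mul, h ψ hψ, h' ψ hψ]
  ring

theorem IsJet.mono {m m' : ℕ} {D : ℕ → ℝ → ℂ} (h : IsJet H m D) (hm : m' ≤ m) : IsJet H m' D :=
  ⟨fun j hj => h.1 j (hj.trans hm), fun j hj => h.2 j (hj.trans_le hm)⟩

theorem IsJet.tail {m : ℕ} {D : ℕ → ℝ → ℂ} (h : IsJet H (m + 1) D) :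
    IsJet H m (fun j => D (j + 1)) :=
  ⟨fun j hj => h.1 (j + 1) (by omega), fun j hj => h.2 (j + 1) (by omega)⟩

theorem IsJet.jet_shiftOp {m : ℕ} {D : ℕ → ℝ → ℂ} (h : IsJet H (m + 1) D) (a : ℂ) :
    IsJet H m (shiftOp a D) where
  integrableOn j hj := (h.1 (j + 1) (by omega)).add ((h.1 j (by omega)).const_mul a)
  isWeakDeriv j hj := (h.2 (j + 1) (by omega)).add_const_mul (h.2 j (by omega))
    (h.1 _ (by omega)) (h.1 _ (by omega)) (h.1 _ (by omega)) (h.1 _ (by omega)) a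

theorem IsJet.jet_opL {m : ℕ} {D : ℕ → ℝ → ℂ} (h : IsJet H (m + 2) D) (a : ℂ) : IsJet H m (opL a D) :=
  (IsJet.tail (m := m + 1) h).jet_shiftOp a

theorem IsJet.jet_opL_iterate {m : ℕ} (a : ℂ) (l : ℕ) {D : ℕ → ℝ → ℂ} (h : IsJet H (m + 2 * l) D) :
    IsJet H m ((opL a)^[l] D) := by
  induction l generalizing D with
  | zero => exact h
  | succ l ih => exact ih (IsJet.jet_opL (m := m + 2 * l) (by convert! h using 1) a)

theorem IsWeakDeriv.unique {p q p' q' : ℝ → ℂ} (h : IsWeakDeriv (-H) 0 p q)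
    (h' : IsWeakDeriv (-H) 0 p' q') (iq : IntegrableOn q (Ioo (-H) 0))
    (iq' : IntegrableOn q' (Ioo (-H) 0)) (e : p =ᵐ[volume.restrict (Ioo (-H) 0)] p') :
    q =ᵐ[volume.restrict (Ioo (-H) 0)] q' := by
  refine ae_eq_of_forall_integral_test_eq iq iq' fun ψ hψ => neg_injective ?_
  rw [← h ψ hψ, ← h' ψ hψ]
  refine integral_congr_ae ?_
  filter_upwards [e] with z hz
  rw [hz]

theorem IsJet.ae_eq {m : ℕ} {D E : ℕ → ℝ → ℂ} (hD : IsJet H m D) (hE : IsJet H m E)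
    (h : D 0 =ᵐ[volume.restrict (Ioo (-H) 0)] E 0) :
    ∀ j ≤ m, D j =ᵐ[volume.restrict (Ioo (-H) 0)] E j := by
  intro j
  induction j with
  | zero => exact fun _ => h
  | succ j ih =>
    intro hj
    exact (hD.2 j hj).unique (hE.2 j hj) (hD.1 _ hj) (hE.1 _ hj) (ih (by omega))

theorem opL_iterate_ae_eq {μ : Measure ℝ} (a : ℂ) (l m : ℕ) {D E : ℕ → ℝ → ℂ}
    (h : ∀ j ≤ m + 2 * l, D j =ᵐ[μ] E j) :
    ∀ j ≤ m, ((opL a)^[l] D) j =ᵐ[μ] ((opL a)^[l] E) j := by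
  induction l generalizing D E with
  | zero => exact h
  | succ l ih =>
    refine ih fun j hj => ?_
    filter_upwards [h (j + 1) (by omega), h (j + 2) (by omega)] with z h1 h2
    simp only [opL, h1, h2]

/-- `Φ` is a combination with constant coefficients of the terms of order at most `m` of a jet. -/
def IsJetComb (m : ℕ) (Φ : (ℕ → ℝ → ℂ) → ℝ → ℂ) : Prop :=
  ∃ a : ℕ → ℂ, ∀ D z, Φ D z = ∑ j ∈ Finset.range (m + 1), a j * D j z

theorem isJetComb_apply {m j : ℕ} (hj : j ≤ m) : IsJetComb m (fun D => D j) :=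
  ⟨fun i => if i = j then 1 else 0, fun D z => by
    simp [Finset.sum_ite_eq', Nat.lt_succ_iff.2 hj]⟩

theorem IsJetComb.add {m : ℕ} {Φ Ψ : (ℕ → ℝ → ℂ) → ℝ → ℂ} (h : IsJetComb m Φ)
    (h' : IsJetComb m Ψ) : IsJetComb m (fun D z => Φ D z + Ψ D z) := by
  obtain ⟨a, ha⟩ := h
  obtain ⟨a', ha'⟩ := h'
  exact ⟨fun j => a j + a' j, fun D z => by
    simp only [ha, ha', add_mul, Finset.sum_add_distrib]⟩

theorem IsJetComb.const_mul {m : ℕ} {Φ : (ℕ → ℝ → ℂ) → ℝ → ℂ} (h : IsJetComb m Φ) (c : ℂ) :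
    IsJetComb m (fun D z => c * Φ D z) := by
  obtain ⟨a, ha⟩ := h
  exact ⟨fun j => c * a j, fun D z => by simp only [ha, Finset.mul_sum, mul_assoc]⟩

/-- What matters is that the coefficients do not depend on the jet: later they will be independent
of the test function and of the mode. -/
theorem isJetComb_opL_iterate (a : ℂ) (l : ℕ) : ∀ i m : ℕ, i + 2 * l ≤ m →
    IsJetComb m (fun D => ((opL a)^[l] D) i) := by
  induction l with
  | zero => exact fun i m h => isJetComb_apply h
  | succ l ih =>
    intro i m h
    simp_rw [Function.iterate_succ_apply']
    exact (ih (i + 2) m (by omega)).add ((ih (i + 1) m (by omega)).const_mul a)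

theorem IsJetComb.comp_shiftOp {m : ℕ} {Φ : (ℕ → ℝ → ℂ) → ℝ → ℂ} (h : IsJetComb m Φ) (a : ℂ) :
    IsJetComb (m + 1) (fun D => Φ (shiftOp a D)) := by
  obtain ⟨c, hc⟩ := h
  have : ∀ M ≤ m + 1, IsJetComb (m + 1)
      (fun D z => ∑ j ∈ Finset.range M, c j * shiftOp a D j z) := by
    intro M
    induction M with
    | zero => exact fun _ => ⟨fun _ => 0, fun D z => by simp⟩
    | succ M ih =>
      intro hM
      simp_rw [Finset.sum_range_succ]
      exact (ih (by omega)).add (((isJetComb_apply (by omega)).add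
        ((isJetComb_apply (by omega)).const_mul a)).const_mul (c M))
  obtain ⟨c', hc'⟩ := this (m + 1) le_rfl
  exact ⟨c', fun D z => (hc _ z).trans (hc' D z)⟩

/-- Weak derivative of the product with an exponential. -/
theorem IsWeakDeriv.exp_mul {p q : ℝ → ℂ} (h : IsWeakDeriv (-H) 0 p q)
    (ip : IntegrableOn p (Ioo (-H) 0)) (iq : IntegrableOn q (Ioo (-H) 0)) (A β : ℝ) :
    IsWeakDeriv (-H) 0 (fun z => ((A * Real.exp (β * z) : ℝ) : ℂ) * p z)
      (fun z => ((A * Real.exp (β * z) : ℝ) : ℂ) * (q z + β * p z)) := by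
  intro ψ hψ
  have hd : ∀ z, HasDerivAt (fun z => A * Real.exp (β * z) * ψ z)
      (A * Real.exp (β * z) * (deriv ψ z + β * ψ z)) z := fun z => by
    have h1 : HasDerivAt (fun z => β * z) β z := by simpa using (hasDerivAt_id z).const_mul β
    have h2 := (h1.exp.const_mul A).mul ((hψ.1.differentiable (by simp)) z).hasDerivAt
    convert! h2 using 1
    ring
  have hψ' : IsTestFunction (Ioo (-H) 0) (fun z => A * Real.exp (β * z) * ψ z) := by
    refine ⟨ContDiff.mul (by fun_prop) hψ.1, hψ.2.1.mul_left, ?_⟩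
    exact (tsupport_mul_subset_right (f := fun z => A * Real.exp (β * z)) (g := ψ)).trans hψ.2.2
  have e := h _ hψ'
  simp_rw [fun z => (hd z).deriv] at e
  have hψe : IsTestFunction (Ioo (-H) 0) (fun z => β * (A * Real.exp (β * z) * ψ z)) := by
    refine ⟨contDiff_const.mul hψ'.1, hψ'.2.1.mul_left, ?_⟩
    exact (tsupport_mul_subset_right (f := fun _ : ℝ => β)).trans hψ'.2.2
  have i1 : IntegrableOn (fun z => p z * ((A * Real.exp (β * z) * (deriv ψ z + β * ψ z) : ℝ) : ℂ))
      (Ioo (-H) 0) := by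
    have := hψ'.deriv.integrable_mul ip
    simp_rw [fun z => (hd z).deriv] at this
    exact this
  have i2 := hψe.integrable_mul ip
  have i3 := hψ'.integrable_mul iq
  calc _ = ∫ z in Ioo (-H) 0, (p z * ((A * Real.exp (β * z) * (deriv ψ z + β * ψ z) : ℝ) : ℂ) -
        p z * ((β * (A * Real.exp (β * z) * ψ z) : ℝ) : ℂ)) := by
        refine integral_congr_ae (ae_of_all _ fun z => ?_)
        simp only
        push_cast
        ring
    _ = -∫ z in Ioo (-H) 0, (q z * ((A * Real.exp (β * z) * ψ z : ℝ) : ℂ) +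
        p z * ((β * (A * Real.exp (β * z) * ψ z) : ℝ) : ℂ)) := by
        rw [integral_sub i1 i2, integral_add i3 i2, e]
        ring
    _ = _ := by
        congr 1
        refine integral_congr_ae (ae_of_all _ fun z => ?_)
        simp only
        push_cast
        ring

theorem integrableOn_exp_mul {p : ℝ → ℂ} (ip : IntegrableOn p (Ioo (-H) 0)) (A β : ℝ) :
    IntegrableOn (fun z => ((A * Real.exp (β * z) : ℝ) : ℂ) * p z) (Ioo (-H) 0) := by
  have hc : Continuous fun z : ℝ => ((A * Real.exp (β * z) : ℝ) : ℂ) := by fun_prop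
  obtain ⟨K, hK⟩ := isCompact_Icc.exists_bound_of_continuousOn (hc.continuousOn (s := Icc (-H) 0))
  refine Integrable.bdd_mul (c := K) ip hc.aestronglyMeasurable ?_
  filter_upwards [ae_restrict_mem measurableSet_Ioo] with z hz
    using hK z (Ioo_subset_Icc_self hz)

/-- The jet of `A e^{βz} D 0`. -/
def expJet (A β : ℝ) (D : ℕ → ℝ → ℂ) (j : ℕ) (z : ℝ) : ℂ :=
  ((A * Real.exp (β * z) : ℝ) : ℂ) * ((shiftOp β)^[j] D) 0 z

theorem IsJet.jet_shiftOp_iterate (a : ℂ) (j : ℕ) {m : ℕ} {D : ℕ → ℝ → ℂ} (h : IsJet H (m + j) D) :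
    IsJet H m ((shiftOp a)^[j] D) := by
  induction j generalizing D with
  | zero => exact h
  | succ j ih => exact ih (IsJet.jet_shiftOp (m := m + j) (by convert! h using 1) a)

/-- Each derivative of `e^{βz} u` is `e^{βz}` times `∂ + β` applied to the previous factor. -/
theorem IsJet.jet_expJet {m : ℕ} {D : ℕ → ℝ → ℂ} (h : IsJet H m D) (A β : ℝ) :
    IsJet H m (expJet A β D) where
  integrableOn j hj := integrableOn_exp_mul
    ((IsJet.jet_shiftOp_iterate β j (m := m - j) (h.mono (by omega))).1 0 (Nat.zero_le _)) A β
  isWeakDeriv j hj := by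
    have h1 := IsJet.jet_shiftOp_iterate β j (m := 1) (h.mono (by omega : 1 + j ≤ m))
    have := (h1.2 0 one_pos).exp_mul (h1.1 0 (by omega)) (h1.1 1 le_rfl) A β
    unfold expJet
    simp_rw [Function.iterate_succ_apply']
    exact this

theorem shiftOp_iterate_add_mul (a e : ℂ) (j : ℕ) (D E : ℕ → ℝ → ℂ) (i : ℕ) (z : ℝ) :
    ((shiftOp a)^[j] (fun i z => D i z + e * E i z)) i z =
      ((shiftOp a)^[j] D) i z + e * ((shiftOp a)^[j] E) i z := by
  induction j generalizing D E with
  | zero => rfl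
  | succ j ih =>
    rw [Function.iterate_succ_apply, Function.iterate_succ_apply, Function.iterate_succ_apply, ← ih]
    have e1 : shiftOp a (fun i z => D i z + e * E i z) =
        fun i z => shiftOp a D i z + e * shiftOp a E i z := by
      funext i z
      simp only [shiftOp]
      ring
    rw [e1]

/-- Conjugation by `e^{bz}` turns `∂` into `∂ + b`, hence `∂(∂ - b)` into `(∂ + b)∂`. The trace
conditions on the density thereby take the form of those on `w`. -/
theorem opL_expJet (A b : ℝ) (D : ℕ → ℝ → ℂ) :
    opL (-b) (expJet A b D) = expJet A b (opL b D) := by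
  funext j z
  simp only [opL, expJet]
  -- The identity `∂(∂ + b) = (∂ + b)² - b(∂ + b)` expresses everything through iterates of `∂ + b`,
  -- as in `expJet`.
  have e : opL b D = fun i z => shiftOp b (shiftOp b D) i z + (-b : ℂ) * shiftOp b D i z := by
    funext i z
    simp only [opL, shiftOp]
    ring
  have := shiftOp_iterate_add_mul b (-b : ℂ) j (shiftOp b (shiftOp b D)) (shiftOp b D) 0 z
  rw [← e] at this
  rw [this, Function.iterate_succ_apply, Function.iterate_succ_apply, Function.iterate_succ_apply]
  ring

theorem opL_iterate_expJet (A b : ℝ) (l : ℕ) (D : ℕ → ℝ → ℂ) :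
    (opL (-b))^[l] (expJet A b D) = expJet A b ((opL b)^[l] D) := by
  induction l generalizing D with
  | zero => rfl
  | succ l ih => rw [Function.iterate_succ_apply, opL_expJet, ih, Function.iterate_succ_apply]

end Jets

/-! ### Integration by parts against the modes: one factor `c` per derivative -/

section ModeReduction

variable {H g : ℝ} {ρeq : ℝ → ℝ} {b N : ℝ} {c : ℝ} {f : ℝ → ℝ} {D : ℕ → ℝ → ℂ}

/-- By the eigenvalue equation `ρ_eq N² f = -c² (ρ_eq f')'`. One of the two powers of `c` is kept in
the profile `c ρ_eq f'`. -/
theorem IsJet.integral_profW_eq (hB : IsBackground H g ρeq b N) (hf : IsMode H ρeq N c f)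
    (hD : IsJet H 1 D) (h0 : VanishesAtEnds (-H) 0 (D 0)) :
    ∫ z in Ioo (-H) 0, D 0 z * profW ρeq N f z =
      c * ∫ z in Ioo (-H) 0, D 1 z * profV ρeq c f z := by
  have key := (hD.2 0 one_pos).integral_flux_eq hB hf (hD.1 0 (by omega)) (hD.1 1 le_rfl) h0
  have hc : (c : ℂ) ≠ 0 := by exact_mod_cast hf.speed_pos.ne'
  obtain ⟨K, hK⟩ := hf.bounded
  have bdd : ∀ (p : ℝ → ℂ) (h : ℝ → ℝ), IntegrableOn p (Ioo (-H) 0) → ContinuousOn h (Ioo (-H) 0) →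
      (∀ z ∈ Ioo (-H) 0, |h z| ≤ K) → IntegrableOn (fun z => p z * (h z : ℂ)) (Ioo (-H) 0) :=
    fun p h ip ch hh => Integrable.mul_bdd (c := K) ip
      ((Complex.continuous_ofReal.comp_continuousOn ch).aestronglyMeasurable measurableSet_Ioo) (by
        filter_upwards [ae_restrict_mem measurableSet_Ioo] with z hz
        rw [Complex.norm_real]
        exact hh z hz)
  have i1 := bdd (D 0) (fun z => -(N ^ 2 / c ^ 2 * (ρeq z * f z))) (hD.1 0 (by omega))
    (continuousOn_const.mul (hB.continuousOn_Ioo.mul hf.continuousOn)).neg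
    (fun z hz => by rw [abs_neg]; exact (hK z hz).2.2.2)
  have i2 := bdd (D 1) (fun z => ρeq z * deriv f z) (hD.1 1 le_rfl)
    (hB.continuousOn_Ioo.mul hf.continuousOn_deriv) (fun z hz => (hK z hz).2.2.1)
  rw [integral_add i1 i2] at key
  have e1 : ∫ z in Ioo (-H) 0, D 0 z * profW ρeq N f z = -(c : ℂ) ^ 2 *
      ∫ z in Ioo (-H) 0, D 0 z * ((-(N ^ 2 / c ^ 2 * (ρeq z * f z)) : ℝ) : ℂ) := by
    rw [← integral_const_mul]
    refine integral_congr_ae (ae_of_all _ fun z => ?_)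
    simp only [profW]
    push_cast
    field_simp
  have e2 : ∫ z in Ioo (-H) 0, D 1 z * profV ρeq c f z = (c : ℂ) *
      ∫ z in Ioo (-H) 0, D 1 z * ((ρeq z * deriv f z : ℝ) : ℂ) := by
    rw [← integral_const_mul]
    refine integral_congr_ae (ae_of_all _ fun z => ?_)
    simp only [profV]
    push_cast
    ring
  rw [e1, e2]
  linear_combination (-(c : ℂ) ^ 2) * key

/-- Here `f'` is integrated, so no end condition on the data is needed; `ρ_eq` goes with the data,
and being exponential it turns `∂` into `∂ - b`. -/
theorem IsJet.integral_profV_eq (hB : IsBackground H g ρeq b N) (hf : IsMode H ρeq N c f)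
    (hD : IsJet H 1 D) :
    ∫ z in Ioo (-H) 0, D 0 z * profV ρeq c f z =
      -((c : ℂ) / (N : ℂ) ^ 2) * ∫ z in Ioo (-H) 0, shiftOp (-b) D 0 z * profW ρeq N f z := by
  obtain ⟨ρ0, hρ0, hρ⟩ := hB.exists_eq_exp
  have i0 := hD.1 0 (by omega)
  have i1 := hD.1 1 le_rfl
  have i2 : IntegrableOn (fun z => D 1 z + ((-b : ℝ) : ℂ) * D 0 z) (Ioo (-H) 0) :=
    i1.add (i0.const_mul _)
  have hw := (hD.2 0 one_pos).exp_mul i0 i1 ρ0 (-b)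
  have key := hw.integral_mode_eq hB.depth_pos hf (integrableOn_exp_mul i0 ρ0 (-b))
    (integrableOn_exp_mul i2 ρ0 (-b))
  have hc : (c : ℂ) ≠ 0 := by exact_mod_cast hf.speed_pos.ne'
  have hN : (N : ℂ) ≠ 0 := by exact_mod_cast hB.freq_pos.ne'
  obtain ⟨K, hK⟩ := hf.bounded
  have bdd : ∀ (p : ℝ → ℂ) (h : ℝ → ℝ), IntegrableOn p (Ioo (-H) 0) → ContinuousOn h (Ioo (-H) 0) →
      (∀ z ∈ Ioo (-H) 0, |h z| ≤ K) → IntegrableOn (fun z => p z * (h z : ℂ)) (Ioo (-H) 0) :=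
    fun p h ip ch hh => Integrable.mul_bdd (c := K) ip
      ((Complex.continuous_ofReal.comp_continuousOn ch).aestronglyMeasurable measurableSet_Ioo) (by
        filter_upwards [ae_restrict_mem measurableSet_Ioo] with z hz
        rw [Complex.norm_real]
        exact hh z hz)
  have j1 := bdd _ (deriv f) (integrableOn_exp_mul i0 ρ0 (-b)) hf.continuousOn_deriv
    (fun z hz => (hK z hz).2.1)
  have j2 := bdd _ f (integrableOn_exp_mul i2 ρ0 (-b))
    hf.continuousOn (fun z hz => (hK z hz).1)
  have e1 : ∫ z in Ioo (-H) 0, D 0 z * profV ρeq c f z = (c : ℂ) *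
      ∫ z in Ioo (-H) 0, ((ρ0 * Real.exp (-b * z) : ℝ) : ℂ) * D 0 z * ((deriv f z : ℝ) : ℂ) := by
    rw [← integral_const_mul]
    refine setIntegral_congr_fun measurableSet_Ioo fun z hz => ?_
    simp only [profV, hρ z hz, neg_mul]
    push_cast
    ring
  have e2 : ∫ z in Ioo (-H) 0, shiftOp (-b) D 0 z * profW ρeq N f z = (N : ℂ) ^ 2 *
      ∫ z in Ioo (-H) 0, ((ρ0 * Real.exp (-b * z) : ℝ) : ℂ) *
        (D 1 z + ((-b : ℝ) : ℂ) * D 0 z) * (f z : ℂ) := by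
    rw [← integral_const_mul]
    refine setIntegral_congr_fun measurableSet_Ioo fun z hz => ?_
    simp only [profW, shiftOp, hρ z hz, neg_mul]
    push_cast
    ring
  rw [e1, e2, eq_neg_of_add_eq_zero_left ((integral_add j1 j2).symm.trans key), ← mul_assoc,
    neg_mul, div_mul_cancel₀ _ (pow_ne_zero 2 hN), mul_neg, neg_mul]

/-- Two consecutive passages apply `∂(∂ - b)` and return to the same profile. Only the first of the
two asks for vanishing at the ends, whence one condition for each power below `l`. -/
theorem IsJet.integral_profW_eq_opL (hB : IsBackground H g ρeq b N) (hf : IsMode H ρeq N c f)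
    (l : ℕ) {D : ℕ → ℝ → ℂ} (hD : IsJet H (2 * l) D)
    (h0 : ∀ i < l, VanishesAtEnds (-H) 0 (((opL (-b))^[i] D) 0)) :
    ∫ z in Ioo (-H) 0, D 0 z * profW ρeq N f z =
      (-((c : ℂ) ^ 2 / (N : ℂ) ^ 2)) ^ l *
        ∫ z in Ioo (-H) 0, ((opL (-b))^[l] D) 0 z * profW ρeq N f z := by
  induction l generalizing D with
  | zero => simp
  | succ l ih =>
    have h1 := IsJet.integral_profW_eq hB hf (hD.mono (by omega)) (h0 0 (by omega))
    have h2 := (IsJet.tail (hD.mono (by omega : 1 + 1 ≤ 2 * (l + 1)))).integral_profV_eq hB hf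
    have h3 := ih (D := opL (-b) D) (IsJet.jet_opL (m := 2 * l) (by convert! hD using 1) _)
      (fun i hi => by
        have := h0 (i + 1) (by omega)
        rwa [Function.iterate_succ_apply] at this)
    rw [Function.iterate_succ_apply, h1, h2,
      show shiftOp (-b : ℂ) (fun j => D (j + 1)) = opL (-b) D from rfl, h3]
    ring

/-- An odd order needs one more passage from the first profile, and therefore also the condition at
`i = l`. -/
theorem IsJet.integral_profW_eq_opL_succ (hB : IsBackground H g ρeq b N)
    (hf : IsMode H ρeq N c f) (l : ℕ) (hD : IsJet H (2 * l + 1) D)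
    (h0 : ∀ i ≤ l, VanishesAtEnds (-H) 0 (((opL (-b))^[i] D) 0)) :
    ∫ z in Ioo (-H) 0, D 0 z * profW ρeq N f z =
      (-((c : ℂ) ^ 2 / (N : ℂ) ^ 2)) ^ l * c *
        ∫ z in Ioo (-H) 0, ((opL (-b))^[l] D) 1 z * profV ρeq c f z := by
  rw [IsJet.integral_profW_eq_opL hB hf l (hD.mono (by omega)) (fun i hi => h0 i hi.le),
    (IsJet.jet_opL_iterate (-b : ℂ) l (m := 1) (by convert! hD using 1; ring)).integral_profW_eq hB hf
      (h0 l le_rfl), mul_assoc]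

end ModeReduction

/-! ### From traces of classical representatives to weak jets -/

section ClassicalJets

variable {H : ℝ}

/-- `E 0, …, E m` are continuous on `(-H, 0)` and are successive derivatives. -/
structure IsClassicalJet (H : ℝ) (m : ℕ) (E : ℕ → ℝ → ℂ) : Prop where
  continuousOn : ∀ j ≤ m, ContinuousOn (E j) (Ioo (-H) 0)
  hasDerivAt : ∀ j < m, ∀ z ∈ Ioo (-H) 0, HasDerivAt (E j) (E (j + 1) z) z

theorem isClassicalJet_of_contDiffOn {m : ℕ} {F : ℝ → ℂ} (hF : ContDiffOn ℝ m F (Ioo (-H) 0)) :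
    IsClassicalJet H m (fun j => iteratedDerivWithin j F (Ioo (-H) 0)) where
  continuousOn j hj := hF.continuousOn_iteratedDerivWithin (by exact_mod_cast hj)
    isOpen_Ioo.uniqueDiffOn
  hasDerivAt j hj z hz := by
    have h := (hF.differentiableOn_iteratedDerivWithin (by exact_mod_cast hj)
      isOpen_Ioo.uniqueDiffOn) z hz
    have := h.hasDerivWithinAt
    rw [iteratedDerivWithin_succ]
    exact this.hasDerivAt (isOpen_Ioo.mem_nhds hz)

theorem IsClassicalJet.jet_opL {m : ℕ} {E : ℕ → ℝ → ℂ} (h : IsClassicalJet H (m + 2) E) (a : ℂ) :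
    IsClassicalJet H m (opL a E) where
  continuousOn j hj := (h.1 (j + 2) (by omega)).add (continuousOn_const.mul (h.1 (j + 1) (by omega)))
  hasDerivAt j hj z hz :=
    (h.2 (j + 2) (by omega) z hz).add ((h.2 (j + 1) (by omega) z hz).const_mul a)

/-- No integrability of `p` and `q` up to the ends is available; the products with a test function
are continuous and compactly supported, and their derivative has zero integral. -/
theorem integral_mul_deriv_test {p q : ℝ → ℂ} (hp : ContinuousOn p (Ioo (-H) 0))
    (hq : ContinuousOn q (Ioo (-H) 0)) (h : ∀ z ∈ Ioo (-H) 0, HasDerivAt p (q z) z) :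
    IsWeakDeriv (-H) 0 p q := by
  intro ψ hψ
  have hcomp : ∀ {r : ℝ → ℂ}, ContinuousOn r (Ioo (-H) 0) → ∀ {η : ℝ → ℝ},
      IsTestFunction (Ioo (-H) 0) η → Continuous (fun z => r z * (η z : ℂ)) := by
    intro r hr η hη
    have hη' : Continuous fun z => (η z : ℂ) := Complex.continuous_ofReal.comp hη.1.continuous
    have hts : tsupport (fun z => r z * (η z : ℂ)) ⊆ tsupport η := by
      refine closure_mono fun z hz => ?_
      rw [Function.mem_support] at hz ⊢
      exact fun h0 => hz (by simp [h0])
    refine continuous_of_tsupport fun z hz => ?_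
    exact ((hr.continuousAt (isOpen_Ioo.mem_nhds (hη.2.2 (hts hz)))).mul hη'.continuousAt)
  have hsupp : ∀ {r : ℝ → ℂ} {η : ℝ → ℝ}, IsTestFunction (Ioo (-H) 0) η →
      HasCompactSupport (fun z => r z * (η z : ℂ)) := fun {r η} hη =>
    (hη.2.1.comp_left (g := fun x : ℝ => (x : ℂ)) rfl).mul_left
  have i1 : Integrable (fun z => p z * ((deriv ψ z : ℝ) : ℂ)) volume :=
    (hcomp hp hψ.deriv).integrable_of_hasCompactSupport (hsupp hψ.deriv)
  have i2 : Integrable (fun z => q z * (ψ z : ℂ)) volume :=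
    (hcomp hq hψ).integrable_of_hasCompactSupport (hsupp hψ)
  have i3 : Integrable (fun z => p z * (ψ z : ℂ)) volume :=
    (hcomp hp hψ).integrable_of_hasCompactSupport (hsupp hψ)
  have hψd : ∀ z, HasDerivAt (fun z => (ψ z : ℂ)) ((deriv ψ z : ℝ) : ℂ) z := fun z =>
    ((hψ.1.differentiable (by simp)) z).hasDerivAt.ofReal_comp
  have hd : ∀ z, HasDerivAt (fun z => p z * (ψ z : ℂ))
      (q z * (ψ z : ℂ) + p z * ((deriv ψ z : ℝ) : ℂ)) z := by
    intro z
    by_cases hz : z ∈ tsupport ψ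
    · exact (h z (hψ.2.2 hz)).mul (hψd z)
    · have e0 : ψ =ᶠ[𝓝 z] 0 := notMem_tsupport_iff_eventuallyEq.1 hz
      have e1 : (fun z => p z * (ψ z : ℂ)) =ᶠ[𝓝 z] fun _ => 0 := by
        filter_upwards [e0] with y hy
        simp [hy]
      have e2 : deriv ψ z = 0 := by
        rw [e0.deriv_eq]
        simp
      rw [e0.eq_of_nhds, e2]
      simpa using (hasDerivAt_const z (0 : ℂ)).congr_of_eventuallyEq e1
  have key := integral_eq_zero_of_hasDerivAt_of_integrable hd (i2.add i1) i3
  rw [integral_add i2 i1] at key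
  have out : ∀ (r : ℝ → ℂ) {η : ℝ → ℝ}, IsTestFunction (Ioo (-H) 0) η →
      ∫ z in Ioo (-H) 0, r z * (η z : ℂ) = ∫ z, r z * (η z : ℂ) := fun r η hη =>
    setIntegral_eq_integral_of_forall_compl_eq_zero fun z hz => by
      have : η z = 0 := by
        by_contra h0
        exact hz (hη.2.2 (subset_tsupport _ h0))
      simp [this]
  rw [out p hψ.deriv, out q hψ]
  linear_combination key

theorem ae_eq_of_continuousOn_of_forall_test {p q : ℝ → ℂ} (hp : ContinuousOn p (Ioo (-H) 0))
    (hq : IntegrableOn q (Ioo (-H) 0))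
    (h : ∀ ψ, IsTestFunction (Ioo (-H) 0) ψ → ∫ z in Ioo (-H) 0, p z * (ψ z : ℂ) =
      ∫ z in Ioo (-H) 0, q z * (ψ z : ℂ)) : p =ᵐ[volume.restrict (Ioo (-H) 0)] q := by
  have hl : LocallyIntegrableOn (fun z => p z - q z) (Ioo (-H) 0) volume :=
    (hp.locallyIntegrableOn measurableSet_Ioo).sub hq.locallyIntegrableOn
  have := isOpen_Ioo.ae_eq_zero_of_integral_contDiff_smul_eq_zero (μ := volume) hl
    (fun ψ h1 h2 h3 => by
      have hψ : IsTestFunction (Ioo (-H) 0) ψ := ⟨h1, h2, h3⟩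
      have ip : IntegrableOn (fun z => p z * (ψ z : ℂ)) (Ioo (-H) 0) := by
        have hc : ContinuousOn (fun z => p z * (ψ z : ℂ)) (tsupport ψ) :=
          (hp.mono h3).mul (Complex.continuous_ofReal.comp hψ.1.continuous).continuousOn
        have := hc.integrableOn_compact (μ := volume) h2
        exact ((integrableOn_iff_integrable_of_support_subset fun z hz =>
          subset_tsupport _ fun h0 => hz (by simp [h0])).1 this).integrableOn
      rw [← setIntegral_eq_integral_of_forall_compl_eq_zero (s := Ioo (-H) 0) fun z hz => by
        rw [image_eq_zero_of_notMem_tsupport fun h => hz (h3 h), zero_smul]]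
      have : ∫ z in Ioo (-H) 0, (p z * (ψ z : ℂ) - q z * (ψ z : ℂ)) = 0 := by
        rw [integral_sub ip (hψ.integrable_mul hq), h ψ hψ, sub_self]
      rw [← this]
      refine integral_congr_ae (ae_of_all _ fun z => ?_)
      simp only [Complex.real_smul]
      ring)
  rw [Filter.EventuallyEq, ae_restrict_iff' measurableSet_Ioo]
  filter_upwards [this] with z hz hz'
  exact sub_eq_zero.1 (hz hz')

/-- A classical jet and a weak jet with the same first term agree almost everywhere. -/
theorem IsClassicalJet.ae_eq {m m' : ℕ} {E D : ℕ → ℝ → ℂ} (hE : IsClassicalJet H m E)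
    (hD : IsJet H m' D) (hm : m ≤ m') (h : E 0 =ᵐ[volume.restrict (Ioo (-H) 0)] D 0) :
    ∀ j ≤ m, E j =ᵐ[volume.restrict (Ioo (-H) 0)] D j := by
  intro j
  induction j with
  | zero => exact fun _ => h
  | succ j ih =>
    intro hj
    refine ae_eq_of_continuousOn_of_forall_test (hE.1 _ hj) (hD.1 _ (by omega)) fun ψ hψ =>
      neg_injective ?_
    rw [← hD.2 j (by omega) ψ hψ, ← integral_mul_deriv_test (hE.1 j (by omega)) (hE.1 _ hj)
      (hE.2 j (by omega)) ψ hψ]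
    refine integral_congr_ae ?_
    filter_upwards [ih (by omega)] with z hz
    rw [hz]

/-- On classical jets, `T` acts as `κ₀ ∂ (∂ + a)`. -/
def ActsAsOpL (H : ℝ) (T : (ℝ → ℂ) → ℝ → ℂ) (κ₀ a : ℂ) : Prop :=
  ∀ (E : ℕ → ℝ → ℂ) (F : ℝ → ℂ) (κ : ℂ), IsClassicalJet H 2 E →
    (∀ z ∈ Ioo (-H) 0, F z = κ * E 0 z) → ∀ z ∈ Ioo (-H) 0, T F z = κ * κ₀ * opL a E 0 z

theorem ActsAsOpL.iterate {T : (ℝ → ℂ) → ℝ → ℂ} {κ₀ a : ℂ} (hT : ActsAsOpL H T κ₀ a) (l : ℕ) :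
    ∀ (E : ℕ → ℝ → ℂ) (F : ℝ → ℂ) (κ : ℂ), IsClassicalJet H (2 * l) E →
      (∀ z ∈ Ioo (-H) 0, F z = κ * E 0 z) →
        ∀ z ∈ Ioo (-H) 0, T^[l] F z = κ * κ₀ ^ l * ((opL a)^[l] E) 0 z := by
  induction l with
  | zero => intro E F κ _ h z hz; simpa using h z hz
  | succ l ih =>
    intro E F κ hE h z hz
    have h2 : IsClassicalJet H 2 E := ⟨fun j hj => hE.1 j (by omega), fun j hj => hE.2 j (by omega)⟩
    rw [Function.iterate_succ_apply, Function.iterate_succ_apply,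
      ih (opL a E) (T F) (κ * κ₀) (IsClassicalJet.jet_opL (m := 2 * l) (by convert! hE using 1) a)
        (hT E F κ h2 h) z hz]
    ring

theorem IsClassicalJet.jet_opL_iterate {m : ℕ} (a : ℂ) (l : ℕ) {E : ℕ → ℝ → ℂ}
    (h : IsClassicalJet H (m + 2 * l) E) :
    IsClassicalJet H m ((opL a)^[l] E) := by
  induction l generalizing E with
  | zero => exact h
  | succ l ih => exact ih (IsClassicalJet.jet_opL (m := m + 2 * l) (by convert! h using 1) a)

variable {g : ℝ} {ρeq : ℝ → ℝ} {b N : ℝ}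

/-- Because `ρ_eq' = -b ρ_eq`, one has `(ρ_eq F')' = ρ_eq (F'' - b F')`, and the prefactor is `1 /
(b ρ_eq)`. -/
theorem actsAsOpL_opT₂Star (hB : IsBackground H g ρeq b N) :
    ActsAsOpL H (opT₂Star ρeq) (1 / (b : ℂ)) (-b : ℂ) := by
  intro E F κ hE hF z hz
  have hρC : ∀ y ∈ Ioo (-H) 0, HasDerivAt (fun y => (ρeq y : ℂ)) (-(b * ρeq y) : ℂ) y :=
    fun y hy => by
      have := (hB.hasDerivAt y hy).ofReal_comp
      convert! this using 1
      push_cast; ring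
  have hF' : ∀ y ∈ Ioo (-H) 0, deriv F y = κ * E 1 y := fun y hy => by
    have e : F =ᶠ[𝓝 y] fun y => κ * E 0 y := by
      filter_upwards [isOpen_Ioo.mem_nhds hy] with x hx using hF x hx
    rw [e.deriv_eq]
    exact ((hE.2 0 (by omega) y hy).const_mul κ).deriv
  have e2 : (fun y => ρeq y • deriv F y) =ᶠ[𝓝 z] fun y => (ρeq y : ℂ) * (κ * E 1 y) := by
    filter_upwards [isOpen_Ioo.mem_nhds hz] with x hx
    rw [hF' x hx, Complex.real_smul]
  have hp : (ρeq z : ℂ) ≠ 0 := by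
    exact_mod_cast (hB.density_pos z (Ioo_subset_Icc_self hz)).ne'
  have hb : (b : ℂ) ≠ 0 := by exact_mod_cast hB.rate_pos.ne'
  have e3 : HasDerivAt (fun y => (ρeq y : ℂ) * (κ * E 1 y))
      (-(b * ρeq z) * (κ * E 1 z) + ρeq z * (κ * E 2 z)) z :=
    (hρC z hz).mul ((hE.2 1 (by omega) z hz).const_mul κ)
  rw [opT₂Star, e2.deriv_eq, e3.deriv,
    (hB.hasDerivAt z hz).deriv, Complex.real_smul, opL]
  push_cast
  field_simp
  ring

/-- Because `ρ_eq' = -b ρ_eq`, one has `ρ_eq (F / (b ρ_eq))' = b⁻¹ (F' + b F)`. -/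
theorem actsAsOpL_opT₂ (hB : IsBackground H g ρeq b N) :
    ActsAsOpL H (opT₂ ρeq) (1 / (b : ℂ)) (b : ℂ) := by
  intro E F κ hE hF z hz
  have hb : (b : ℂ) ≠ 0 := by exact_mod_cast hB.rate_pos.ne'
  have hp : ∀ y ∈ Ioo (-H) 0, (ρeq y : ℂ) ≠ 0 := fun y hy => by
    exact_mod_cast (hB.density_pos y (Ioo_subset_Icc_self hy)).ne'
  have hρC : ∀ y ∈ Ioo (-H) 0, HasDerivAt (fun y => (ρeq y : ℂ)) (-(b * ρeq y) : ℂ) y :=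
    fun y hy => by
      have := (hB.hasDerivAt y hy).ofReal_comp
      convert! this using 1
      push_cast; ring
  have hF' : ∀ y ∈ Ioo (-H) 0, deriv (fun x => (1 / (-deriv ρeq x)) • F x) y =
      κ * (1 / (b * ρeq y : ℂ)) * (E 1 y + b * E 0 y) := fun y hy => by
    have e : (fun x => (1 / (-deriv ρeq x)) • F x) =ᶠ[𝓝 y]
        fun x => (κ / b) * (E 0 x / (ρeq x : ℂ)) := by
      filter_upwards [isOpen_Ioo.mem_nhds hy] with x hx
      have := hp x hx
      rw [hF x hx, (hB.hasDerivAt x hx).deriv, Complex.real_smul]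
      push_cast
      field_simp
    have := hp y hy
    have e3 : HasDerivAt (fun x => (κ / b) * (E 0 x / (ρeq x : ℂ)))
        ((κ / b) * ((E 1 y * ρeq y - E 0 y * -(b * ρeq y)) / (ρeq y : ℂ) ^ 2)) y :=
      ((hE.2 0 (by omega) y hy).div (hρC y hy) (hp y hy)).const_mul _
    rw [e.deriv_eq, e3.deriv]
    field_simp
    ring
  have e2 : (fun y => ρeq y • deriv (fun x => (1 / (-deriv ρeq x)) • F x) y) =ᶠ[𝓝 z]
      fun y => κ * (1 / (b : ℂ)) * (E 1 y + b * E 0 y) := by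
    filter_upwards [isOpen_Ioo.mem_nhds hz] with x hx
    have := hp x hx
    rw [hF' x hx, Complex.real_smul]
    field_simp
  have e3 : HasDerivAt (fun y => κ * (1 / (b : ℂ)) * (E 1 y + b * E 0 y))
      (κ * (1 / (b : ℂ)) * (E 2 z + b * E 1 z)) z :=
    ((hE.2 1 (by omega) z hz).add ((hE.2 0 (by omega) z hz).const_mul (b : ℂ))).const_mul _
  rw [opT₂, e2.deriv_eq, e3.deriv, opL]

/-- From vanishing traces of `T^l u` to the vanishing of the corresponding term of a weak jet. -/
theorem vanishesAtEnds_of_hasZeroTrace {d : ℕ} {T : (ℝ → ℂ) → ℝ → ℂ} {κ₀ a : ℂ} (hneg : -H < 0)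
    (hκ : κ₀ ≠ 0)
    (hT : ActsAsOpL H T κ₀ a) {l m : ℕ} (hl : 2 * l ≤ m) {u : Horiz d × ℝ → ℝ}
    (hu : HasZeroTrace H (2 * l) (T^[l]) u) (χ : 𝓢(Horiz d, ℂ)) {D : ℕ → ℝ → ℂ} (hD : IsJet H m D)
    (h0 : slice (fun p => (u p : ℂ)) χ =ᵐ[volume.restrict (Ioo (-H) 0)] D 0) :
    VanishesAtEnds (-H) 0 (((opL a)^[l] D) 0) := by
  obtain ⟨F, h1, h2, h3, h4⟩ := hu χ
  have hE := isClassicalJet_of_contDiffOn (m := 2 * l) (by exact_mod_cast h1)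
  set E := fun j => iteratedDerivWithin j F (Ioo (-H) 0)
  have hE0 : E 0 = F := by simp [E]
  -- The representative in the trace condition is classical, while integration by parts uses the
  -- weak jet; their derivatives agree almost everywhere, so the traces carry over.
  have hED := hE.ae_eq hD hl (by rw [hE0]; exact EventuallyEq.trans h2 h0)
  have hTF := hT.iterate l E F 1 hE fun z _ => by rw [hE0, one_mul]
  have hev : ∀ z ∈ Ioo (-H) 0, ((opL a)^[l] E) 0 z = (κ₀ ^ l)⁻¹ * T^[l] F z := fun z hz => by
    rw [hTF z hz, one_mul, inv_mul_cancel_left₀ (pow_ne_zero l hκ)]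
  refine ⟨((opL a)^[l] E) 0, (IsClassicalJet.jet_opL_iterate (m := 0) a l (by convert! hE using 1; ring)).1 0 le_rfl
    , ?_, ?_, ?_⟩
  · exact (opL_iterate_ae_eq a l 0 (fun j hj => (hED j (by omega)).symm)) 0 le_rfl
  · have : Tendsto (fun z => (κ₀ ^ l)⁻¹ * T^[l] F z) (𝓝[>] (-H)) (𝓝 0) := by
      simpa using h3.const_mul (κ₀ ^ l)⁻¹
    refine this.congr' ?_
    filter_upwards [Ioo_mem_nhdsGT hneg] with z hz using (hev z hz).symm
  · have : Tendsto (fun z => (κ₀ ^ l)⁻¹ * T^[l] F z) (𝓝[<] 0) (𝓝 0) := by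
      simpa using h4.const_mul (κ₀ ^ l)⁻¹
    refine this.congr' ?_
    filter_upwards [Ioo_mem_nhdsLT hneg] with z hz using (hev z hz).symm

end ClassicalJets

/-! ### Summation over the modes -/

section Tail

open scoped FourierTransform LineDeriv

variable {d : ℕ} {H s : ℝ}

theorem exists_br_hat (r : ℝ) (y : StripL2 d H) {h : ℝ → ℂ}
    (hh : MemLp h 2 (volume.restrict (Ioo (-H) 0))) :
    ∃ m : HorizL2 d,
      (∫⁻ ξ, ‖m ξ‖ₑ ^ 2 = ∫⁻ X, ‖∫ z in Ioo (-H) 0, y (X, z) * h z‖ₑ ^ 2) ∧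
      ∀ φ : 𝓢(Horiz d, ℂ), br r y (𝓕⁻ φ) h = ∫ ξ, m ξ * symbolMul (-r) φ ξ := by
  have hm := memLp_profile (d := d) (Lp.memLp y) hh
  refine ⟨𝓕⁻ hm.toLp, ?_, fun φ => ?_⟩
  · have e : ‖(𝓕⁻ hm.toLp : HorizL2 d)‖ = ‖hm.toLp‖ := by
      rw [← Lp.norm_fourier_eq, FourierTransform.fourier_fourierInv_eq]
    rw [← eLpNorm_two_sq, ← Lp.enorm_def, ← ofReal_norm, e, ofReal_norm, Lp.enorm_toLp,
      eLpNorm_two_sq]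
  · rw [br, strip_integral_eq_left (Lp.memLp y) _ hh, lambdaPow_fourierInv, ← integral_mul_fourierInv]
    refine integral_congr_ae ?_
    filter_upwards [hm.coeFn_toLp] with X hX
    rw [hX]

/-- Multiplication by the symbol of the Laplacian. -/
def lapMul (φ : 𝓢(Horiz d, ℂ)) : 𝓢(Horiz d, ℂ) := ∑ i, dirMul i (dirMul i φ)

theorem lapMul_apply (φ : 𝓢(Horiz d, ℂ)) (ξ : Horiz d) :
    lapMul φ ξ = -(lapSymbol ξ : ℂ) * φ ξ := by
  rw [lapMul, sum_apply, ← sum_dirSymbol_sq, Finset.sum_mul]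
  refine Finset.sum_congr rfl fun i _ => ?_
  rw [dirMul_eq, dirMul_eq]
  ring

theorem norm_sum_sq_le (m : ℕ) (x : ℕ → ℂ) :
    ‖∑ j ∈ Finset.range m, x j‖ ^ 2 ≤ m * ∑ j ∈ Finset.range m, ‖x j‖ ^ 2 := by
  have h1 := norm_sum_le (Finset.range m) x
  calc _ ≤ (∑ j ∈ Finset.range m, ‖x j‖) ^ 2 := pow_le_pow_left₀ (norm_nonneg _) h1 2
    _ ≤ _ := by
      have := sq_sum_le_card_mul_sum_sq (s := Finset.range m) (f := fun j => ‖x j‖)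
      simpa using this

/-- If the modal coefficients are `c_n^m` times the coefficients, in a Bessel family, of
derivatives of order at most `m`, then their weighted Sobolev norms are summable. -/
theorem tsum_weighted_lt_top (hd : d ≠ 0) {c : ℕ+ → ℝ} (hc : ∀ n, 0 < c n) {h : ℕ+ → ℝ → ℂ}
    (hh : IsBesselFamily (volume.restrict (Ioo (-H) 0)) h) (m : ℕ) (y : ℕ → StripL2 d H)
    (a : ℕ → ℂ) {U : ℕ+ → HorizL2 d}
    (hU : ∀ n (φ : 𝓢(Horiz d, ℂ)), ∫ ξ, U n ξ * lapMul φ ξ = (c n : ℂ) ^ m *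
      ∑ j ∈ Finset.range (m + 1), a j * br (s - j) (y j) (𝓕⁻ (lapMul φ)) (h n)) :
    ∑' n, ENNReal.ofReal (1 / c n ^ (2 * m)) *
      ∫⁻ ξ, ENNReal.ofReal (lambdaSymbol d (s - m) ξ) ^ 2 * ‖U n ξ‖ₑ ^ 2 < ⊤ := by
  choose M hM1 hM2 using fun n j => exists_br_hat (s - (j : ℕ)) (y j) (hh.1 n)
  have hUe : ∀ n, ∀ᵐ ξ, U n ξ = (c n : ℂ) ^ m * ∑ j ∈ Finset.range (m + 1),
      a j * ((lambdaSymbol d (-(s - j)) ξ : ℂ) * M n j ξ) := by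
    intro n
    have icM : ∀ (φ : 𝓢(Horiz d, ℂ)) j, Integrable (fun ξ =>
        a j * (M n j ξ * symbolMul (-(s - j)) (lapMul φ) ξ)) := fun φ j =>
      (integrable_L2_mul_schwartz _ _).const_mul _
    have eG : ∀ (φ : 𝓢(Horiz d, ℂ)) ξ, ((c n : ℂ) ^ m * ∑ j ∈ Finset.range (m + 1),
        (a j * (-(lapSymbol ξ : ℂ) * (lambdaSymbol d (-(s - j)) ξ : ℂ))) * M n j ξ) * φ ξ =
        (c n : ℂ) ^ m * ∑ j ∈ Finset.range (m + 1),
          a j * (M n j ξ * symbolMul (-(s - j)) (lapMul φ) ξ) := fun φ ξ => by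
      rw [mul_assoc, Finset.sum_mul]
      congr 1
      refine Finset.sum_congr rfl fun j _ => ?_
      rw [symbolMul_apply, lapMul_apply]
      ring
    have eF : ∀ (φ : 𝓢(Horiz d, ℂ)) ξ, -(lapSymbol ξ : ℂ) * U n ξ * φ ξ =
        U n ξ * lapMul φ ξ := fun φ ξ => by
      rw [lapMul_apply]
      ring
    have clap : Continuous fun ξ : Horiz d => -(lapSymbol ξ : ℂ) :=
      (Complex.continuous_ofReal.comp continuous_lapSymbol).neg
    -- The hypothesis concerns only tests multiplied by the symbol of the Laplacian, which is all
    -- that the velocity can offer. It identifies `κ U`, and `κ` is then divided out away from `ξ =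
    -- 0`.
    have key : (fun ξ => -(lapSymbol ξ : ℂ) * U n ξ) =ᵐ[volume]
        fun ξ => (c n : ℂ) ^ m * ∑ j ∈ Finset.range (m + 1),
          (a j * (-(lapSymbol ξ : ℂ) * (lambdaSymbol d (-(s - j)) ξ : ℂ))) * M n j ξ := by
      refine ae_eq_of_forall_schwartz (locallyIntegrable_mul_L2 _ clap) ?_ (fun φ => ?_)
        (fun φ => ?_) fun φ => ?_
      · have : LocallyIntegrable (fun ξ => ∑ j ∈ Finset.range (m + 1),
            ((c n : ℂ) ^ m * (a j * (-(lapSymbol ξ : ℂ) *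
              (lambdaSymbol d (-(s - j)) ξ : ℂ)))) * M n j ξ) volume :=
          locallyIntegrable_finsetSum _ fun j _ => locallyIntegrable_mul_L2 _
            (continuous_const.mul (continuous_const.mul (clap.mul
              (Complex.continuous_ofReal.comp (continuous_lambdaSymbol _)))))
        convert! this using 2 with ξ
        rw [Finset.mul_sum]
        exact Finset.sum_congr rfl fun j _ => by ring
      · simp_rw [eF]
        exact integrable_L2_mul_schwartz _ _
      · simp_rw [eG]
        exact (integrable_finsetSum _ fun j _ => icM φ j).const_mul _
      · simp_rw [eF, eG]
        rw [integral_const_mul, integral_finsetSum _ fun j _ => icM φ j, hU]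
        congr 1
        refine Finset.sum_congr rfl fun j _ => ?_
        rw [integral_const_mul, hM2]
    filter_upwards [key, ae_lapSymbol_ne_zero hd] with ξ h1 h2
    have h2' : -(lapSymbol ξ : ℂ) ≠ 0 := neg_ne_zero.2 (by exact_mod_cast h2)
    refine mul_left_cancel₀ h2' (h1.trans ?_)
    rw [Finset.mul_sum, Finset.mul_sum, Finset.mul_sum]
    exact Finset.sum_congr rfl fun j _ => by ring
  -- The orders match: the weight of order `s - m` times the factor of order `-(s - j)` has order `j
  -- - m ≤ 0`, so it is at most `1`.
  have hpt : ∀ n, ∀ᵐ ξ, ENNReal.ofReal (lambdaSymbol d (s - m) ξ) ^ 2 * ‖U n ξ‖ₑ ^ 2 ≤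
      ∑ j ∈ Finset.range (m + 1), ENNReal.ofReal (c n ^ (2 * m) * ((m + 1 : ℕ) * ‖a j‖ ^ 2)) *
        ‖M n j ξ‖ₑ ^ 2 := by
    intro n
    filter_upwards [hUe n] with ξ hξ
    have hle : lambdaSymbol d (s - m) ξ ^ 2 * ‖U n ξ‖ ^ 2 ≤
        ∑ j ∈ Finset.range (m + 1), (c n ^ (2 * m) * ((m + 1 : ℕ) * ‖a j‖ ^ 2)) * ‖M n j ξ‖ ^ 2 := by
      have e : lambdaSymbol d (s - m) ξ ^ 2 * ‖U n ξ‖ ^ 2 =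
          c n ^ (2 * m) * ‖∑ j ∈ Finset.range (m + 1),
            a j * ((lambdaSymbol d (j - m) ξ : ℂ) * M n j ξ)‖ ^ 2 := by
        rw [← abs_of_pos (lambdaSymbol_pos (d := d) (s - m) ξ), ← Real.norm_eq_abs,
          ← Complex.norm_real, ← mul_pow, ← norm_mul, hξ]
        have : (lambdaSymbol d (s - m) ξ : ℂ) * ((c n : ℂ) ^ m * ∑ j ∈ Finset.range (m + 1),
            a j * ((lambdaSymbol d (-(s - j)) ξ : ℂ) * M n j ξ)) = (c n : ℂ) ^ m *
            ∑ j ∈ Finset.range (m + 1), a j * ((lambdaSymbol d (j - m) ξ : ℂ) * M n j ξ) := by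
          rw [Finset.mul_sum, Finset.mul_sum, Finset.mul_sum]
          refine Finset.sum_congr rfl fun j _ => ?_
          have : (j : ℝ) - m = (s - m) + -(s - j) := by ring
          rw [this, lambdaSymbol_add]
          push_cast
          ring
        rw [this, norm_mul, mul_pow, norm_pow, Complex.norm_real, Real.norm_of_nonneg (hc n).le,
          ← pow_mul, mul_comm m 2]
      rw [e]
      refine (mul_le_mul_of_nonneg_left (norm_sum_sq_le (m + 1) _)
        (pow_nonneg (hc n).le _)).trans ?_
      rw [Finset.mul_sum, Finset.mul_sum]
      refine Finset.sum_le_sum fun j hj => ?_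
      rw [norm_mul, norm_mul, Complex.norm_real, Real.norm_of_nonneg (lambdaSymbol_pos _ _).le,
        mul_pow, mul_pow]
      have h1 : lambdaSymbol d (j - m) ξ ≤ 1 := lambdaSymbol_le_one (by
        have : (j : ℝ) ≤ m := by exact_mod_cast Nat.lt_succ_iff.1 (Finset.mem_range.1 hj)
        linarith) ξ
      have h2 : lambdaSymbol d (j - m) ξ ^ 2 ≤ 1 := pow_le_one₀ (lambdaSymbol_pos _ _).le h1
      have hcn := hc n
      calc _ = (c n ^ (2 * m) * ((m + 1 : ℕ) * ‖a j‖ ^ 2)) * (lambdaSymbol d (j - m) ξ ^ 2 *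
            ‖M n j ξ‖ ^ 2) := by ring
        _ ≤ (c n ^ (2 * m) * ((m + 1 : ℕ) * ‖a j‖ ^ 2)) * (1 * ‖M n j ξ‖ ^ 2) := by gcongr
        _ = _ := by ring
    have hcn := hc n
    rw [← ofReal_norm, ← ENNReal.ofReal_pow (lambdaSymbol_pos _ _).le,
      ← ENNReal.ofReal_pow (norm_nonneg _), ← ENNReal.ofReal_mul (by positivity)]
    refine (ENNReal.ofReal_le_ofReal hle).trans ?_
    rw [ENNReal.ofReal_sum_of_nonneg fun j _ => by positivity]
    refine Finset.sum_le_sum fun j _ => ?_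
    rw [ENNReal.ofReal_mul (by positivity), ENNReal.ofReal_pow (norm_nonneg _), ofReal_norm]
  -- The power `c_n^(2m)` cancels the weight, leaving sums to which the Bessel inequality applies.
  have hterm : ∀ n, ENNReal.ofReal (1 / c n ^ (2 * m)) *
      ∫⁻ ξ, ENNReal.ofReal (lambdaSymbol d (s - m) ξ) ^ 2 * ‖U n ξ‖ₑ ^ 2 ≤
      ∑ j ∈ Finset.range (m + 1), ENNReal.ofReal ((m + 1 : ℕ) * ‖a j‖ ^ 2) *
        ∫⁻ X, ‖∫ z in Ioo (-H) 0, y j (X, z) * h n z‖ₑ ^ 2 := by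
    intro n
    have hcn := hc n
    calc _ ≤ ENNReal.ofReal (1 / c n ^ (2 * m)) * ∫⁻ ξ, ∑ j ∈ Finset.range (m + 1),
          ENNReal.ofReal (c n ^ (2 * m) * ((m + 1 : ℕ) * ‖a j‖ ^ 2)) * ‖M n j ξ‖ₑ ^ 2 := by
          exact mul_le_mul' le_rfl (lintegral_mono_ae (hpt n))
      _ = _ := by
          rw [lintegral_finsetSum' _ fun j _ => ((Lp.memLp (M n j)).1.enorm.pow_const 2).const_mul _,
            Finset.mul_sum]
          refine Finset.sum_congr rfl fun j _ => ?_
          rw [lintegral_const_mul' _ _ ENNReal.ofReal_ne_top, hM1, ← mul_assoc,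
            ← ENNReal.ofReal_mul (by positivity), ← mul_assoc, one_div,
            inv_mul_cancel₀ (pow_ne_zero _ hcn.ne'), one_mul]
  refine (ENNReal.tsum_le_tsum hterm).trans_lt ?_
  rw [Summable.tsum_finsetSum fun _ _ => ENNReal.summable]
  refine ENNReal.sum_lt_top.2 fun j _ => ?_
  rw [ENNReal.tsum_mul_left]
  refine ENNReal.mul_lt_top ENNReal.ofReal_lt_top ?_
  refine hh.tsum_lintegral_lt_top (μ := volume) ?_
  rw [← volume_restrict_strip]
  exact Lp.memLp (y j)

end Tail

/-! ### Modal coefficients of the initial data -/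

section InitialData

open scoped FourierTransform LineDeriv

variable {d : ℕ} {H s : ℝ}

/-- The vertical slices of `∂_z^j u`, where `y j = Λ^{s-j} ∂_z^j u`. -/
def sliceJet (s : ℝ) (y : ℕ → StripL2 d H) (χ : 𝓢(Horiz d, ℂ)) (j : ℕ) : ℝ → ℂ :=
  slice (y j) (lambdaPow d (-(s - j)) χ)

/-- Testing the relation of order `j` with `Λ^{-(s-j)} χ` removes the horizontal operator, whose
order depends on `j`. Order `j` against `ψ'` is then compared with order `j + 1` against `ψ`. -/
theorem isJet_sliceJet {m : ℕ} {u : Horiz d × ℝ → ℝ} {y : ℕ → StripL2 d H}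
    (hy : ∀ j ≤ m, IsLambdaPowDz H (s - j) j u (y j)) (χ : 𝓢(Horiz d, ℂ)) :
    IsJet H m (sliceJet s y χ) where
  integrableOn j _ := integrableOn_slice _ _
  isWeakDeriv j hj := by
    have key : ∀ j ≤ m, ∀ ψ, IsTestFunction (Ioo (-H) 0) ψ →
        ∫ p in strip d H, (u p : ℂ) * χ p.1 * ((iteratedDeriv j ψ p.2 : ℝ) : ℂ) =
          (-1) ^ j * ∫ z in Ioo (-H) 0, sliceJet s y χ j z * (ψ z : ℂ) := fun j hj ψ hψ => by
      have h := hy j hj (lambdaPow d (-(s - j)) χ) ψ hψ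
      rw [lambdaPow_lambdaPow, add_neg_cancel, lambdaPow_zero] at h
      rw [h, strip_integral_eq_right (Lp.memLp (y j)) _ (memLp_testFunction hψ)]
      rfl
    intro ψ hψ
    have h1 := key j hj.le (deriv ψ) hψ.deriv
    have h2 := key (j + 1) hj ψ hψ
    rw [iteratedDeriv_succ', h1, pow_succ, mul_assoc] at h2
    have h3 := mul_left_cancel₀ (pow_ne_zero j (by norm_num : (-1 : ℂ) ≠ 0)) h2
    rw [h3]
    ring

theorem slice_ae_eq_sliceJet {u : Horiz d × ℝ → ℝ} {y : ℕ → StripL2 d H}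
    (hu : MemLp u 2 (volume.restrict (strip d H))) (hy : IsLambdaPowDz H s 0 u (y 0))
    (χ : 𝓢(Horiz d, ℂ)) :
    slice (fun p => (u p : ℂ)) χ =ᵐ[volume.restrict (Ioo (-H) 0)] sliceJet s y χ 0 := by
  have := slice_eq_of_isLambdaPowDz hu hy χ
  simpa [sliceJet] using this

theorem br_eq_integral_sliceJet {u : Horiz d × ℝ → ℝ} {y : ℕ → StripL2 d H} {v : StripL2 d H}
    (hu : MemLp u 2 (volume.restrict (strip d H))) (hy : IsLambdaPowDz H s 0 u (y 0))
    (hv : IsLambdaPowDz H s 0 u v) (χ : 𝓢(Horiz d, ℂ)) {h : ℝ → ℂ}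
    (hh : MemLp h 2 (volume.restrict (Ioo (-H) 0))) :
    br s v χ h = ∫ z in Ioo (-H) 0, sliceJet s y χ 0 z * h z := by
  rw [br_eq_slice _ _ hh]
  refine integral_congr_ae ?_
  filter_upwards [slice_ae_eq_sliceJet hu hy χ, slice_eq_of_isLambdaPowDz hu hv χ] with z h1 h2
  rw [← h1, h2]

theorem integral_comb_sliceJet (y : ℕ → StripL2 d H) (χ : 𝓢(Horiz d, ℂ)) (m : ℕ) (a : ℕ → ℂ)
    {h : ℝ → ℂ} (hh : MemLp h 2 (volume.restrict (Ioo (-H) 0))) :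
    ∫ z in Ioo (-H) 0, (∑ j ∈ Finset.range m, a j * sliceJet s y χ j z) * h z =
      ∑ j ∈ Finset.range m, a j * br (s - j) (y j) χ h := by
  simp_rw [Finset.sum_mul, mul_assoc]
  have hi : ∀ j, IntegrableOn (fun z => a j * (sliceJet s y χ j z * h z)) (Ioo (-H) 0) := fun j =>
    Integrable.const_mul ((memLp_slice (Lp.memLp (y j)) _).integrable_mul hh) _
  rw [integral_finsetSum _ fun j _ => hi j]
  refine Finset.sum_congr rfl fun j _ => ?_
  rw [integral_const_mul, br_eq_slice _ _ hh]
  rfl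

variable {g : ℝ} {ρeq : ℝ → ℝ} {b N : ℝ} {c : ℕ+ → ℝ} {f : ℕ+ → ℝ → ℝ}

/-- The profile left after `μ` integrations by parts, starting from `profW`. -/
def endProf (ρeq : ℝ → ℝ) (N c : ℝ) (f : ℝ → ℝ) (μ : ℕ) : ℝ → ℂ :=
  if μ % 2 = 0 then profW ρeq N f else profV ρeq c f

theorem isBesselFamily_endProf (hB : IsBackground H g ρeq b N)
    (hSL : IsSturmLiouvilleBasis H g ρeq c f) (μ : ℕ) :
    IsBesselFamily (volume.restrict (Ioo (-H) 0)) (fun n => endProf ρeq N (c n) (f n) μ) := by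
  unfold endProf
  split_ifs
  · exact isBesselFamily_profW hB hSL
  · exact isBesselFamily_profV hB hSL

/-- Both parities in one formula: `μ / 2` double passages, and a single one more if `μ` is odd. The
condition `2 * i < μ` selects exactly the end values met on the way. -/
theorem IsJet.integral_profW_reduce {c : ℝ} {f : ℝ → ℝ} (hB : IsBackground H g ρeq b N)
    (hf : IsMode H ρeq N c f) (μ : ℕ) {D : ℕ → ℝ → ℂ} (hD : IsJet H μ D)
    (h0 : ∀ i, 2 * i < μ → VanishesAtEnds (-H) 0 (((opL (-b))^[i] D) 0)) :
    ∫ z in Ioo (-H) 0, D 0 z * profW ρeq N f z = (-(1 / (N : ℂ) ^ 2)) ^ (μ / 2) * (c : ℂ) ^ μ *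
      ∫ z in Ioo (-H) 0, ((opL (-b))^[μ / 2] D) (μ % 2) z * endProf ρeq N c f μ z := by
  rcases Nat.even_or_odd' μ with ⟨l, rfl | rfl⟩
  · have e1 : 2 * l / 2 = l := by omega
    have e2 : 2 * l % 2 = 0 := by omega
    rw [hD.integral_profW_eq_opL hB hf l fun i hi => h0 i (by omega), e1, endProf, e2, if_pos rfl,
      pow_mul, ← mul_pow]
    congr 2
    ring
  · have e1 : (2 * l + 1) / 2 = l := by omega
    have e2 : (2 * l + 1) % 2 = 1 := by omega
    rw [hD.integral_profW_eq_opL_succ hB hf l fun i hi => h0 i (by omega), e1, endProf, e2,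
      if_neg one_ne_zero, pow_succ (c : ℂ) (2 * l), pow_mul, ← mul_assoc, ← mul_pow]
    congr 3
    ring

/-- The modal coefficients of `w` at the initial time. -/
theorem exists_reduction_profW (hB : IsBackground H g ρeq b N)
    (hSL : IsSturmLiouvilleBasis H g ρeq c f) (μ : ℕ) {y : ℕ → StripL2 d H}
    (hD : ∀ χ, IsJet H μ (sliceJet s y χ))
    (h0 : ∀ χ i, 2 * i < μ → VanishesAtEnds (-H) 0 (((opL (-b))^[i] (sliceJet s y χ)) 0)) :
    ∃ a : ℕ → ℂ, ∀ n χ, ∫ z in Ioo (-H) 0, sliceJet s y χ 0 z * profW ρeq N (f n) z =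
      (c n : ℂ) ^ μ * ∑ j ∈ Finset.range (μ + 1),
        a j * br (s - j) (y j) χ (endProf ρeq N (c n) (f n) μ) := by
  obtain ⟨a, ha⟩ := (isJetComb_opL_iterate (-b : ℂ) (μ / 2) (μ % 2) μ (by omega)).const_mul
    ((-(1 / (N : ℂ) ^ 2)) ^ (μ / 2))
  refine ⟨a, fun n χ => ?_⟩
  rw [(hD χ).integral_profW_reduce hB (hSL.isMode hB n) μ (h0 χ),
    ← integral_comb_sliceJet y χ (μ + 1) a ((isBesselFamily_endProf hB hSL μ).1 n)]
  simp_rw [← ha, mul_assoc]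
  rw [integral_const_mul]
  ring

/-- The modal coefficients of `ρ` at the initial time. -/
theorem exists_reduction_profRho (hB : IsBackground H g ρeq b N)
    (hSL : IsSturmLiouvilleBasis H g ρeq c f) (μ : ℕ) {y : ℕ → StripL2 d H}
    (hD : ∀ χ, IsJet H μ (sliceJet s y χ))
    (h0 : ∀ χ i, 2 * i < μ → VanishesAtEnds (-H) 0 (((opL b)^[i] (sliceJet s y χ)) 0)) :
    ∃ (a : ℕ → ℂ) (h : ℕ+ → ℝ → ℂ), IsBesselFamily (volume.restrict (Ioo (-H) 0)) h ∧
      ∀ n χ, ∫ z in Ioo (-H) 0, sliceJet s y χ 0 z * profRho g (f n) z =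
        (c n : ℂ) ^ μ * ∑ j ∈ Finset.range (μ + 1), a j * br (s - j) (y j) χ (h n) := by
  obtain ⟨ρ0, hρ0, hρ⟩ := hB.exists_eq_exp
  -- Chosen so that `g f = A e^{bz} (ρ_eq N² f)`: the coefficient of `ρ` becomes a coefficient of
  -- `w` type for `A e^{bz} ρ`. In the end the exponential is absorbed into the Bessel family.
  set A : ℝ := g / (ρ0 * N ^ 2) with hA
  have hcomb : ∀ l r i m, i + r + 2 * l ≤ m →
      IsJetComb m (fun D => ((shiftOp b)^[r] ((opL b)^[l] D)) i) := by
    intro l r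
    induction r with
    | zero => exact fun i m h => isJetComb_opL_iterate (b : ℂ) l i m (by omega)
    | succ r ih =>
      intro i m h
      simp_rw [Function.iterate_succ_apply']
      exact (ih (i + 1) m (by omega)).add ((ih i m (by omega)).const_mul b)
  obtain ⟨a, ha⟩ := (hcomb (μ / 2) (μ % 2) 0 μ (by omega)).const_mul
    ((-(1 / (N : ℂ) ^ 2)) ^ (μ / 2))
  have hce : Continuous fun z : ℝ => ((A * Real.exp (b * z) : ℝ) : ℂ) := by fun_prop
  obtain ⟨K, hK⟩ := isCompact_Icc.exists_bound_of_continuousOn (hce.continuousOn (s := Icc (-H) 0))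
  have hBes := (isBesselFamily_endProf hB hSL μ).mul_bounded hce.aestronglyMeasurable (K := K) (by
    filter_upwards [ae_restrict_mem measurableSet_Ioo] with z hz
      using hK z (Ioo_subset_Icc_self hz))
  refine ⟨a, _, hBes, fun n χ => ?_⟩
  have hJ := (hD χ).jet_expJet A b
  have e0 : ∫ z in Ioo (-H) 0, sliceJet s y χ 0 z * profRho g (f n) z =
      ∫ z in Ioo (-H) 0, expJet A b (sliceJet s y χ) 0 z * profW ρeq N (f n) z := by
    refine setIntegral_congr_fun measurableSet_Ioo fun z hz => ?_
    have hN := hB.freq_pos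
    have : g * f n z = A * Real.exp (b * z) * (ρeq z * N ^ 2 * f n z) := by
      rw [hρ z hz, Real.exp_neg, hA]
      have := Real.exp_pos (b * z)
      field_simp
    simp only [expJet, profRho, profW, this, Function.iterate_zero, id]
    push_cast
    ring
  have hv : ∀ i, 2 * i < μ →
      VanishesAtEnds (-H) 0 (((opL (-b))^[i] (expJet A b (sliceJet s y χ))) 0) := fun i hi => by
    rw [opL_iterate_expJet]
    obtain ⟨F, h1, h2, h3, h4⟩ := h0 χ i hi
    have ht : ∀ x, Tendsto (fun z : ℝ => ((A * Real.exp (b * z) : ℝ) : ℂ)) (𝓝 x)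
        (𝓝 ((A * Real.exp (b * x) : ℝ) : ℂ)) := fun x => hce.tendsto x
    refine ⟨fun z => ((A * Real.exp (b * z) : ℝ) : ℂ) * F z, hce.continuousOn.mul h1, ?_, ?_, ?_⟩
    · filter_upwards [h2] with z hz
      simp only [expJet, Function.iterate_zero, id, hz]
    · simpa using ((ht (-H)).mono_left nhdsWithin_le_nhds).mul h3
    · simpa using ((ht 0).mono_left nhdsWithin_le_nhds).mul h4
  rw [e0, hJ.integral_profW_reduce hB (hSL.isMode hB n) μ hv,
    ← integral_comb_sliceJet y χ (μ + 1) a (hBes.1 n)]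
  simp_rw [← ha, opL_iterate_expJet]
  rw [mul_comm ((-(1 / (N : ℂ) ^ 2)) ^ (μ / 2)), mul_assoc, ← integral_const_mul]
  congr 1
  refine integral_congr_ae (ae_of_all _ fun z => ?_)
  have e1 : expJet A b ((opL b)^[μ / 2] (sliceJet s y χ)) (μ % 2) z =
      ((A * Real.exp (b * z) : ℝ) : ℂ) *
        ((shiftOp b)^[μ % 2] ((opL b)^[μ / 2] (sliceJet s y χ))) 0 z := rfl
  simp only [e1]
  ring

/-- The modal coefficients of `V` at the initial time, for those `χ` for which `∂ V` has
a suitable primitive. -/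
theorem exists_reduction_profV (hB : IsBackground H g ρeq b N)
    (hSL : IsSturmLiouvilleBasis H g ρeq c f) (μ : ℕ) {y : ℕ → StripL2 d H}
    (hD : ∀ χ, IsJet H (μ + 1) (sliceJet s y χ)) :
    ∃ a : ℕ → ℂ, ∀ n χ, (∀ i, 2 * i < μ →
        VanishesAtEnds (-H) 0 (((opL (-b))^[i] (shiftOp (-b) (sliceJet s y χ))) 0)) →
      ∫ z in Ioo (-H) 0, sliceJet s y χ 0 z * profV ρeq (c n) (f n) z =
      (c n : ℂ) ^ (μ + 1) * ∑ j ∈ Finset.range (μ + 1 + 1),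
        a j * br (s - j) (y j) χ (endProf ρeq N (c n) (f n) μ) := by
  obtain ⟨a, ha⟩ := ((isJetComb_opL_iterate (-b : ℂ) (μ / 2) (μ % 2) μ
    (by omega)).comp_shiftOp (-b)).const_mul (-(1 / (N : ℂ) ^ 2) * (-(1 / (N : ℂ) ^ 2)) ^ (μ / 2))
  refine ⟨a, fun n χ h0 => ?_⟩
  rw [((hD χ).mono (by omega : 1 ≤ μ + 1)).integral_profV_eq hB (hSL.isMode hB n),
    ((hD χ).jet_shiftOp (-b)).integral_profW_reduce hB (hSL.isMode hB n) μ h0,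
    ← integral_comb_sliceJet y χ (μ + 1 + 1) a ((isBesselFamily_endProf hB hSL μ).1 n)]
  simp_rw [← ha, mul_assoc]
  rw [integral_const_mul, integral_const_mul]
  ring

end InitialData

/-! ### End values of the velocity and comparison of energies -/

section Conclusion

open scoped FourierTransform LineDeriv

variable {d : ℕ} {H T s g : ℝ} {ρeq : ℝ → ℝ} {b N : ℝ} {V : Fin d → ℝ → Horiz d × ℝ → ℝ}
  {w ρ P : ℝ → Horiz d × ℝ → ℝ} {Vv : Fin d → ℝ → StripL2 d H} {wv ρv : ℝ → StripL2 d H}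

theorem fourierInv_lapMul (φ : 𝓢(Horiz d, ℂ)) :
    𝓕⁻ (lapMul φ) = ∑ i : Fin d, ∂_{hdir i} (∂_{hdir i} (𝓕⁻ φ)) := by
  simp only [lapMul, lineDeriv_fourierInv]
  exact map_sum (FourierTransform.fourierInvCLM ℂ 𝓢(Horiz d, ℂ)) _ _

theorem lineDeriv_comm (i j : Fin d) (χ : 𝓢(Horiz d, ℂ)) :
    ∂_{hdir i} (∂_{hdir j} χ) = ∂_{hdir j} (∂_{hdir i} χ) := by
  obtain ⟨φ, rfl⟩ : ∃ φ : 𝓢(Horiz d, ℂ), χ = 𝓕⁻ φ :=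
    ⟨𝓕 χ, (FourierTransform.fourierInv_fourier_eq χ).symm⟩
  simp only [lineDeriv_fourierInv]
  congr 1
  ext ξ
  simp only [dirMul_eq]
  ring

theorem slice_sum (v : StripL2 d H) (χ : Fin d → 𝓢(Horiz d, ℂ)) :
    slice v (∑ i, χ i) =ᵐ[volume.restrict (Ioo (-H) 0)] fun z => ∑ i, slice v (χ i) z := by
  refine ae_eq_of_forall_integral_test_eq (integrableOn_slice _ _)
    (integrable_finsetSum _ fun i _ => integrableOn_slice _ _) fun ψ hψ => ?_
  have hm := memLp_testFunction hψ
  simp only [Finset.sum_mul]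
  rw [integral_finsetSum _ fun i _ => hψ.integrable_mul (integrableOn_slice _ _),
    ← strip_integral_eq_right (Lp.memLp v) _ hm]
  simp_rw [← fun i => strip_integral_eq_right (Lp.memLp v) (χ i) hm]
  rw [← integral_finsetSum]
  · refine integral_congr_ae (ae_of_all _ fun p => ?_)
    simp only [sum_apply, Finset.mul_sum, Finset.sum_mul]
  · intro i _
    refine ((Lp.memLp v).integrable_mul (memLp_strip_tensor (χ i) hm)).congr
      (ae_of_all _ fun p => ?_)
    simp [mul_assoc]

theorem exists_initial_jet {m : ℕ} (hT : 0 < T) {u : ℝ → Horiz d × ℝ → ℝ}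
    (h : IsContinuousIntoHsm H T s m u) :
    ∃ y : ℕ → StripL2 d H, ∀ j ≤ m, IsLambdaPowDz H (s - j) j (u 0) (y j) := by
  have : ∀ j, ∃ y : StripL2 d H, j ≤ m → IsLambdaPowDz H (s - j) j (u 0) y := fun j => by
    by_cases hj : j ≤ m
    · obtain ⟨v, _, hv⟩ := h.2 j hj
      exact ⟨v 0, fun _ => hv 0 ⟨le_rfl, hT.le⟩⟩
    · exact ⟨0, fun h => absurd h hj⟩
  choose y hy using this
  exact ⟨y, hy⟩

/-- The trace conditions for `V` follow from those for `w`. -/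
theorem vanishesAtEnds_velocity (hs : 0 ≤ s) (hT : 0 < T) (hB : IsBackground H g ρeq b N)
    (hsol : IsLinearSolution H g T ρeq V w ρ P) (hV : ∀ i, IsHsCurve H T s (V i) (Vv i))
    (hw : IsHsCurve H T s w wv) (hcurl : HasZeroVerticalVorticity H (fun i => V i 0)) {μ k : ℕ}
    (hμ : μ + 1 ≤ 2 * k + 1)
    {yw yV : ℕ → StripL2 d H} (j : Fin d)
    (hyw : ∀ l ≤ μ + 1, IsLambdaPowDz H (s - l) l (w 0) (yw l))
    (hyV : ∀ l ≤ μ + 1, IsLambdaPowDz H (s - l) l (V j 0) (yV l))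
    (h0 : ∀ χ, ∀ l ≤ k, 2 * l ≤ μ + 1 →
      VanishesAtEnds (-H) 0 (((opL (-b))^[l] (sliceJet s yw χ)) 0))
    (χ : 𝓢(Horiz d, ℂ)) (i : ℕ) (hi : 2 * i < μ) :
    VanishesAtEnds (-H) 0 (((opL (-b))^[i] (shiftOp (-b)
      (sliceJet s yV (∑ l : Fin d, ∂_{hdir l} (∂_{hdir l} χ))))) 0) := by
  have ht : (0 : ℝ) ∈ Icc 0 T := ⟨le_rfl, hT.le⟩
  have z0 : ∀ {u : Horiz d × ℝ → ℝ} {y : ℕ → StripL2 d H} {v : StripL2 d H},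
      MemLp u 2 (volume.restrict (strip d H)) →
      (∀ l ≤ μ + 1, IsLambdaPowDz H (s - l) l u (y l)) → IsLambdaPowDz H s 0 u v →
      ∀ χ, slice v (lambdaPow d (-s) χ) =ᵐ[volume.restrict (Ioo (-H) 0)] sliceJet s y χ 0 :=
    fun {u y v} hu hy hv χ => (slice_eq_of_isLambdaPowDz hu hv χ).symm.trans
      (slice_ae_eq_sliceJet hu (by simpa using hy 0 (by omega)) χ)
  have jW := isJet_sliceJet hyw (∂_{hdir j} χ)
  have jV := isJet_sliceJet hyV (∑ l : Fin d, ∂_{hdir l} (∂_{hdir l} χ))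
  have hdiv := isWeakDeriv_slice_divergence hs hsol hV hw ht (∂_{hdir j} χ)
  -- Transposed form of `ΔV_j = ∂_j ∇·V`, which holds for a field without vorticity. With
  -- incompressibility, the slice of `V_j` at `Δχ` becomes the `z`-derivative of the slice of `w` at
  -- `∂_j χ`.
  have eV : (fun z => ∑ l, slice (Vv l 0) (lambdaPow d (-s) (∂_{hdir l} (∂_{hdir j} χ))) z)
      =ᵐ[volume.restrict (Ioo (-H) 0)] sliceJet s yV (∑ l : Fin d, ∂_{hdir l} (∂_{hdir l} χ)) 0 := by
    have e1 := ae_all_iff.2 fun l => slice_curl_eq hs hT hB hsol hV hcurl ht l j (∂_{hdir l} χ)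
    have e2 := slice_sum (Vv j 0) fun l => lambdaPow d (-s) (∂_{hdir l} (∂_{hdir l} χ))
    rw [← map_sum] at e2
    filter_upwards [e1, e2, z0 ((hV j).memLp 0 ht) hyV ((hV j).rep 0 ht)
      (∑ l : Fin d, ∂_{hdir l} (∂_{hdir l} χ))] with z h1 h2 h3
    rw [← h3, h2]
    refine Finset.sum_congr rfl fun l _ => ?_
    rw [lineDeriv_comm, h1 l]
  have e01 : sliceJet s yV (∑ l : Fin d, ∂_{hdir l} (∂_{hdir l} χ)) 0 =ᵐ[volume.restrict (Ioo (-H) 0)]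
      sliceJet s yw (∂_{hdir j} χ) 1 :=
    eV.symm.trans (hdiv.unique (jW.2 0 (by omega))
      (integrable_finsetSum _ fun l _ => integrableOn_slice _ _) (jW.1 1 (by omega))
      (z0 (hw.memLp 0 ht) hyw (hw.rep 0 ht) _))
  have eJ := (jV.mono (Nat.le_succ μ)).ae_eq (IsJet.tail jW) e01
  -- Since `V` corresponds to `∂_z w`, applying `∂ - b` to it is applying `∂(∂ - b)` to `w`; hence
  -- the shift to `i + 1`, and `2 * i < μ` gives exactly `2 * (i + 1) ≤ μ + 1`.
  have h1 := h0 (∂_{hdir j} χ) (i + 1) (by omega) (by omega)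
  rw [Function.iterate_succ_apply] at h1
  refine h1.congr (opL_iterate_ae_eq (-b : ℂ) i 0 (fun l hl => ?_) 0 le_rfl)
  filter_upwards [eJ l (by omega), eJ (l + 1) (by omega)] with z e1 e2
  simp only [shiftOp, opL, e1, e2]

theorem sobolevNormSq_mode_le {u : Horiz d × ℝ → ℝ} {v : StripL2 d H}
    (hu : MemLp u 2 (volume.restrict (strip d H))) (hv : IsLambdaPowDz H s 0 u v)
    {q : Horiz d → ℝ} {h : ℝ → ℂ} (hh : MemLp h 2 (volume.restrict (Ioo (-H) 0)))
    (hq : ∀ X, (q X : ℂ) = ∫ z in Ioo (-H) 0, (u (X, z) : ℂ) * h z) {U : HorizL2 d}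
    (hU : ∀ φ : 𝓢(Horiz d, ℂ), ∫ ξ, U ξ * φ ξ = br s v (𝓕⁻ φ) h) (r : ℝ) :
    sobolevNormSq r q ≤ ∫⁻ ξ, ENNReal.ofReal (lambdaSymbol d r ξ) ^ 2 * ‖U ξ‖ₑ ^ 2 := by
  have hm : MemLp (fun X => (q X : ℂ)) 2 volume := by
    simp_rw [hq]
    exact memLp_profile (memLp_complex hu) hh
  refine sobolevNormSq_le (by simpa using hm.re) r fun φ => ?_
  rw [hU, ← strip_integral_eq_br hu hv _ hh, strip_integral_eq_left (memLp_complex hu) _ hh]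
  simp_rw [hq]

theorem modeW_eq (hB : IsBackground H g ρeq b N) (f : ℝ → ℝ) (u : Horiz d × ℝ → ℝ) (X : Horiz d) :
    (modeW H g ρeq f u X : ℂ) = ∫ z in Ioo (-H) 0, (u (X, z) : ℂ) * profW ρeq N f z := by
  rw [modeW, ← integral_complex_ofReal]
  refine setIntegral_congr_fun measurableSet_Ioo fun z hz => ?_
  simp only [hB.nsq_eq z hz, profW]
  push_cast
  ring

theorem modeV_eq (c : ℝ) (f : ℝ → ℝ) (u : Horiz d × ℝ → ℝ) (X : Horiz d) :
    (modeV H ρeq c f u X : ℂ) = ∫ z in Ioo (-H) 0, (u (X, z) : ℂ) * profV ρeq c f z := by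
  rw [modeV, ← integral_complex_ofReal]
  refine integral_congr_ae (ae_of_all _ fun z => ?_)
  simp only [profV]
  push_cast
  ring

theorem modeRho_eq (hB : IsBackground H g ρeq b N) (f : ℝ → ℝ) (u : Horiz d × ℝ → ℝ)
    (X : Horiz d) :
    (modeRho H g ρeq f u X : ℂ) = ∫ z in Ioo (-H) 0, (u (X, z) : ℂ) * profRho g f z := by
  rw [modeRho, ← integral_complex_ofReal]
  refine setIntegral_congr_fun measurableSet_Ioo fun z hz => ?_
  have hN := hB.freq_pos
  have hp := hB.density_pos z (Ioo_subset_Icc_self hz)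
  simp only [hB.nsq_eq z hz, profRho]
  rw [← Complex.ofReal_mul]
  congr 1
  field_simp

/-- The conserved energy weights `w` by `1 / N²`; passing to equal weights costs `1 + N²` in one
direction and `1 + 1 / N²` in the other, whatever the mode and the frequency. -/
theorem energy_comparison {n : ℕ} {N : ℝ} (hN : 0 < N) {v v' : Fin n → ℂ} {x x' y y' : ℂ}
    (h : ∑ i, ‖v i‖ ^ 2 + ‖x‖ ^ 2 / N ^ 2 + ‖y‖ ^ 2 =
      ∑ i, ‖v' i‖ ^ 2 + ‖x'‖ ^ 2 / N ^ 2 + ‖y'‖ ^ 2) :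
    ‖y‖ₑ ^ 2 + ∑ i, ‖v i‖ₑ ^ 2 + ‖x‖ₑ ^ 2 ≤ ENNReal.ofReal ((1 + N ^ 2) * (1 + 1 / N ^ 2)) *
      (‖y'‖ₑ ^ 2 + ∑ i, ‖v' i‖ₑ ^ 2 + ‖x'‖ₑ ^ 2) := by
  have e : ∀ (v : Fin n → ℂ) (x y : ℂ), ‖y‖ₑ ^ 2 + ∑ i, ‖v i‖ₑ ^ 2 + ‖x‖ₑ ^ 2 =
      ENNReal.ofReal (‖y‖ ^ 2 + ∑ i, ‖v i‖ ^ 2 + ‖x‖ ^ 2) := fun v x y => by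
    rw [ENNReal.ofReal_add (by positivity) (by positivity),
      ENNReal.ofReal_add (by positivity) (by positivity),
      ENNReal.ofReal_sum_of_nonneg fun i _ => by positivity]
    simp only [ENNReal.ofReal_pow (norm_nonneg _), ofReal_norm]
  rw [e, e, ← ENNReal.ofReal_mul (by positivity)]
  refine ENNReal.ofReal_le_ofReal ?_
  have hv : 0 ≤ ∑ i, ‖v i‖ ^ 2 := by positivity
  have hv' : 0 ≤ ∑ i, ‖v' i‖ ^ 2 := by positivity
  set A := ∑ i, ‖v i‖ ^ 2
  set A' := ∑ i, ‖v' i‖ ^ 2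
  have h1 : ‖y‖ ^ 2 + A + ‖x‖ ^ 2 ≤ (1 + N ^ 2) * (A + ‖x‖ ^ 2 / N ^ 2 + ‖y‖ ^ 2) := by
    have e1 : (1 + N ^ 2) * (A + ‖x‖ ^ 2 / N ^ 2 + ‖y‖ ^ 2) = ‖y‖ ^ 2 + A + ‖x‖ ^ 2 +
        (N ^ 2 * A + ‖x‖ ^ 2 / N ^ 2 + N ^ 2 * ‖y‖ ^ 2) := by field_simp; ring
    rw [e1]
    have : 0 ≤ N ^ 2 * A + ‖x‖ ^ 2 / N ^ 2 + N ^ 2 * ‖y‖ ^ 2 := by positivity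
    linarith
  have h2 : A' + ‖x'‖ ^ 2 / N ^ 2 + ‖y'‖ ^ 2 ≤ (1 + 1 / N ^ 2) * (‖y'‖ ^ 2 + A' + ‖x'‖ ^ 2) := by
    have e1 : (1 + 1 / N ^ 2) * (‖y'‖ ^ 2 + A' + ‖x'‖ ^ 2) = A' + ‖x'‖ ^ 2 / N ^ 2 + ‖y'‖ ^ 2 +
        (A' / N ^ 2 + ‖y'‖ ^ 2 / N ^ 2 + ‖x'‖ ^ 2) := by field_simp; ring
    rw [e1]
    have : 0 ≤ A' / N ^ 2 + ‖y'‖ ^ 2 / N ^ 2 + ‖x'‖ ^ 2 := by positivity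
    linarith
  calc _ ≤ _ := h1
    _ = (1 + N ^ 2) * (A' + ‖x'‖ ^ 2 / N ^ 2 + ‖y'‖ ^ 2) := by rw [h]
    _ ≤ (1 + N ^ 2) * ((1 + 1 / N ^ 2) * (‖y'‖ ^ 2 + A' + ‖x'‖ ^ 2)) := by gcongr
    _ = _ := by ring

/-- The weighted sum of three energies, as a single integral. -/
theorem lintegral_energy (r : ℝ) {n : ℕ} (v : Fin n → HorizL2 d) (x y : HorizL2 d) :
    (∫⁻ ξ, ENNReal.ofReal (lambdaSymbol d r ξ) ^ 2 * ‖y ξ‖ₑ ^ 2) +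
      ∑ i, (∫⁻ ξ, ENNReal.ofReal (lambdaSymbol d r ξ) ^ 2 * ‖v i ξ‖ₑ ^ 2) +
      (∫⁻ ξ, ENNReal.ofReal (lambdaSymbol d r ξ) ^ 2 * ‖x ξ‖ₑ ^ 2) =
    ∫⁻ ξ, ENNReal.ofReal (lambdaSymbol d r ξ) ^ 2 *
      (‖y ξ‖ₑ ^ 2 + ∑ i, ‖v i ξ‖ₑ ^ 2 + ‖x ξ‖ₑ ^ 2) := by
  have hm : ∀ u : HorizL2 d, AEMeasurable
      (fun ξ => ENNReal.ofReal (lambdaSymbol d r ξ) ^ 2 * ‖u ξ‖ₑ ^ 2) volume := fun u =>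
    (((continuous_lambdaSymbol r).measurable.ennreal_ofReal.pow_const 2).aemeasurable).mul
      ((Lp.memLp u).1.enorm.pow_const 2)
  simp_rw [mul_add, Finset.mul_sum]
  rw [lintegral_add_right' _ (hm x), lintegral_add_left' (hm y),
    lintegral_finsetSum' _ fun i _ => hm (v i)]

end Conclusion

/-! ### Weighted summability at the initial time -/

section InitialDecay

open scoped FourierTransform LineDeriv

variable {d : ℕ} {H T s g : ℝ} {ρeq : ℝ → ℝ} {b N : ℝ} {V : Fin d → ℝ → Horiz d × ℝ → ℝ}
  {w ρ P : ℝ → Horiz d × ℝ → ℝ} {Vv : Fin d → ℝ → StripL2 d H} {wv ρv : ℝ → StripL2 d H}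
  {c : ℕ+ → ℝ} {f : ℕ+ → ℝ → ℝ}

theorem vanishesAtEnds_of_trace_opT₂Star (hB : IsBackground H g ρeq b N) {u : Horiz d × ℝ → ℝ}
    (hu : MemLp u 2 (volume.restrict (strip d H))) {y : ℕ → StripL2 d H} {m l : ℕ}
    (hy : ∀ j ≤ m, IsLambdaPowDz H (s - j) j u (y j)) (hl : 2 * l ≤ m)
    (h : HasZeroTrace H (2 * l) ((opT₂Star ρeq)^[l]) u) (χ : 𝓢(Horiz d, ℂ)) :
    VanishesAtEnds (-H) 0 (((opL (-b))^[l] (sliceJet s y χ)) 0) :=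
  vanishesAtEnds_of_hasZeroTrace hB.neg_lt_zero
    (one_div_ne_zero (by exact_mod_cast hB.rate_pos.ne')) (actsAsOpL_opT₂Star hB) hl h χ
    (isJet_sliceJet hy χ) (slice_ae_eq_sliceJet hu (by simpa using hy 0 (Nat.zero_le m)) χ)

theorem vanishesAtEnds_of_trace_opT₂ (hB : IsBackground H g ρeq b N) {u : Horiz d × ℝ → ℝ}
    (hu : MemLp u 2 (volume.restrict (strip d H))) {y : ℕ → StripL2 d H} {m l : ℕ}
    (hy : ∀ j ≤ m, IsLambdaPowDz H (s - j) j u (y j)) (hl : 2 * l ≤ m)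
    (h : HasZeroTrace H (2 * l) ((opT₂ ρeq)^[l]) u) (χ : 𝓢(Horiz d, ℂ)) :
    VanishesAtEnds (-H) 0 (((opL b)^[l] (sliceJet s y χ)) 0) :=
  vanishesAtEnds_of_hasZeroTrace hB.neg_lt_zero
    (one_div_ne_zero (by exact_mod_cast hB.rate_pos.ne')) (actsAsOpL_opT₂ hB) hl h χ
    (isJet_sliceJet hy χ) (slice_ae_eq_sliceJet hu (by simpa using hy 0 (Nat.zero_le m)) χ)

theorem tsum_initial_w (hd : d ≠ 0) (hT : 0 < T) (hB : IsBackground H g ρeq b N)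
    (hSL : IsSturmLiouvilleBasis H g ρeq c f) (hw : IsHsCurve H T s w wv) {k ν : ℕ}
    (hν : ν ≤ 2 * k + 1) (hreg : IsContinuousIntoHsm H T s ν w)
    (hw0 : ∀ l ≤ k, HasZeroTrace H (2 * l) ((opT₂Star ρeq)^[l]) (w 0)) {U : ℕ+ → HorizL2 d}
    (hU : ∀ n (φ : 𝓢(Horiz d, ℂ)), ∫ ξ, U n ξ * φ ξ = br s (wv 0) (𝓕⁻ φ) (profW ρeq N (f n))) :
    ∑' n, ENNReal.ofReal (1 / c n ^ (2 * ν)) *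
      ∫⁻ ξ, ENNReal.ofReal (lambdaSymbol d (s - ν) ξ) ^ 2 * ‖U n ξ‖ₑ ^ 2 < ⊤ := by
  have ht : (0 : ℝ) ∈ Icc 0 T := ⟨le_rfl, hT.le⟩
  obtain ⟨y, hy⟩ := exists_initial_jet hT hreg
  obtain ⟨a, ha⟩ := exists_reduction_profW hB hSL ν (fun χ => isJet_sliceJet hy χ) fun χ i hi =>
    vanishesAtEnds_of_trace_opT₂Star hB (hw.memLp 0 ht) hy hi.le (hw0 i (by omega)) χ
  refine tsum_weighted_lt_top hd hSL.speed_pos (isBesselFamily_endProf hB hSL ν) ν y a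
    fun n φ => ?_
  rw [hU, br_eq_integral_sliceJet (hw.memLp 0 ht) (by simpa using hy 0 (Nat.zero_le ν))
    (hw.rep 0 ht) _ ((hSL.isMode hB n).memLp_profW hB), ha]

theorem tsum_initial_rho (hd : d ≠ 0) (hT : 0 < T) (hB : IsBackground H g ρeq b N)
    (hSL : IsSturmLiouvilleBasis H g ρeq c f) (hρ : IsHsCurve H T s ρ ρv) {k ν : ℕ}
    (hν : ν ≤ 2 * k + 1) (hreg : IsContinuousIntoHsm H T s ν ρ)
    (hρ0 : ∀ l ≤ k, 2 * l < ν → HasZeroTrace H (2 * l) ((opT₂ ρeq)^[l]) (ρ 0))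
    {U : ℕ+ → HorizL2 d}
    (hU : ∀ n (φ : 𝓢(Horiz d, ℂ)), ∫ ξ, U n ξ * φ ξ = br s (ρv 0) (𝓕⁻ φ) (profRho g (f n))) :
    ∑' n, ENNReal.ofReal (1 / c n ^ (2 * ν)) *
      ∫⁻ ξ, ENNReal.ofReal (lambdaSymbol d (s - ν) ξ) ^ 2 * ‖U n ξ‖ₑ ^ 2 < ⊤ := by
  have ht : (0 : ℝ) ∈ Icc 0 T := ⟨le_rfl, hT.le⟩
  obtain ⟨y, hy⟩ := exists_initial_jet hT hreg
  obtain ⟨a, h, hh, ha⟩ := exists_reduction_profRho hB hSL ν (fun χ => isJet_sliceJet hy χ)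
    fun χ i hi => vanishesAtEnds_of_trace_opT₂ hB (hρ.memLp 0 ht) hy hi.le
      (hρ0 i (by omega) hi) χ
  refine tsum_weighted_lt_top hd hSL.speed_pos hh ν y a fun n φ => ?_
  rw [hU, br_eq_integral_sliceJet (hρ.memLp 0 ht) (by simpa using hy 0 (Nat.zero_le ν))
    (hρ.rep 0 ht) _ ((hSL.isMode hB n).memLp_profRho g), ha]

/-- The first integration by parts, against `c_n ρ_eq f_n'`, needs no end condition, and `μ` more
follow. The tests `𝓕⁻ (lapMul φ)` are Laplacians, precisely those for which the end values of `V`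
are deduced from those of `w`. -/
theorem tsum_initial_velocity (hd : d ≠ 0) (hs : 0 ≤ s) (hT : 0 < T)
    (hB : IsBackground H g ρeq b N) (hSL : IsSturmLiouvilleBasis H g ρeq c f)
    (hsol : IsLinearSolution H g T ρeq V w ρ P) (hV : ∀ i, IsHsCurve H T s (V i) (Vv i))
    (hw : IsHsCurve H T s w wv) (hcurl : HasZeroVerticalVorticity H (fun i => V i 0)) {k μ : ℕ}
    (hμ : μ + 1 ≤ 2 * k + 1) (hwreg : IsContinuousIntoHsm H T s (μ + 1) w) (j : Fin d)
    (hreg : IsContinuousIntoHsm H T s (μ + 1) (V j))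
    (hw0 : ∀ l ≤ k, HasZeroTrace H (2 * l) ((opT₂Star ρeq)^[l]) (w 0)) {U : ℕ+ → HorizL2 d}
    (hU : ∀ n (φ : 𝓢(Horiz d, ℂ)),
      ∫ ξ, U n ξ * φ ξ = br s (Vv j 0) (𝓕⁻ φ) (profV ρeq (c n) (f n))) :
    ∑' n, ENNReal.ofReal (1 / c n ^ (2 * (μ + 1))) *
      ∫⁻ ξ, ENNReal.ofReal (lambdaSymbol d (s - (μ + 1 : ℕ)) ξ) ^ 2 * ‖U n ξ‖ₑ ^ 2 < ⊤ := by
  have ht : (0 : ℝ) ∈ Icc 0 T := ⟨le_rfl, hT.le⟩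
  obtain ⟨yw, hyw⟩ := exists_initial_jet hT hwreg
  obtain ⟨y, hy⟩ := exists_initial_jet hT hreg
  obtain ⟨a, ha⟩ := exists_reduction_profV hB hSL μ fun χ => isJet_sliceJet hy χ
  refine tsum_weighted_lt_top hd hSL.speed_pos (isBesselFamily_endProf hB hSL μ) (μ + 1) y a
    fun n φ => ?_
  rw [hU, br_eq_integral_sliceJet ((hV j).memLp 0 ht) (by simpa using hy 0 (Nat.zero_le _))
    ((hV j).rep 0 ht) _ ((hSL.isMode hB n).memLp_profV hB), ha]
  intro i hi
  rw [fourierInv_lapMul]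
  exact vanishesAtEnds_velocity hs hT hB hsol hV hw hcurl hμ j hyw hy
    (fun χ l hl hl' => vanishesAtEnds_of_trace_opT₂Star hB (hw.memLp 0 ht) hyw hl' (hw0 l hl) χ)
    _ i hi

end InitialDecay

end StratifiedFluid

end

/-- The hypothesis `hV0` is not needed: for a velocity without vertical vorticity,
`ΔV = -∇ ∂_z w` at `t = 0`, so that the traces of `V` vanish when those of `w` do. -/
theorem mainTheorem6
    {d : ℕ} (hd : d = 1 ∨ d = 2)
    (H g T s : ℝ) (hH : 0 < H) (hg : 0 < g) (hT : 0 < T) (hs : 0 ≤ s)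
    (k ν : ℕ) (hk : 1 ≤ k) (hν : ν = 2 * k ∨ ν = 2 * k + 1)
    -- the background stratification, of class `W^{ν,∞}`, with constant `N > 0`
    (ρeq : ℝ → ℝ) (hρcont : ContinuousOn ρeq (Icc (-H) 0))
    (hρpos : ∀ z ∈ Icc (-H) 0, 0 < ρeq z)
    (hρW : MemWInfty H ν ρeq)
    (hN : ∃ N : ℝ, 0 < N ∧ ∀ z ∈ Ioo (-H) 0, Nsq g ρeq z = N ^ 2)
    -- the vertical modes
    (c : ℕ+ → ℝ) (f : ℕ+ → ℝ → ℝ) (hSL : IsSturmLiouvilleBasis H g ρeq c f)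
    -- the solution of the linear equations
    (V : Fin d → ℝ → Horiz d × ℝ → ℝ) (w ρ P : ℝ → Horiz d × ℝ → ℝ)
    (hsol : IsLinearSolution H g T ρeq V w ρ P)
    (hVreg : ∀ i, IsContinuousIntoHsm H T s ν (V i))
    (hwreg : IsContinuousIntoHsm H T s ν w)
    (hρreg : IsContinuousIntoHsm H T s ν ρ)
    (hcurl : HasZeroVerticalVorticity H (fun i => V i 0))
    -- the compatibility conditions on the initial data at `z = -H` and `z = 0`
    (hV0 : ∀ l, 1 ≤ l → l ≤ k → ∀ i,
      HasZeroTrace H (2 * l - 1) (fun F => deriv ((opT₁ ρeq)^[l - 1] F)) (V i 0))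
    (hw0 : ∀ l ≤ k, HasZeroTrace H (2 * l) ((opT₂Star ρeq)^[l]) (w 0))
    (hρ0 : ∀ l ≤ k, 2 * l < ν → HasZeroTrace H (2 * l) ((opT₂ ρeq)^[l]) (ρ 0)) :
    ∀ t ∈ Icc 0 T,
      ∑' n : ℕ+, ENNReal.ofReal (1 / c n ^ (2 * ν)) *
        (sobolevNormSq (s - ν) (modeRho H g ρeq (f n) (ρ t)) +
          ∑ i, sobolevNormSq (s - ν) (modeV H ρeq (c n) (f n) (V i t)) +
          sobolevNormSq (s - ν) (modeW H g ρeq (f n) (w t))) < ⊤ := by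
  intro t ht
  have hd0 : d ≠ 0 := by omega
  have hν' : ν ≤ 2 * k + 1 := by omega
  -- Here `μ` counts the passages left for the velocity after its first one; `k ≥ 1` makes `ν`
  -- positive.
  obtain ⟨μ, rfl⟩ : ∃ μ, ν = μ + 1 := ⟨ν - 1, by omega⟩
  obtain ⟨b, N, hB⟩ := exists_isBackground hH hg hρcont hρpos hN
  choose Vv hV using fun i => (hVreg i).exists_isHsCurve
  obtain ⟨wv, hw⟩ := hwreg.exists_isHsCurve
  obtain ⟨ρv, hρ⟩ := hρreg.exists_isHsCurve
  choose Vh Wh Rh hVh hWh hRh hE using fun n =>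
    exists_modal_hats hd0 hs hT hB hsol hV hw hρ hcurl (hSL.isMode hB n)
  set I : HorizL2 d → ℝ≥0∞ := fun U =>
    ∫⁻ ξ, ENNReal.ofReal (lambdaSymbol d (s - (μ + 1 : ℕ)) ξ) ^ 2 * ‖U ξ‖ₑ ^ 2 with hI
  set q : ℕ+ → ℝ≥0∞ := fun n => ENNReal.ofReal (1 / c n ^ (2 * (μ + 1))) with hq
  set C := ENNReal.ofReal ((1 + N ^ 2) * (1 + 1 / N ^ 2)) with hC
  have sW : ∑' n, q n * I (Wh n 0) < ⊤ :=
    tsum_initial_w hd0 hT hB hSL hw hν' hwreg hw0 fun n φ => hWh n 0 φ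
  have sR : ∑' n, q n * I (Rh n 0) < ⊤ :=
    tsum_initial_rho hd0 hT hB hSL hρ hν' hρreg hρ0 fun n φ => hRh n 0 φ
  have sV : ∀ i, ∑' n, q n * I (Vh n i 0) < ⊤ := fun i =>
    tsum_initial_velocity hd0 hs hT hB hSL hsol hV hw hcurl hν' hwreg i (hVreg i) hw0
      fun n φ => hVh n i 0 φ
  -- The energy is conserved frequency by frequency, so it may be integrated against any Sobolev
  -- weight; `C` does not depend on `n`.
  have hle : ∀ n, sobolevNormSq (s - (μ + 1 : ℕ)) (modeRho H g ρeq (f n) (ρ t)) +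
      ∑ i, sobolevNormSq (s - (μ + 1 : ℕ)) (modeV H ρeq (c n) (f n) (V i t)) +
      sobolevNormSq (s - (μ + 1 : ℕ)) (modeW H g ρeq (f n) (w t)) ≤
      C * (I (Rh n 0) + ∑ i, I (Vh n i 0) + I (Wh n 0)) := fun n => by
    have hf := hSL.isMode hB n
    calc _ ≤ I (Rh n t) + ∑ i, I (Vh n i t) + I (Wh n t) :=
          add_le_add (add_le_add
            (sobolevNormSq_mode_le (hρ.memLp t ht) (hρ.rep t ht) (hf.memLp_profRho g)
              (modeRho_eq hB _ _) (hRh n t) _)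
            (Finset.sum_le_sum fun i _ => sobolevNormSq_mode_le ((hV i).memLp t ht)
              ((hV i).rep t ht) (hf.memLp_profV hB) (modeV_eq _ _ _) (hVh n i t) _))
            (sobolevNormSq_mode_le (hw.memLp t ht) (hw.rep t ht) (hf.memLp_profW hB)
              (modeW_eq hB _ _) (hWh n t) _)
      _ ≤ _ := by
        simp only [hI]
        rw [lintegral_energy _ (fun i => Vh n i t), lintegral_energy _ (fun i => Vh n i 0),
          ← lintegral_const_mul' _ _ ENNReal.ofReal_ne_top]
        refine lintegral_mono_ae ?_
        filter_upwards [hE n t ht] with ξ hξ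
        calc _ ≤ _ := mul_le_mul_right (energy_comparison hB.freq_pos hξ) _
          _ = _ := by ring
  calc _ ≤ ∑' n, C * (q n * I (Rh n 0) + ∑ i, q n * I (Vh n i 0) + q n * I (Wh n 0)) := by
        refine ENNReal.tsum_le_tsum fun n => (mul_le_mul_right (hle n) _).trans_eq ?_
        rw [← Finset.mul_sum]
        ring
    _ = C * (∑' n, q n * I (Rh n 0) + ∑ i, ∑' n, q n * I (Vh n i 0) +
        ∑' n, q n * I (Wh n 0)) := by
      rw [ENNReal.tsum_mul_left, ENNReal.tsum_add, ENNReal.tsum_add,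
        Summable.tsum_finsetSum fun i _ => ENNReal.summable]
    _ < ⊤ := ENNReal.mul_lt_top ENNReal.ofReal_lt_top
      (ENNReal.add_lt_top.2 ⟨ENNReal.add_lt_top.2 ⟨sR, ENNReal.sum_lt_top.2 fun i _ => sV i⟩, sW⟩)
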